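/- Work over $\mathbb C$. Let $v_3:\mathbb P^3\to\mathbb P^{19}$, $[t]\mapsto[t^\alpha]_{|\alpha|=3}$, be the triple Veronese embedding. For a subset $X\subset\mathbb P^{19}$ let $\sigma_k(X)\subset\mathbb P^{19}$ denote the $k$-th secant variety of $X$: the Zariski closure of the union of all $(k-1)$-planes spanned by $k$ points of $X$, with its reduced structure. A variety is smooth at one of its points if its local ring there is a regular local ring. Let $\mathbb P^2\subset\mathbb P^3$ be any $2$-plane. Then $\sigma_4(v_3(\mathbb P^3))\subset\mathbb P^{19}$ is smooth at every point of $\sigma_4(v_3(\mathbb P^2))\setminus\sigma_3(v_3(\mathbb P^3))$. Moreover, $\sigma_4(v_3(\mathbb P^2))$ equals the linear span $\langle v_3(\mathbb P^2)\rangle$, which is a $9$-plane in $\mathbb P^{19}$. -/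

import Mathlib

open scoped LinearAlgebra.Projectivization

/-- The multi-indices `α = (a₀, …, aₙ)` with `|α| = a₀ + ⋯ + aₙ = d`; they index the homogeneous
coordinates `s_α` of `ℙ^N`, `N = (n+d choose d) - 1`. -/
abbrev MultiIndex (n d : ℕ) : Type := {a : Fin (n + 1) → ℕ // ∑ i, a i = d}

/-- All monomials `t^α` of degree `d` in the coordinates of the vector `t`. -/
def veroneseVec (n d : ℕ) (t : Fin (n + 1) → ℂ) : MultiIndex n d → ℂ :=
  fun a => ∏ i, t i ^ a.1 i

theorem veroneseVec_smul (n d : ℕ) (c : ℂ) (t : Fin (n + 1) → ℂ) :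
    veroneseVec n d (c • t) = c ^ d • veroneseVec n d t := by
  funext a
  simp only [veroneseVec, Pi.smul_apply, smul_eq_mul, mul_pow, Finset.prod_mul_distrib]
  rw [Finset.prod_pow_eq_pow_sum, a.2]

theorem veroneseVec_ne_zero (n d : ℕ) {t : Fin (n + 1) → ℂ} (ht : t ≠ 0) :
    veroneseVec n d t ≠ 0 := by
  obtain ⟨i, hi⟩ := Function.ne_iff.mp ht
  intro h
  have h1 := congrFun h ⟨Pi.single i d, by simp⟩
  simp only [veroneseVec, Pi.zero_apply, Finset.prod_eq_zero_iff] at h1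
  obtain ⟨j, -, hj⟩ := h1
  rcases eq_or_ne j i with rfl | hji
  · exact hi (pow_eq_zero_iff_of_pos_or hj)
  · simp [Pi.single_eq_of_ne hji] at hj
where
  pow_eq_zero_iff_of_pos_or {x : ℂ} {m : ℕ} (h : x ^ m = 0) : x = 0 := by
    by_contra hx
    exact pow_ne_zero m hx h

/-- The `d`-uple Veronese embedding `v_d : ℙⁿ → ℙ^N`, `[t] ↦ [t^α]_{|α| = d}`. -/
noncomputable def veronese (n d : ℕ) :
    ℙ ℂ (Fin (n + 1) → ℂ) → ℙ ℂ (MultiIndex n d → ℂ) :=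
  Projectivization.lift
    (fun t => Projectivization.mk ℂ (veroneseVec n d t.1) (veroneseVec_ne_zero n d t.2))
    (by
      rintro ⟨a, ha⟩ ⟨b, hb⟩ c (rfl : a = c • b)
      rw [Projectivization.mk_eq_mk_iff']
      exact ⟨c ^ d, (veroneseVec_smul n d c b).symm⟩)

section ProjectiveVarieties

variable {σ : Type}

/-- The set of all nonzero vectors that represent a point of `X` (the punctured affine cone). -/
def puncturedCone (X : Set (ℙ ℂ (σ → ℂ))) : Set (σ → ℂ) :=
  {v | ∃ hv : v ≠ 0, Projectivization.mk ℂ v hv ∈ X}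

/-- The homogeneous ideal `I(X) ⊆ ℂ[s]` of a subset `X` of projective space: the polynomials that
vanish at every representative of every point of `X`. (As `ℂ` is infinite, a polynomial vanishes at
all multiples `c • v`, `c ≠ 0`, if and only if each of its homogeneous components vanishes
at `v`; hence this is the ideal generated by the homogeneous forms that vanish on `X`.) -/
noncomputable def homogIdeal (X : Set (ℙ ℂ (σ → ℂ))) : Ideal (MvPolynomial σ ℂ) :=
  MvPolynomial.vanishingIdeal ℂ (puncturedCone X)

/-- The Zariski closure of a subset of projective space: the points at which every
element of `I(X)` vanishes. -/
def zariskiClosure (X : Set (ℙ ℂ (σ → ℂ))) : Set (ℙ ℂ (σ → ℂ)) :=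
  {p | homogIdeal X ≤ homogIdeal {p}}

/-- The `k`-th secant variety `σ_k(X)`: the Zariski closure of the union of all `(k-1)`-planes
that are spanned by `k` points of `X`. -/
def secantVariety (k : ℕ) (X : Set (ℙ ℂ (σ → ℂ))) : Set (ℙ ℂ (σ → ℂ)) :=
  zariskiClosure {p | ∃ x : Fin k → ℙ ℂ (σ → ℂ), (∀ i, x i ∈ X) ∧
    Projectivization.Independent x ∧ p ∈ Projectivization.Subspace.span (Set.range x)}

/-- The homogeneous ideal of a point is prime. -/
instance homogIdeal_singleton_isPrime (p : ℙ ℂ (σ → ℂ)) : (homogIdeal {p}).IsPrime := by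
  let φ : MvPolynomial σ ℂ →ₐ[ℂ] Polynomial ℂ :=
    MvPolynomial.aeval fun i => Polynomial.C (p.rep i) * Polynomial.X
  have hφ : ∀ (f : MvPolynomial σ ℂ) (c : ℂ),
      (φ f).eval c = MvPolynomial.aeval (c • p.rep) f := by
    intro f c
    have : (Polynomial.aeval c).comp φ = MvPolynomial.aeval (c • p.rep) := by
      ext i
      simp only [φ, AlgHom.comp_apply, MvPolynomial.aeval_X, Pi.smul_apply, smul_eq_mul, map_mul,
        Polynomial.aeval_C, Polynomial.aeval_X, Algebra.algebraMap_self_apply]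
      ring
    rw [← this]
    simp [Polynomial.coe_aeval_eq_eval]
  have key : homogIdeal {p} = RingHom.ker φ := by
    ext f
    rw [RingHom.mem_ker, homogIdeal, MvPolynomial.mem_vanishingIdeal_iff]
    constructor
    · intro h
      refine Polynomial.eq_zero_of_infinite_isRoot _
        (Set.Infinite.mono (s := {c : ℂ | c ≠ 0}) ?_ (Set.finite_singleton (0 : ℂ)).infinite_compl)
      intro c hc
      change (φ f).eval c = 0
      rw [hφ]
      refine h _ ⟨smul_ne_zero hc p.rep_nonzero, ?_⟩
      rw [Set.mem_singleton_iff]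
      conv_rhs => rw [← p.mk_rep]
      rw [Projectivization.mk_eq_mk_iff']
      exact ⟨c, rfl⟩
    · rintro h v ⟨hv, hvp⟩
      rw [Set.mem_singleton_iff, ← p.mk_rep, Projectivization.mk_eq_mk_iff'] at hvp
      obtain ⟨c, rfl⟩ := hvp
      rw [← hφ, h, Polynomial.eval_zero]
  rw [key]
  exact RingHom.ker_isPrime _

/-- The grading of `ℂ[s]` by degree. -/
noncomputable instance homogeneousGrading :
    GradedAlgebra (MvPolynomial.homogeneousSubmodule σ ℂ) :=
  MvPolynomial.gradedAlgebra

/-- The local ring `𝒪_{ℙ,p}` of projective space at `p`: the fractions `f / g` of homogeneous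
polynomials of the same degree with `g(p) ≠ 0`. -/
abbrev ProjLocalRing (p : ℙ ℂ (σ → ℂ)) : Type :=
  HomogeneousLocalization.AtPrime (MvPolynomial.homogeneousSubmodule σ ℂ) (homogIdeal {p})

/-- The ideal of `X` in `𝒪_{ℙ,p}`: the fractions `f / g` of degree zero that lie in the
localization of `I(X)`. -/
noncomputable def localIdeal (X : Set (ℙ ℂ (σ → ℂ))) (p : ℙ ℂ (σ → ℂ)) :
    Ideal (ProjLocalRing p) :=
  ((homogIdeal X).map
      (algebraMap (MvPolynomial σ ℂ) (Localization.AtPrime (homogIdeal {p})))).comap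
    (algebraMap (ProjLocalRing p) (Localization.AtPrime (homogIdeal {p})))

/-- The local ring `𝒪_{X,p}` of the projective variety `X` (a Zariski closed set with its reduced
structure) at `p`. It is the zero ring when `p` does not lie on `X`. -/
abbrev VarietyLocalRing (X : Set (ℙ ℂ (σ → ℂ))) (p : ℙ ℂ (σ → ℂ)) : Type :=
  ProjLocalRing p ⧸ localIdeal X p

/-- The projective variety `X` is smooth (non-singular) at `p`: the point `p` lies on `X` and
`𝒪_{X,p}` is a regular local ring. -/
def IsSmoothAt (X : Set (ℙ ℂ (σ → ℂ))) (p : ℙ ℂ (σ → ℂ)) : Prop :=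
  p ∈ X ∧ IsRegularLocalRing (VarietyLocalRing X p)

end ProjectiveVarieties

/-! A linear substitution moves the plane to `t 3 = 0`. The span of its cubes is then the space of
plane cubics, those whose coordinates `idx i j 3` all vanish.

Equations. The slices of a sum of four cubes have the form `Tᵀ * diagonal d * T`, so `B * adj A * C`
is symmetric for any three combinations `A`, `B`, `C` of slices. The entries of its skew part
(`bracket`) are therefore quintics vanishing on σ₄ (`bracket_transpose_mul_diagonal_mul`). They are
affine in the corner entry `A 3 3`, with leading coefficient the same bracket of the upper left `3 ×
3` blocks (`bracket_castSucc`). For the slices of a cubic this coefficient is its Aronhold invariant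
or the variant `aronhold'`, and the two agree on plane cubics. Where both are nonzero, four such
equations express the four coordinates of degree at least two in `t 3` rationally through the
sixteen others (`lift_eq_self`). Conversely, a tangent space computation at four points in general
position shows that sums of four cubes reach an open set of values of these sixteen coordinates
(`exists_isOpen_sum_veroneseVec`). So near such a plane cubic σ₄ is a graph over a space of
projective dimension 15.

Algebraically, the fifteen affine coordinates generate the maximal ideal of the local ring
(`idx_three_mem`), and a chain of linear sections of the graph gives sixteen primes, hence dimension
at least 15 (`le_ringKrullDim_secantVariety`). Regularity follows.

The Aronhold invariant is nonzero off σ₃. Suppose that it vanishes. If the Hessian is not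
identically zero, the commutation relations make the cubic into a commutative associative algebra of
dimension three with a nondegenerate invariant form. Such an algebra is generated by one element, so
the cubic is given by a sequence `m (i + j + k)` with a linear recurrence of order three. If the
Hessian vanishes identically, the cubic is a cone and a similar description holds. Perturbing the
recurrence to have distinct roots exhibits the cubic as a limit of sums of three cubes
(`mem_closure_cubeSums_of_aronhold_eq_zero`).

The open set above, restricted to the plane, also shows that four cubes fill the space of plane
cubics (`secantVariety_eq_span`). -/

namespace VeroneseCubic

/-! ### Coordinates of quaternary cubics and linear substitutions -/

open MvPolynomial Matrix

/-- The index set of the twenty coordinates of the space of quaternary cubics. -/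
abbrev MI : Type := MultiIndex 3 3

/-- The multi-index of the monomial `t i * t j * t k`. -/
def idx (i j k : Fin 4) : MI :=
  ⟨Pi.single i 1 + Pi.single j 1 + Pi.single k 1, by simp [Finset.sum_add_distrib]⟩

theorem idx_swap_left (i j k : Fin 4) : idx j i k = idx i j k :=
  Subtype.ext (by simp only [idx]; abel)

theorem idx_swap_right (i j k : Fin 4) : idx i k j = idx i j k :=
  Subtype.ext (by simp only [idx]; abel)

theorem exists_eq_add_single {n : ℕ} (a : Fin 4 → ℕ) (h : ∑ i, a i = n + 1) :
    ∃ (i : Fin 4) (b : Fin 4 → ℕ), a = b + Pi.single i 1 ∧ ∑ i, b i = n := by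
  obtain ⟨i, -, hi⟩ : ∃ i ∈ Finset.univ, a i ≠ 0 := by
    by_contra! hc
    rw [Finset.sum_eq_zero hc] at h
    omega
  have hab : a = (a - Pi.single i 1) + Pi.single i 1 := by
    funext j
    rcases eq_or_ne j i with rfl | hj
    · simp; omega
    · simp [Pi.single_eq_of_ne hj]
  refine ⟨i, a - Pi.single i 1, hab, ?_⟩
  rw [hab] at h
  simp only [Pi.add_apply, Finset.sum_add_distrib] at h
  simpa using h

theorem exists_idx (α : MI) : ∃ i j k, α = idx i j k := by
  obtain ⟨a, ha⟩ := α
  obtain ⟨k, b, rfl, hb⟩ := exists_eq_add_single a ha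
  obtain ⟨j, c, rfl, hc⟩ := exists_eq_add_single b hb
  obtain ⟨i, d, rfl, hd⟩ := exists_eq_add_single c hc
  have : d = 0 := by
    funext l
    exact (Finset.sum_eq_zero_iff.mp hd) l (Finset.mem_univ l)
  exact ⟨i, j, k, Subtype.ext (by simp [idx, this])⟩

instance : Finite MI :=
  Finite.of_surjective (fun p : Fin 4 × Fin 4 × Fin 4 => idx p.1 p.2.1 p.2.2) fun α => by
    obtain ⟨i, j, k, rfl⟩ := exists_idx α
    exact ⟨(i, j, k), rfl⟩

noncomputable instance : Fintype MI := Fintype.ofFinite _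

@[simp] theorem veroneseVec_idx (t : Fin 4 → ℂ) (i j k : Fin 4) :
    veroneseVec 3 3 t (idx i j k) = t i * t j * t k := by
  simp only [veroneseVec, idx, Pi.add_apply, pow_add, Finset.prod_mul_distrib]
  have h (l : Fin 4) : ∏ x, t x ^ (Pi.single l 1 : Fin 4 → ℕ) x = t l := by
    rw [Finset.prod_eq_single l] <;> simp +contextual
  rw [h, h, h]

section Tri

variable {R R' : Type*} [CommRing R] [Algebra ℂ R] [CommRing R'] [Algebra ℂ R']

/-- The symmetric trilinear form on the space of linear forms defined by the coordinates `s`,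
as a linear function of `s`. -/
noncomputable def tri (a b c : Fin 4 → ℂ) : (MI → R) →ₗ[ℂ] R :=
  ∑ i, ∑ j, ∑ k, (a i * b j * c k) • LinearMap.proj (idx i j k)

theorem tri_apply (a b c : Fin 4 → ℂ) (s : MI → R) :
    tri a b c s = ∑ i, ∑ j, ∑ k, (a i * b j * c k) • s (idx i j k) := by
  simp [tri, LinearMap.sum_apply]

theorem map_tri (φ : R →ₐ[ℂ] R') (a b c : Fin 4 → ℂ) (s : MI → R) :
    φ (tri a b c s) = tri a b c (fun α => φ (s α)) := by
  simp [tri_apply, map_sum, map_smul]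

theorem tri_veroneseVec (a b c t : Fin 4 → ℂ) :
    tri a b c (veroneseVec 3 3 t) = (a ⬝ᵥ t) * (b ⬝ᵥ t) * (c ⬝ᵥ t) := by
  simp only [tri_apply, veroneseVec_idx, dotProduct, smul_eq_mul]
  rw [Finset.sum_mul_sum, Finset.sum_mul]
  refine Finset.sum_congr rfl fun i _ => ?_
  rw [Finset.sum_mul]
  refine Finset.sum_congr rfl fun j _ => ?_
  rw [Finset.mul_sum]
  exact Finset.sum_congr rfl fun k _ => by ring

/-- A functional that kills all the vectors of monomials is a cubic polynomial vanishing at every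
point, so its coefficients are zero. -/
theorem span_range_veroneseVec :
    Submodule.span ℂ (Set.range (veroneseVec 3 3)) = ⊤ := by
  by_contra hne
  obtain ⟨φ, hφ, hle⟩ := Submodule.exists_le_ker_of_lt_top _ (lt_top_iff_ne_top.mpr hne)
  apply hφ
  set Q : MvPolynomial (Fin 4) ℂ :=
    ∑ α : MI, monomial (Finsupp.equivFunOnFinite.symm α.1) (φ (Pi.single α 1)) with hQ
  have hQ0 : Q = 0 := by
    refine MvPolynomial.funext fun t => ?_
    have h1 : φ (veroneseVec 3 3 t) = 0 := hle (Submodule.subset_span ⟨t, rfl⟩)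
    rw [LinearMap.pi_apply_eq_sum_univ φ] at h1
    rw [hQ, map_sum, map_zero, ← h1]
    refine Finset.sum_congr rfl fun α _ => ?_
    rw [eval_monomial, Finsupp.prod_fintype _ _ (by simp)]
    simp only [veroneseVec, Finsupp.equivFunOnFinite_symm_apply_apply, smul_eq_mul]
    rw [mul_comm]
    congr 2
    funext β
    simp [Pi.single_apply, eq_comm]
  refine LinearMap.pi_ext' fun α => LinearMap.ext_ring ?_
  have h2 := congrArg (coeff (Finsupp.equivFunOnFinite.symm α.1)) hQ0
  simpa [hQ, coeff_sum, coeff_monomial, Subtype.val_inj, eq_comm] using h2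

/-- This reduces identities for `act` to cubes, where `act g` is just `g` applied to the point; in
particular the choices made in `rep` do not matter. -/
theorem linearMap_ext_veronese {M : Type*} [AddCommGroup M] [Module ℂ M]
    {φ ψ : (MI → ℂ) →ₗ[ℂ] M} (h : ∀ t, φ (veroneseVec 3 3 t) = ψ (veroneseVec 3 3 t)) : φ = ψ := by
  apply LinearMap.ext_on_range (v := veroneseVec 3 3) span_range_veroneseVec h

/-- A triple of indices that represents a multi-index. -/
noncomputable def rep (α : MI) : Fin 4 × Fin 4 × Fin 4 :=
  ((exists_idx α).choose, (exists_idx α).choose_spec.choose,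
    (exists_idx α).choose_spec.choose_spec.choose)

theorem idx_rep (α : MI) : idx (rep α).1 (rep α).2.1 (rep α).2.2 = α :=
  (exists_idx α).choose_spec.choose_spec.choose_spec.symm

/-- The linear substitution on cubics that is induced by a `4 × 4` matrix. -/
noncomputable def act (g : Matrix (Fin 4) (Fin 4) ℂ) : (MI → R) →ₗ[ℂ] (MI → R) :=
  LinearMap.pi fun α => tri (g (rep α).1) (g (rep α).2.1) (g (rep α).2.2)

theorem act_apply (g : Matrix (Fin 4) (Fin 4) ℂ) (s : MI → R) (α : MI) :
    act g s α = tri (g (rep α).1) (g (rep α).2.1) (g (rep α).2.2) s := rfl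

theorem map_act (φ : R →ₐ[ℂ] R') (g : Matrix (Fin 4) (Fin 4) ℂ) (s : MI → R) (α : MI) :
    φ (act g s α) = act g (fun β => φ (s β)) α := by
  rw [act_apply, act_apply, map_tri]

theorem act_veroneseVec (g : Matrix (Fin 4) (Fin 4) ℂ) (t : Fin 4 → ℂ) :
    act g (veroneseVec 3 3 t) = veroneseVec 3 3 (g *ᵥ t) := by
  funext α
  rw [act_apply, tri_veroneseVec]
  conv_rhs => rw [← idx_rep α, veroneseVec_idx]
  rfl

theorem act_act (g h : Matrix (Fin 4) (Fin 4) ℂ) (s : MI → ℂ) :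
    act g (act h s) = act (g * h) s := by
  have : (act g).comp (act h) = act (R := ℂ) (g * h) :=
    linearMap_ext_veronese fun t => by simp [act_veroneseVec]
  exact LinearMap.congr_fun this s

theorem act_one (s : MI → ℂ) : act 1 s = s := by
  have : act (R := ℂ) 1 = LinearMap.id :=
    linearMap_ext_veronese fun t => by simp [act_veroneseVec]
  exact LinearMap.congr_fun this s

end Tri

end VeroneseCubic

/-! ### Secant varieties in terms of sums of cubes -/

namespace VeroneseCubic

open MvPolynomial Matrix Projectivization

section Closure

variable {σ : Type}

theorem homogIdeal_anti {X Y : Set (ℙ ℂ (σ → ℂ))} (h : X ⊆ Y) : homogIdeal Y ≤ homogIdeal X :=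
  vanishingIdeal_anti_mono fun _ ⟨hv, hx⟩ => ⟨hv, h hx⟩

theorem homogIdeal_zariskiClosure (X : Set (ℙ ℂ (σ → ℂ))) :
    homogIdeal (zariskiClosure X) = homogIdeal X := by
  refine le_antisymm (homogIdeal_anti fun p hp => homogIdeal_anti (by simpa using hp)) ?_
  rintro f hf v ⟨hv, hp⟩
  exact hp hf v ⟨hv, rfl⟩

theorem mem_homogIdeal_singleton {v : σ → ℂ} (hv : v ≠ 0) {f : MvPolynomial σ ℂ} :
    f ∈ homogIdeal {mk ℂ v hv} ↔ ∀ c : ℂ, c ≠ 0 → aeval (c • v) f = 0 := by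
  constructor
  · intro h c hc
    exact h _ ⟨smul_ne_zero hc hv, by
      rw [Set.mem_singleton_iff, mk_eq_mk_iff']; exact ⟨c, rfl⟩⟩
  · rintro h w ⟨hw, hwv⟩
    rw [Set.mem_singleton_iff, mk_eq_mk_iff'] at hwv
    obtain ⟨c, rfl⟩ := hwv
    exact h c (left_ne_zero_of_smul hw)

end Closure

/-- The linear combinations of `k` linearly independent vectors `veroneseVec 3 3 t`, `t ∈ T`. -/
def cubeSums (k : ℕ) (T : Submodule ℂ (Fin 4 → ℂ)) : Set (MI → ℂ) :=
  {s | ∃ (b : Fin k → ℂ) (t : Fin k → Fin 4 → ℂ), (∀ i, t i ∈ T) ∧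
    LinearIndependent ℂ (fun i => veroneseVec 3 3 (t i)) ∧ s = ∑ i, b i • veroneseVec 3 3 (t i)}

theorem smul_mem_cubeSums {k : ℕ} {T : Submodule ℂ (Fin 4 → ℂ)} {s : MI → ℂ}
    (hs : s ∈ cubeSums k T) (c : ℂ) : c • s ∈ cubeSums k T := by
  obtain ⟨b, t, ht, hli, rfl⟩ := hs
  exact ⟨c • b, t, ht, hli, by simp [Finset.smul_sum, smul_smul]⟩

theorem veroneseVec_zero : veroneseVec 3 3 0 = 0 := by
  have := veroneseVec_smul 3 3 0 0
  simpa using this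

theorem ne_zero_of_veroneseVec_ne_zero {t : Fin 4 → ℂ} (h : veroneseVec 3 3 t ≠ 0) : t ≠ 0 := by
  rintro rfl
  exact h veroneseVec_zero

theorem mk_mem_secantSet_iff {k : ℕ} (P : Projectivization.Subspace ℂ (Fin 4 → ℂ)) {s : MI → ℂ} (hs : s ≠ 0) :
    (∃ x : Fin k → ℙ ℂ (MI → ℂ), (∀ i, x i ∈ veronese 3 3 '' (P : Set (ℙ ℂ (Fin 4 → ℂ)))) ∧
      Independent x ∧ mk ℂ s hs ∈ Subspace.span (Set.range x)) ↔
    s ∈ cubeSums k (Subspace.submodule P) := by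
  constructor
  · rintro ⟨_, hx, ⟨f, hf, hl⟩, hp⟩
    have hmem : ∀ i, ∃ (c : ℂ) (t : Fin 4 → ℂ), t ∈ Subspace.submodule P ∧
        f i = c • veroneseVec 3 3 t := by
      intro i
      obtain ⟨q, hq, hqx⟩ := hx i
      induction q using Projectivization.ind with | h t ht =>
      change mk ℂ (veroneseVec 3 3 t) _ = _ at hqx
      obtain ⟨c, hc⟩ := (mk_eq_mk_iff' ..).mp hqx.symm
      exact ⟨c, t, (Subspace.mem_submodule_iff P ht).mpr hq, hc.symm⟩
    choose c t ht hft using hmem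
    have hc (i) : c i ≠ 0 := fun h0 => hf i (by rw [hft, h0, zero_smul])
    have h1 := (Subspace.mem_span _).mp hp (Submodule.projectivization
      (Submodule.span ℂ (Set.range f))) (by
        rintro _ ⟨i, rfl⟩
        exact (Submodule.mk_mem_projectivization_iff _ (hf i)).mpr
          (Submodule.subset_span ⟨i, rfl⟩))
    rw [Submodule.mk_mem_projectivization_iff, Submodule.mem_span_range_iff_exists_fun] at h1
    obtain ⟨b, rfl⟩ := h1
    refine ⟨fun i => b i * c i, t, ht, ?_, ?_⟩
    · have h2 : (fun i => veroneseVec 3 3 (t i)) = (fun i => (Units.mk0 (c i) (hc i))⁻¹) • f := by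
        funext i
        change _ = (Units.mk0 (c i) (hc i))⁻¹ • f i
        rw [hft, Units.smul_def, smul_smul]
        simp [hc i]
      rw [h2]
      exact hl.units_smul _
    · exact Finset.sum_congr rfl fun i _ => by rw [hft, smul_smul]
  · rintro ⟨b, t, ht, hli, hst⟩
    have h0 (i) : t i ≠ 0 := ne_zero_of_veroneseVec_ne_zero (hli.ne_zero i)
    refine ⟨fun i => mk ℂ (veroneseVec 3 3 (t i)) (hli.ne_zero i), fun i =>
      ⟨mk ℂ (t i) (h0 i), (Subspace.mem_submodule_iff P (h0 i)).mp (ht i), rfl⟩,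
      ⟨_, _, hli⟩, ?_⟩
    rw [← Subspace.mem_submodule_iff, hst]
    refine Submodule.sum_mem _ fun i _ => Submodule.smul_mem _ _ ?_
    rw [Subspace.mem_submodule_iff _ (hli.ne_zero i)]
    exact Subspace.subset_span _ ⟨i, rfl⟩

theorem mem_homogIdeal_secantVariety {k : ℕ} {P : Projectivization.Subspace ℂ (Fin 4 → ℂ)}
    {f : MvPolynomial MI ℂ} :
    f ∈ homogIdeal (secantVariety k (veronese 3 3 '' (P : Set (ℙ ℂ (Fin 4 → ℂ))))) ↔
      ∀ s ∈ cubeSums k (Subspace.submodule P), s ≠ 0 → aeval s f = 0 := by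
  rw [secantVariety, homogIdeal_zariskiClosure]
  exact ⟨fun h s hs h0 => h s ⟨h0, (mk_mem_secantSet_iff P h0).mpr hs⟩,
    fun h s ⟨h0, hs⟩ => h s ((mk_mem_secantSet_iff P h0).mp hs) h0⟩

/-- The test polynomials need not be homogeneous, so vanishing at a point means vanishing at every
nonzero multiple of a representative. -/
theorem mk_mem_secantVariety {k : ℕ} {P : Projectivization.Subspace ℂ (Fin 4 → ℂ)} {v : MI → ℂ} (hv : v ≠ 0) :
    mk ℂ v hv ∈ secantVariety k (veronese 3 3 '' (P : Set (ℙ ℂ (Fin 4 → ℂ)))) ↔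
      ∀ f : MvPolynomial MI ℂ, (∀ s ∈ cubeSums k (Subspace.submodule P), s ≠ 0 → aeval s f = 0) →
        ∀ c : ℂ, c ≠ 0 → aeval (c • v) f = 0 := by
  have : mk ℂ v hv ∈ secantVariety k (veronese 3 3 '' (P : Set (ℙ ℂ (Fin 4 → ℂ)))) ↔
      homogIdeal (secantVariety k (veronese 3 3 '' (P : Set (ℙ ℂ (Fin 4 → ℂ))))) ≤
        homogIdeal {mk ℂ v hv} := by
    conv_rhs => rw [secantVariety, homogIdeal_zariskiClosure]
    rfl
  rw [this]
  constructor
  · intro h f hf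
    exact (mem_homogIdeal_singleton hv).mp (h (mem_homogIdeal_secantVariety.mpr hf))
  · intro h f hf
    exact (mem_homogIdeal_singleton hv).mpr (h f (mem_homogIdeal_secantVariety.mp hf))

theorem range_veronese : Set.range (veronese 3 3) =
    veronese 3 3 '' ((⊤ : Projectivization.Subspace ℂ (Fin 4 → ℂ)) : Set (ℙ ℂ (Fin 4 → ℂ))) := by
  have : ((⊤ : Projectivization.Subspace ℂ (Fin 4 → ℂ)) : Set (ℙ ℂ (Fin 4 → ℂ))) = Set.univ := by
    rw [← Subspace.span_univ, Set.eq_univ_iff_forall]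
    exact fun x => Subspace.subset_span _ (Set.mem_univ x)
  rw [this, Set.image_univ]

theorem continuous_aeval' {σ : Type*} (f : MvPolynomial σ ℂ) :
    Continuous fun s : σ → ℂ => aeval s f := by
  simpa [MvPolynomial.coe_aeval_eq_eval] using MvPolynomial.continuous_eval f

/-- The Zariski closure contains the closure in the classical topology. -/
theorem mk_mem_secantVariety_of_mem_closure {k : ℕ} {P : Projectivization.Subspace ℂ (Fin 4 → ℂ)} {v : MI → ℂ}
    (hv : v ≠ 0) (h : v ∈ closure (cubeSums k (Subspace.submodule P))) :
    mk ℂ v hv ∈ secantVariety k (veronese 3 3 '' (P : Set (ℙ ℂ (Fin 4 → ℂ)))) := by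
  rw [mk_mem_secantVariety]
  intro f hf c hc
  have h1 : v ∈ closure ({s | s ≠ 0} ∩ cubeSums k (Subspace.submodule P)) :=
    isOpen_ne.inter_closure ⟨hv, h⟩
  have h2 : closure ({s | s ≠ 0} ∩ cubeSums k (Subspace.submodule P)) ⊆
      {s | aeval (c • s) f = 0} := by
    refine closure_minimal ?_ (isClosed_eq ((continuous_aeval' f).comp (continuous_const_smul c))
      continuous_const)
    exact fun s ⟨h0, hs⟩ => hf _ (smul_mem_cubeSums hs c) (smul_ne_zero hc h0)
  exact h2 h1

end VeroneseCubic

/-! ### Local rings of projective space: dehomogenization, maximal ideal, dimension bound -/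

namespace VeroneseCubic

open MvPolynomial Projectivization

theorem aeval_smul_of_isHomogeneous {σ : Type*} {n : ℕ} {f : MvPolynomial σ ℂ}
    (hf : f.IsHomogeneous n) (c : ℂ) (v : σ → ℂ) : aeval (c • v) f = c ^ n * aeval v f := by
  conv_lhs => rw [f.as_sum]
  conv_rhs => rw [f.as_sum]
  rw [map_sum, map_sum, Finset.mul_sum]
  refine Finset.sum_congr rfl fun d hd => ?_
  have hdn : d.degree = n := by
    have := hf (mem_support_iff.mp hd)
    rwa [Finsupp.degree_eq_weight_one]
  rw [aeval_monomial, aeval_monomial, ← hdn, Finsupp.degree_apply, Finsupp.prod, Finsupp.prod,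
    mul_left_comm, ← Finset.prod_pow_eq_pow_sum, ← Finset.prod_mul_distrib]
  simp only [Pi.smul_apply, smul_eq_mul, mul_pow]

section LocalRing

variable {σ : Type} (p : ℙ ℂ (σ → ℂ)) (L : MvPolynomial σ ℂ) (hL : L.IsHomogeneous 1)
  (hLp : L ∉ homogIdeal {p})

/-- The fraction `f / L ^ n` for a form `f` of degree `n`. -/
noncomputable def frac {n : ℕ} (f : MvPolynomial σ ℂ) (hf : f.IsHomogeneous n) : ProjLocalRing p :=
  HomogeneousLocalization.mk
    { deg := n
      num := ⟨f, hf⟩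
      den := ⟨L ^ n, by simpa using hL.pow n⟩
      den_mem := (homogIdeal {p}).primeCompl.pow_mem hLp n }

/-- The localization of the polynomial ring at the homogeneous ideal of a point. -/
abbrev Loc : Type := Localization.AtPrime (homogIdeal {p})

include hLp in
theorem isUnit_algebraMap_form : IsUnit (algebraMap _ (Loc p) L) :=
  IsLocalization.map_units (Loc p) (⟨L, hLp⟩ : (homogIdeal {p}).primeCompl)

theorem val_frac {n : ℕ} (f : MvPolynomial σ ℂ) (hf : f.IsHomogeneous n) :
    (frac p L hL hLp f hf).val * algebraMap _ (Loc p) L ^ n = algebraMap _ (Loc p) f := by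
  rw [frac, HomogeneousLocalization.val_mk, ← map_pow]
  exact Localization.mk_eq_mk' (M := (homogIdeal {p}).primeCompl) ▸ IsLocalization.mk'_spec _ _ _

/-- Dehomogenization with respect to the linear form `L`. -/
noncomputable def dehom : MvPolynomial σ ℂ →+* ProjLocalRing p :=
  eval₂Hom ((HomogeneousLocalization.fromZeroRingHom (homogeneousSubmodule σ ℂ) _).comp
    (algebraMap ℂ (homogeneousSubmodule σ ℂ 0)))
    fun i => frac p L hL hLp (X i) (isHomogeneous_X ℂ i)

theorem val_dehom {n : ℕ} (f : MvPolynomial σ ℂ) (hf : f.IsHomogeneous n) :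
    (dehom p L hL hLp f).val * algebraMap _ (Loc p) L ^ n = algebraMap _ (Loc p) f := by
  have h1 : (dehom p L hL hLp f).val = ((algebraMap (ProjLocalRing p) (Loc p)).comp
    (dehom p L hL hLp)) f := rfl
  rw [h1]
  conv_rhs => rw [f.as_sum]
  conv_lhs => rw [f.as_sum]
  rw [map_sum, map_sum, Finset.sum_mul]
  refine Finset.sum_congr rfl fun d hd => ?_
  have hdn : d.degree = n := by
    have := hf (mem_support_iff.mp hd)
    rwa [Finsupp.degree_eq_weight_one]
  rw [← hdn, Finsupp.degree_apply, Finset.prod_pow_eq_pow_sum _ _ _ |>.symm, RingHom.comp_apply, dehom,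
    coe_eval₂Hom, eval₂_monomial, monomial_eq, map_mul, map_mul, mul_assoc]
  congr 1
  rw [Finsupp.prod, Finsupp.prod, map_prod, map_prod, ← Finset.prod_mul_distrib]
  refine Finset.prod_congr rfl fun i _ => ?_
  rw [map_pow, map_pow, ← mul_pow]
  congr 1
  simpa using val_frac p L hL hLp (X i) (isHomogeneous_X ℂ i)


theorem dehom_self : dehom p L hL hLp L = 1 := by
  have h := val_dehom p L hL hLp L hL
  rw [pow_one] at h
  apply HomogeneousLocalization.val_injective
  rw [HomogeneousLocalization.val_one]
  exact (isUnit_algebraMap_form p L hLp).mul_eq_right.mp h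

theorem dehom_mem_localIdeal {n : ℕ} {f : MvPolynomial σ ℂ} (hf : f.IsHomogeneous n)
    {Y : Set (ℙ ℂ (σ → ℂ))} (hY : f ∈ homogIdeal Y) : dehom p L hL hLp f ∈ localIdeal Y p := by
  rw [localIdeal, Ideal.mem_comap]
  have h := val_dehom p L hL hLp f hf
  have hm := Ideal.mem_map_of_mem (algebraMap _ (Loc p)) hY
  rw [← h] at hm
  exact (Ideal.mul_unit_mem_iff_mem _ ((isUnit_algebraMap_form p L hLp).pow n)).mp hm

theorem isUnit_dehom_of_notMem {n : ℕ} {f : MvPolynomial σ ℂ} (hf : f.IsHomogeneous n)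
    (hfp : f ∉ homogIdeal {p}) : IsUnit (dehom p L hL hLp f) := by
  rw [← HomogeneousLocalization.isUnit_iff_isUnit_val]
  have h := val_dehom p L hL hLp f hf
  exact isUnit_of_mul_isUnit_left (h ▸ isUnit_algebraMap_form p f hfp)

theorem dehom_mem_maximalIdeal {n : ℕ} {f : MvPolynomial σ ℂ} (hf : f.IsHomogeneous n)
    (hfp : f ∈ homogIdeal {p}) :
    dehom p L hL hLp f ∈ IsLocalRing.maximalIdeal (ProjLocalRing p) := by
  rw [IsLocalRing.mem_maximalIdeal, mem_nonunits_iff,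
    ← HomogeneousLocalization.isUnit_iff_isUnit_val]
  intro hu
  have h := hu.mul ((isUnit_algebraMap_form p L hLp).pow n)
  rw [val_dehom p L hL hLp f hf] at h
  exact ((IsLocalization.AtPrime.isUnit_to_map_iff (Loc p) (homogIdeal {p}) f).mp h) hfp

/-- Every element of the local ring is a quotient of dehomogenized polynomials. -/
theorem exists_dehom_mul_eq (x : ProjLocalRing p) : ∃ f g : MvPolynomial σ ℂ,
    IsUnit (dehom p L hL hLp g) ∧ dehom p L hL hLp g * x = dehom p L hL hLp f := by
  obtain ⟨c, rfl⟩ := HomogeneousLocalization.mk_surjective x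
  obtain ⟨n, ⟨f, hf⟩, ⟨g, hg⟩, hgp⟩ := c
  refine ⟨f, g, isUnit_dehom_of_notMem p L hL hLp hg hgp, ?_⟩
  apply HomogeneousLocalization.val_injective
  apply ((isUnit_algebraMap_form p L hLp).pow n).mul_left_injective
  simp only
  rw [val_dehom p L hL hLp f hf, HomogeneousLocalization.val_mul, mul_right_comm,
    val_dehom p L hL hLp g hg, HomogeneousLocalization.val_mk, mul_comm]
  exact Localization.mk_eq_mk' (M := (homogIdeal {p}).primeCompl) ▸ IsLocalization.mk'_spec _ _ _

-- By `exists_dehom_mul_eq` the local ring is a quotient of a localization of a polynomial ring in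
-- finitely many variables.
include hL hLp in
theorem isNoetherianRing_projLocalRing [Finite σ] : IsNoetherianRing (ProjLocalRing p) := by
  let M := (IsUnit.submonoid (ProjLocalRing p)).comap (dehom p L hL hLp)
  have hM (y : M) : IsUnit (dehom p L hL hLp y) := y.2
  have : IsNoetherianRing (Localization M) :=
    IsLocalization.isNoetherianRing M (Localization M) inferInstance
  refine isNoetherianRing_of_surjective (Localization M) _
    (IsLocalization.lift (M := M) (S := Localization M) (g := dehom p L hL hLp) hM) ?_
  rw [IsLocalization.lift_surjective_iff]
  intro x
  obtain ⟨f, g, hg, h⟩ := exists_dehom_mul_eq p L hL hLp x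
  exact ⟨(f, ⟨g, hg⟩), by rw [mul_comm]; exact h⟩

/-- Modulo this ideal each variable equals its value at `v`, so the quotient map factors through
evaluation. -/
theorem sub_C_aeval_mem (v : σ → ℂ) (f : MvPolynomial σ ℂ) :
    f - C (aeval v f) ∈ Ideal.span (Set.range fun i => (X i - C (v i) : MvPolynomial σ ℂ)) := by
  rw [← Ideal.Quotient.mk_eq_mk_iff_sub_mem]
  set I := Ideal.span (Set.range fun i => (X i - C (v i) : MvPolynomial σ ℂ))
  have : (Ideal.Quotient.mkₐ ℂ I) = (Ideal.Quotient.mkₐ ℂ I).comp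
      ((Algebra.ofId ℂ (MvPolynomial σ ℂ)).comp (aeval v)) := by
    ext i
    simp only [Ideal.Quotient.mkₐ_eq_mk, AlgHom.comp_apply, aeval_X]
    exact Ideal.Quotient.mk_eq_mk_iff_sub_mem _ _ |>.mpr (Ideal.subset_span ⟨i, rfl⟩)
  exact DFunLike.congr_fun this f

section Point

variable {v : σ → ℂ} (hv : v ≠ 0) (hpv : p = mk ℂ v hv) (hLv : aeval v L = 1)

include hL hpv hLv in
theorem X_sub_mem_homogIdeal (i : σ) : X i - C (v i) * L ∈ homogIdeal {p} := by
  subst hpv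
  rw [mem_homogIdeal_singleton]
  intro c _
  have h : aeval (c • v) L = c := by rw [aeval_smul_of_isHomogeneous hL, hLv, pow_one, mul_one]
  rw [map_sub, map_mul, h, aeval_X, aeval_C, Pi.smul_apply, smul_eq_mul,
    Algebra.algebraMap_self_apply]
  ring

-- Up to a unit an element is a dehomogenized polynomial, which differs from its value at `v` by an
-- element of the span. For an element of the maximal ideal this constant cannot be a unit, so it is
-- zero.
include hv hpv hLv in
theorem maximalIdeal_projLocalRing : IsLocalRing.maximalIdeal (ProjLocalRing p) =
    Ideal.span (Set.range fun i => dehom p L hL hLp (X i - C (v i))) := by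
  have h1 (i : σ) : dehom p L hL hLp (X i - C (v i)) ∈
      IsLocalRing.maximalIdeal (ProjLocalRing p) := by
    have h := dehom_mem_maximalIdeal p L hL hLp
      (f := X i - C (v i) * L) (n := 1)
      ((isHomogeneous_X ℂ i).sub (by simpa using (isHomogeneous_C σ (v i)).mul hL))
      (X_sub_mem_homogIdeal p L hL hv hpv hLv i)
    rwa [map_sub, map_mul, dehom_self, mul_one, ← map_sub] at h
  have h2 : (Ideal.span (Set.range fun i => (X i - C (v i) : MvPolynomial σ ℂ))).map
      (dehom p L hL hLp) = Ideal.span (Set.range fun i => dehom p L hL hLp (X i - C (v i))) := by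
    rw [Ideal.map_span, ← Set.range_comp]
    rfl
  have h3 : Ideal.span (Set.range fun i => dehom p L hL hLp (X i - C (v i))) ≤
      IsLocalRing.maximalIdeal (ProjLocalRing p) := by
    rw [Ideal.span_le]
    rintro _ ⟨i, rfl⟩
    exact h1 i
  refine le_antisymm (fun x hx => ?_) h3
  obtain ⟨f, g, hg, h⟩ := exists_dehom_mul_eq p L hL hLp x
  have h4 : dehom p L hL hLp f ∈ IsLocalRing.maximalIdeal (ProjLocalRing p) :=
    h ▸ Ideal.mul_mem_left _ _ hx
  have h5 := Ideal.mem_map_of_mem (dehom p L hL hLp) (sub_C_aeval_mem v f)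
  rw [h2, map_sub] at h5
  have h6 : dehom p L hL hLp (C (aeval v f)) ∈ IsLocalRing.maximalIdeal (ProjLocalRing p) := by
    have := Ideal.sub_mem _ h4 (h3 h5)
    rwa [sub_sub_cancel] at this
  have h7 : aeval v f = 0 := by
    by_contra h0
    exact h6 ((isUnit_iff_ne_zero.mpr h0).map ((dehom p L hL hLp).comp C))
  rw [h7, map_zero, map_zero, sub_zero, ← h] at h5
  exact (Ideal.unit_mul_mem_iff_mem _ hg).mp h5

include hv hpv hLv in
theorem isUnit_dehom {f : MvPolynomial σ ℂ} (hf : aeval v f ≠ 0) :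
    IsUnit (dehom p L hL hLp f) := by
  have h5 := Ideal.mem_map_of_mem (dehom p L hL hLp) (sub_C_aeval_mem v f)
  rw [Ideal.map_span, ← Set.range_comp] at h5
  have h6 := (maximalIdeal_projLocalRing p L hL hLp hv hpv hLv).ge h5
  by_contra hu
  have h4 : dehom p L hL hLp f ∈ IsLocalRing.maximalIdeal (ProjLocalRing p) := hu
  have := Ideal.sub_mem _ h4 h6
  rw [map_sub, sub_sub_cancel] at this
  exact this ((isUnit_iff_ne_zero.mpr hf).map ((dehom p L hL hLp).comp C))

end Point

include hL hLp in
/-- A chain of prime ideals between `I(Y)` and `I(p)` whose inclusions are witnessed by linear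
forms bounds the dimension of `Y` at `p` from below. -/
theorem le_ringKrullDim_varietyLocalRing {Y : Set (ℙ ℂ (σ → ℂ))} {n : ℕ}
    (Q : ℕ → Ideal (MvPolynomial σ ℂ)) (hQ : ∀ k, (Q k).IsPrime) (hY : homogIdeal Y ≤ Q 0)
    (hmono : Monotone Q) (hQp : ∀ k, Q k ≤ homogIdeal {p})
    (hz : ∀ k < n, ∃ z : MvPolynomial σ ℂ, z.IsHomogeneous 1 ∧ z ∈ Q (k + 1) ∧ z ∉ Q k) :
    localIdeal Y p ≠ ⊤ ∧ (n : WithBot ℕ∞) ≤ ringKrullDim (VarietyLocalRing Y p) := by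
  have hdisj (k) : Disjoint ((homogIdeal {p}).primeCompl : Set (MvPolynomial σ ℂ)) (Q k) :=
    Set.disjoint_left.mpr fun x hx hxQ => hx (hQp k hxQ)
  -- Each prime is extended to the localization and contracted to its degree-zero part.
  let Q' (k : ℕ) : Ideal (ProjLocalRing p) :=
    ((Q k).map (algebraMap _ (Loc p))).comap (algebraMap (ProjLocalRing p) (Loc p))
  have hQ' (k) : (Q' k).IsPrime := by
    have := hQ k
    have := IsLocalization.isPrime_of_isPrime_disjoint (homogIdeal {p}).primeCompl (Loc p) (Q k)
      (hQ k) (hdisj k)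
    exact Ideal.comap_isPrime _ _
  have hle (k) : localIdeal Y p ≤ Q' k :=
    Ideal.comap_mono (Ideal.map_mono (hY.trans (hmono (Nat.zero_le k))))
  have hlt (k) (hk : k < n) : Q' k < Q' (k + 1) := by
    refine lt_of_le_of_ne (Ideal.comap_mono (Ideal.map_mono (hmono (Nat.le_succ k)))) fun he => ?_
    -- The fraction `z / L` separates the two contractions: if it lay in `Q' k`, then `z` would lie
    -- in the contraction to `ℂ[s]` of the extension of `Q k`, which is `Q k` itself.
    obtain ⟨z, hz1, hzQ, hzn⟩ := hz k hk
    have h := val_dehom p L hL hLp z hz1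
    have hu := (isUnit_algebraMap_form p L hLp).pow 1
    have hmem : dehom p L hL hLp z ∈ Q' (k + 1) := by
      rw [Ideal.mem_comap]
      have := Ideal.mem_map_of_mem (algebraMap _ (Loc p)) hzQ
      rw [← h] at this
      exact (Ideal.mul_unit_mem_iff_mem _ hu).mp this
    rw [← he, Ideal.mem_comap] at hmem
    have h2 := Ideal.mul_mem_right (algebraMap _ (Loc p) L ^ 1) _ hmem
    erw [h] at h2
    have h3 := IsLocalization.under_map_of_isPrime_disjoint (homogIdeal {p}).primeCompl (Loc p)
      (hQ k) (hdisj k)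
    exact hzn (h3.le h2)
  refine ⟨fun h => (hQ' 0).ne_top (top_le_iff.mp (h ▸ hle 0)), ?_⟩
  rw [ringKrullDim_quotient]
  let s : LTSeries (PrimeSpectrum.zeroLocus (localIdeal Y p : Set (ProjLocalRing p))) :=
    { length := n
      toFun := fun k => ⟨⟨Q' k, hQ' k⟩, hle k⟩
      step := fun k => hlt k k.2 }
  exact le_iSup (fun q : LTSeries _ => ((q.length : ℕ) : WithBot ℕ∞)) s

end LocalRing

end VeroneseCubic

/-! ### Commutation equations for slices and the Aronhold invariant -/

namespace VeroneseCubic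

open MvPolynomial Matrix

section Bracket

variable {R R' : Type*} [CommRing R] [CommRing R']

/-- An entry of the skew-symmetric part of `B * adj A * C`. -/
noncomputable def bracket {n : Type*} [Fintype n] [DecidableEq n] (A B C : Matrix n n R)
    (i j : n) : R :=
  (B * A.adjugate * C) i j - (B * A.adjugate * C) j i

theorem map_bracket {n : Type*} [Fintype n] [DecidableEq n] (φ : R →+* R') (A B C : Matrix n n R)
    (i j : n) : φ (bracket A B C i j) = bracket (A.map φ) (B.map φ) (C.map φ) i j := by
  have h : (B.map φ) * (A.map φ).adjugate * (C.map φ) = (B * A.adjugate * C).map φ := by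
    rw [Matrix.map_mul, Matrix.map_mul]
    congr 2
    exact (RingHom.map_adjugate φ A).symm
  simp [bracket, h]

theorem bracket_swap_entries {n : Type*} [Fintype n] [DecidableEq n] (A B C : Matrix n n R)
    (i j : n) : bracket A B C j i = -bracket A B C i j := by
  simp [bracket]

theorem bracket_swap {n : Type*} [Fintype n] [DecidableEq n] {A B C : Matrix n n R}
    (hA : A.IsSymm) (hB : B.IsSymm) (hC : C.IsSymm) (i j : n) :
    bracket A C B i j = -bracket A B C i j := by
  have h : (C * A.adjugate * B) = (B * A.adjugate * C)ᵀ := by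
    rw [transpose_mul, transpose_mul, adjugate_transpose, hA, hB, hC, Matrix.mul_assoc]
  simp [bracket, h]

/-- Since `T * adj T` is the scalar `det T`, the product `B * adj A * C` is again `Tᵀ * diagonal *
T` up to the factor `det T ^ 2`, hence symmetric. -/
theorem bracket_transpose_mul_diagonal_mul {n : Type*} [Fintype n] [DecidableEq n]
    (T : Matrix n n R) (a b c : n → R) (i j : n) :
    bracket (Tᵀ * diagonal a * T) (Tᵀ * diagonal b * T) (Tᵀ * diagonal c * T) i j = 0 := by
  obtain ⟨d, hd⟩ : ∃ d, adjugate (diagonal a) = diagonal d := ⟨_, adjugate_diagonal a⟩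
  have hbdc : diagonal (b * d * c) = diagonal b * (diagonal d * diagonal c) := by
    simp [diagonal_mul_diagonal, mul_assoc, Pi.mul_def]
  have h : Tᵀ * diagonal b * T * (Tᵀ * diagonal a * T).adjugate * (Tᵀ * diagonal c * T) =
      (T.det * T.det) • (Tᵀ * diagonal (b * d * c) * T) := by
    calc _ = Tᵀ * diagonal b * (T * T.adjugate) * diagonal d * (adjugate Tᵀ * Tᵀ) *
          diagonal c * T := by
          rw [adjugate_mul_distrib, adjugate_mul_distrib, hd]
          simp only [Matrix.mul_assoc]
      _ = _ := by
          rw [mul_adjugate, adjugate_mul, det_transpose]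
          simp only [Matrix.mul_smul, Matrix.smul_mul, Matrix.mul_one, smul_smul,
            Matrix.mul_assoc, hbdc]
  have hs : (Tᵀ * diagonal (b * d * c) * T).IsSymm := by
    rw [Matrix.IsSymm, transpose_mul, transpose_mul, diagonal_transpose, transpose_transpose,
      Matrix.mul_assoc]
  rw [bracket, h, Matrix.smul_apply, Matrix.smul_apply, hs.apply, sub_self]

/-- The upper left `3 × 3` block. -/
def corner (A : Matrix (Fin 4) (Fin 4) R) : Matrix (Fin 3) (Fin 3) R :=
  A.submatrix Fin.castSucc Fin.castSucc

/-- The matrix with the lower right entry replaced by `0`. -/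
def zeroLast (A : Matrix (Fin 4) (Fin 4) R) : Matrix (Fin 4) (Fin 4) R :=
  of fun i j => if i = 3 ∧ j = 3 then 0 else A i j

/-- For row and column indices below 3 the corner entries of `B` and `C` never enter. The entry `A 3
3` enters only the cofactors with both indices below 3, and its coefficient there is the cofactor of
the `3 × 3` block. -/
theorem bracket_castSucc (A B C : Matrix (Fin 4) (Fin 4) R) (i j : Fin 3) :
    bracket A B C i.castSucc j.castSucc = A 3 3 * bracket (corner A) (corner B) (corner C) i j +
      bracket (zeroLast A) (zeroLast B) (zeroLast C) i.castSucc j.castSucc := by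
  have key (i j : Fin 3) : (B * A.adjugate * C) i.castSucc j.castSucc =
      A 3 3 * (corner B * (corner A).adjugate * corner C) i j +
      (zeroLast B * (zeroLast A).adjugate * zeroLast C) i.castSucc j.castSucc := by
    have hi : i.castSucc ≠ 3 := Fin.castSucc_ne_last i
    have hj : j.castSucc ≠ 3 := Fin.castSucc_ne_last j
    have h3 : (Fin.castSucc 0 : Fin 4) = 0 ∧ (Fin.castSucc 1 : Fin 4) = 1 ∧
      (Fin.castSucc 2 : Fin 4) = 2 := ⟨rfl, rfl, rfl⟩
    simp only [Matrix.mul_apply, Fin.sum_univ_four, Fin.sum_univ_three, corner, submatrix_apply,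
      zeroLast, of_apply, hi, hj, false_and, and_false, if_false]
    simp [h3, adjugate_fin_succ_eq_det_submatrix (n := 3), adjugate_fin_three, det_fin_three, Fin.succAbove, submatrix_apply]
    ring
  rw [bracket, bracket, bracket, key, key]
  ring

/-- The adjugate of such an `A` is concentrated at the entry `(3, 3)`, which is multiplied by an
entry `C 3 j = 0`. -/
theorem bracket_eq_zero_of_last {A B C : Matrix (Fin 4) (Fin 4) R} (hA : ∀ i, A i 3 = 0)
    (hA' : ∀ i, A 3 i = 0) (hC : ∀ i ≠ 3, C 3 i = 0) {i j : Fin 4}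
    (hi : i ≠ 3) (hj : j ≠ 3) : bracket A B C i j = 0 := by
  have key (k l : Fin 4) (h : k ≠ 3 ∨ l ≠ 3) : A.adjugate k l = 0 := by
    rw [adjugate_apply]
    rcases h with hk | hl
    · refine det_eq_zero_of_column_eq_zero 3 fun r => ?_
      rcases eq_or_ne r l with rfl | hr
      · simp [hk.symm]
      · rw [updateRow_ne hr, hA]
    · refine det_eq_zero_of_row_eq_zero 3 fun c => ?_
      rw [updateRow_ne hl.symm, hA']
  have key2 (i j : Fin 4) (hi : i ≠ 3) (hj : j ≠ 3) : (B * A.adjugate * C) i j = 0 := by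
    rw [Matrix.mul_apply]
    refine Finset.sum_eq_zero fun l _ => ?_
    rw [Matrix.mul_apply]
    rcases eq_or_ne l 3 with rfl | hl
    · rw [hC j hj, mul_zero]
    · rw [Finset.sum_eq_zero fun k _ => by rw [key k l (Or.inr hl), mul_zero], zero_mul]
  rw [bracket, key2 i j hi hj, key2 j i hj hi, sub_zero]

end Bracket

section Slices

variable {R : Type*} [CommRing R]

/-- The matrix of the quadratic form that is the `c`-th derivative of a cubic form. -/
def slice (y : MI → R) (c : Fin 4) : Matrix (Fin 4) (Fin 4) R := of fun i j => y (idx c i j)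

omit [CommRing R] in
theorem slice_isSymm (y : MI → R) (c : Fin 4) : (slice y c).IsSymm := by
  ext i j
  exact congrArg y (idx_swap_right _ _ _)

/-- The Aronhold invariant of the restriction of the cubic form to the first three variables. -/
noncomputable def aronhold (y : MI → R) : R :=
  bracket (corner (slice y 0)) (corner (slice y 1)) (corner (slice y 2)) 1 2

/-- A variant of the Aronhold invariant. -/
noncomputable def aronhold' (y : MI → R) : R :=
  bracket (corner (slice y 0 + slice y 3)) (corner (slice y 1)) (corner (slice y 2)) 1 2

/-- Equations of the fourth secant variety. -/
noncomputable def secantEq (y : MI → R) (k : Fin 3) : R :=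
  bracket (slice y k.castSucc) (slice y (k + 1).castSucc) (slice y (k + 2).castSucc)
    (k + 1).castSucc (k + 2).castSucc

/-- An equation of the fourth secant variety. -/
noncomputable def secantEq' (y : MI → R) : R :=
  bracket (slice y 0 + slice y 3) (slice y 1) (slice y 2) 1 2

theorem idx_sort : (∀ k, idx 1 0 k = idx 0 1 k) ∧ (∀ k, idx 2 0 k = idx 0 2 k) ∧
    (∀ k, idx 2 1 k = idx 1 2 k) ∧ (∀ k, idx k 1 0 = idx k 0 1) ∧ (∀ k, idx k 2 0 = idx k 0 2) ∧
    (∀ k, idx k 2 1 = idx k 1 2) ∧ (∀ k, idx 3 0 k = idx 0 3 k) ∧ (∀ k, idx 3 1 k = idx 1 3 k) ∧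
    (∀ k, idx 3 2 k = idx 2 3 k) ∧ (∀ k, idx k 3 0 = idx k 0 3) ∧ (∀ k, idx k 3 1 = idx k 1 3) ∧
    (∀ k, idx k 3 2 = idx k 2 3) :=
  ⟨fun k => idx_swap_left 0 1 k, fun k => idx_swap_left 0 2 k, fun k => idx_swap_left 1 2 k,
    fun k => idx_swap_right k 0 1, fun k => idx_swap_right k 0 2, fun k => idx_swap_right k 1 2,
    fun k => idx_swap_left 0 3 k, fun k => idx_swap_left 1 3 k, fun k => idx_swap_left 2 3 k,
    fun k => idx_swap_right k 0 3, fun k => idx_swap_right k 1 3, fun k => idx_swap_right k 2 3⟩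

/-- The cyclic symmetry of the invariant gives the three equations `secantEq` the same leading
coefficient. -/
theorem bracket_corner_slice (y : MI → R) (k : Fin 3) :
    bracket (corner (slice y k.castSucc)) (corner (slice y (k + 1).castSucc))
      (corner (slice y (k + 2).castSucc)) (k + 1) (k + 2) = aronhold y := by
  have h3 : (Fin.castSucc 0 : Fin 4) = 0 ∧ (Fin.castSucc 1 : Fin 4) = 1 ∧
    (Fin.castSucc 2 : Fin 4) = 2 := ⟨rfl, rfl, rfl⟩
  have h4 : (1 + 1 : Fin 3) = 2 ∧ (1 + 2 : Fin 3) = 0 ∧ (2 + 1 : Fin 3) = 0 ∧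
    (2 + 2 : Fin 3) = 1 := ⟨rfl, rfl, rfl, rfl⟩
  fin_cases k
  · rfl
  · simp [h4, h3, aronhold, bracket, Matrix.mul_apply, Fin.sum_univ_three, adjugate_fin_three, corner,
      slice, idx_sort]
    ring
  · simp [h4, h3, aronhold, bracket, Matrix.mul_apply, Fin.sum_univ_three, adjugate_fin_three, corner,
      slice, idx_sort]
    ring

/-- The restriction of the derivative in direction `w` to the first three variables. -/
def cornerSlice (y : MI → R) (w : Fin 3 → R) : Matrix (Fin 3) (Fin 3) R :=
  ∑ k, w k • corner (slice y k.castSucc)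

theorem cornerSlice_isSymm (y : MI → R) (w : Fin 3 → R) : (cornerSlice y w).IsSymm := by
  ext i j
  simp [cornerSlice, Matrix.sum_apply, corner, slice, idx_swap_right _ i.castSucc j.castSucc]

theorem aronhold_dvd_bracket_cornerSlice (y : MI → R) (w : Fin 3 → R) {a b i j : Fin 3}
    (hab : a < b) (hij : i < j) : aronhold y ∣ bracket (cornerSlice y w)
      (corner (slice y a.castSucc)) (corner (slice y b.castSucc)) i j := by
  have h3 : (Fin.castSucc 0 : Fin 4) = 0 ∧ (Fin.castSucc 1 : Fin 4) = 1 ∧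
    (Fin.castSucc 2 : Fin 4) = 2 := ⟨rfl, rfl, rfl⟩
  have h4 : (-1 : Fin 3) = 2 ∧ (-2 : Fin 3) = 1 ∧ (1 + 2 : Fin 3) = 0 := ⟨rfl, rfl, rfl⟩
  -- In `Fin 3` the index completing `a ≠ b` is `-(a + b)`, because `0 + 1 + 2 = 0`; the signs are
  -- those of the permutations formed by the pairs and their completions.
  refine ⟨(if b = a + 1 then 1 else -1) * (if j = i + 1 then 1 else -1) *
    (w (-(a + b)) * w (-(i + j))), ?_⟩
  fin_cases a <;> fin_cases b <;> first | exact absurd hab (by decide) | skip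
  all_goals
    fin_cases i <;> fin_cases j <;> first | exact absurd hij (by decide) | skip
  all_goals
    simp [h3, h4, aronhold, bracket, Matrix.mul_apply, Fin.sum_univ_three, adjugate_fin_three,
      corner, slice, idx_sort, cornerSlice]
    ring

theorem bracket_cornerSlice_eq_zero {y : MI → R} (hy : aronhold y = 0) (w : Fin 3 → R)
    (a b i j : Fin 3) : bracket (cornerSlice y w) (corner (slice y a.castSucc))
      (corner (slice y b.castSucc)) i j = 0 := by
  have hs (a : Fin 3) : (corner (slice y a.castSucc)).IsSymm := (slice_isSymm y _).submatrix _
  have h1 {a b i j : Fin 3} (hab : a < b) (hij : i < j) : bracket (cornerSlice y w)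
      (corner (slice y a.castSucc)) (corner (slice y b.castSucc)) i j = 0 := by
    simpa [hy] using aronhold_dvd_bracket_cornerSlice y w hab hij
  have h2 {a b : Fin 3} (hab : a < b) (i j : Fin 3) : bracket (cornerSlice y w)
      (corner (slice y a.castSucc)) (corner (slice y b.castSucc)) i j = 0 := by
    rcases lt_trichotomy i j with h | rfl | h
    · exact h1 hab h
    · simp [bracket]
    · rw [bracket_swap_entries, h1 hab h, neg_zero]
  rcases lt_trichotomy a b with h | rfl | h
  · exact h2 h i j
  · have h3 := (cornerSlice_isSymm y w)
    rw [bracket, sub_eq_zero]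
    have : (corner (slice y a.castSucc) * (cornerSlice y w).adjugate *
        corner (slice y a.castSucc)).IsSymm := by
      rw [Matrix.IsSymm, transpose_mul, transpose_mul, adjugate_transpose, h3, hs,
        Matrix.mul_assoc]
    exact this.apply _ _
  · rw [bracket_swap (cornerSlice_isSymm y w) (hs _) (hs _), h2 h, neg_zero]

/-- If the Aronhold invariant vanishes, the derivatives of the cubic form satisfy a commutation
relation. -/
theorem cornerSlice_mul_adjugate_mul_isSymm {y : MI → R} (hy : aronhold y = 0)
    (u v w : Fin 3 → R) :
    (cornerSlice y u * (cornerSlice y w).adjugate * cornerSlice y v).IsSymm := by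
  have hb (a b i j : Fin 3) := sub_eq_zero.mp (bracket_cornerSlice_eq_zero hy w a b i j)
  generalize (cornerSlice y w).adjugate = M at hb
  ext i j
  simp only [transpose_apply, cornerSlice, Finset.sum_mul, Finset.mul_sum, Matrix.sum_apply,
    Matrix.smul_mul, Matrix.mul_smul, Matrix.smul_apply]
  refine Finset.sum_congr rfl fun a _ => Finset.sum_congr rfl fun b _ => ?_
  rw [hb]

end Slices

end VeroneseCubic

/-! ### The algebra of a ternary cubic with nonvanishing Hessian -/

namespace VeroneseCubic

open MvPolynomial Matrix

section TernaryCubic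

variable (F : (Fin 3 → ℂ) →ₗ[ℂ] Matrix (Fin 3) (Fin 3) ℂ)

theorem isUnit_det_rows_iff (x y z : Fin 3 → ℂ) :
    LinearIndependent ℂ ![x, y, z] ↔ (Matrix.of ![x, y, z]).det ≠ 0 := by
  rw [← isUnit_iff_ne_zero, ← Matrix.isUnit_iff_isUnit_det,
    ← Matrix.linearIndependent_rows_iff_isUnit]
  rfl

theorem exists_rows_extend {w : Fin 3 → ℂ} (hw : w ≠ 0) :
    ∃ a b : Fin 3 → ℂ, (Matrix.of ![w, a, b]).det ≠ 0 := by
  obtain ⟨i, hi⟩ := Function.ne_iff.mp hw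
  fin_cases i
  · exact ⟨![0, 1, 0], ![0, 0, 1], by simpa [det_fin_three] using hi⟩
  · exact ⟨![1, 0, 0], ![0, 0, 1], by simpa [det_fin_three] using hi⟩
  · exact ⟨![1, 0, 0], ![0, 1, 0], by simpa [det_fin_three] using hi⟩

theorem exists_coords {B : Matrix (Fin 3) (Fin 3) ℂ} (hB : B.det ≠ 0) (v : Fin 3 → ℂ) :
    ∃ c : Fin 3 → ℂ, v = c 0 • B 0 + c 1 • B 1 + c 2 • B 2 := by
  have hu : IsUnit B.det := isUnit_iff_ne_zero.mpr hB
  refine ⟨v ᵥ* B⁻¹, ?_⟩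
  have : v = (v ᵥ* B⁻¹) ᵥ* B := by rw [vecMul_vecMul, nonsing_inv_mul _ hu, vecMul_one]
  conv_lhs => rw [this]
  funext j
  simp [vecMul, dotProduct, Fin.sum_univ_three]

/-- A symmetric bilinear form on a three-dimensional space with an isotropic plane is
degenerate. -/
theorem det_eq_zero_of_isotropic {D : Matrix (Fin 3) (Fin 3) ℂ} {w a b : Fin 3 → ℂ}
    (hB : (Matrix.of ![w, a, b]).det ≠ 0) (haa : a ⬝ᵥ D *ᵥ a = 0) (hab : a ⬝ᵥ D *ᵥ b = 0)
    (hba : b ⬝ᵥ D *ᵥ a = 0) (hbb : b ⬝ᵥ D *ᵥ b = 0) : D.det = 0 := by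
  have hG : (Matrix.of ![w, a, b] * D * (Matrix.of ![w, a, b])ᵀ).det = 0 := by
    have hent (i j : Fin 3) : (Matrix.of ![w, a, b] * D * (Matrix.of ![w, a, b])ᵀ) i j =
        ![w, a, b] i ⬝ᵥ D *ᵥ ![w, a, b] j := by
      rw [Matrix.mul_assoc, Matrix.mul_apply]
      rfl
    rw [det_fin_three, hent 1 1, hent 1 2, hent 2 1, hent 2 2]
    change _ * (a ⬝ᵥ D *ᵥ a) * (b ⬝ᵥ D *ᵥ b) - _ * (a ⬝ᵥ D *ᵥ b) * (b ⬝ᵥ D *ᵥ a)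
      - _ * _ * (b ⬝ᵥ D *ᵥ b) + _ * (a ⬝ᵥ D *ᵥ b) * _ + _ * _ * (b ⬝ᵥ D *ᵥ a)
      - _ * (a ⬝ᵥ D *ᵥ a) * _ = 0
    rw [haa, hab, hba, hbb]
    ring
  rw [det_mul, det_mul, det_transpose] at hG
  simpa [hB] using hG

variable {F} (hs : ∀ u, (F u).IsSymm) (hF : ∀ u v, F u *ᵥ v = F v *ᵥ u)
  (hc : ∀ u v w, (F u * (F w).adjugate * F v).IsSymm) {w : Fin 3 → ℂ} (hw : (F w).det ≠ 0)

/-- Multiplication by `u` in the algebra that is defined by a degenerate ternary cubic. -/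
noncomputable def mulMat (F : (Fin 3 → ℂ) →ₗ[ℂ] Matrix (Fin 3) (Fin 3) ℂ) (w u : Fin 3 → ℂ) :
    Matrix (Fin 3) (Fin 3) ℂ := (F w)⁻¹ * F u

include hw in
theorem F_mul_mulMat (u : Fin 3 → ℂ) : F w * mulMat F w u = F u := by
  rw [mulMat, ← Matrix.mul_assoc, mul_nonsing_inv _ (isUnit_iff_ne_zero.mpr hw), Matrix.one_mul]

include hs hc in
theorem mulMat_comm (u v : Fin 3 → ℂ) :
    mulMat F w u * mulMat F w v = mulMat F w v * mulMat F w u := by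
  have h : F u * (F w)⁻¹ * F v = F v * (F w)⁻¹ * F u := by
    have h1 := hc u v w
    rw [Matrix.IsSymm, transpose_mul, transpose_mul, adjugate_transpose, hs, hs, hs,
      ← Matrix.mul_assoc] at h1
    rw [Matrix.inv_def]
    simp only [Matrix.mul_smul, Matrix.smul_mul, h1]
  simp only [mulMat, Matrix.mul_assoc] at h ⊢
  rw [h]

include hF in
theorem mulMat_mulVec_comm (u v : Fin 3 → ℂ) : mulMat F w u *ᵥ v = mulMat F w v *ᵥ u := by
  rw [mulMat, mulMat, ← mulVec_mulVec, hF, mulVec_mulVec]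

include hw in
theorem mulMat_self : mulMat F w w = 1 :=
  nonsing_inv_mul _ (isUnit_iff_ne_zero.mpr hw)

include hF hw in
theorem mulMat_mulVec_one (u : Fin 3 → ℂ) : mulMat F w u *ᵥ w = u := by
  rw [mulMat_mulVec_comm hF, mulMat_self hw, one_mulVec]

-- Associativity of the product `u * v = mulMat F w u *ᵥ v`, which follows from its commutativity
-- and from the fact that multiplications commute.
include hs hF hc in
theorem mulMat_mulVec (u v : Fin 3 → ℂ) :
    mulMat F w (mulMat F w u *ᵥ v) = mulMat F w u * mulMat F w v := by
  refine Matrix.ext_of_mulVec_single fun i => ?_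
  rw [mulMat_mulVec_comm hF, mulVec_mulVec, mulMat_comm hs hc, ← mulVec_mulVec,
    mulMat_mulVec_comm hF _ v, mulVec_mulVec]

include hs hF hw in
theorem dotProduct_F_mulVec (u v : Fin 3 → ℂ) :
    u ⬝ᵥ F w *ᵥ v = w ⬝ᵥ F w *ᵥ (mulMat F w u *ᵥ v) := by
  rw [mulVec_mulVec, F_mul_mulMat hw, ← (hs w).eq, dotProduct_mulVec, vecMul_transpose, hF,
    ← vecMul_transpose, (hs u).eq, dotProduct_mulVec]

theorem mulMat_add (u v : Fin 3 → ℂ) : mulMat F w (u + v) = mulMat F w u + mulMat F w v := by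
  simp [mulMat, Matrix.mul_add]

theorem mulMat_smul (c : ℂ) (u : Fin 3 → ℂ) : mulMat F w (c • u) = c • mulMat F w u := by
  simp [mulMat]

theorem mulMat_sub (u v : Fin 3 → ℂ) : mulMat F w (u - v) = mulMat F w u - mulMat F w v := by
  simp [mulMat, Matrix.mul_sub]

include hs hF hc hw in
/-- The algebra defined by a degenerate ternary cubic is generated by one element. -/
theorem exists_generator : ∃ a, (Matrix.of ![w, a, mulMat F w a *ᵥ a]).det ≠ 0 := by
  by_contra! hdep
  have hw0 : w ≠ 0 := by
    rintro rfl
    simp at hw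
  obtain ⟨a, b, hab⟩ := exists_rows_extend hw0
  -- For `x = p a + q b`, dependence of the unit `w`, `x` and `x * x` is the vanishing of a `2 × 2`
  -- minor in the coordinates along `a` and `b`. Testing `a`, `b`, `a + b` and `a - b` determines
  -- these coordinates of all products up to two parameters.
  have hdep2 (p q : ℂ) (x : Fin 3 → ℂ) (h : mulMat F w (p • a + q • b) *ᵥ (p • a + q • b) =
      x 0 • w + x 1 • a + x 2 • b) : p * x 2 = q * x 1 := by
    have h1 := hdep (p • a + q • b)
    rw [h] at h1
    have h2 : Matrix.of ![w, p • a + q • b, x 0 • w + x 1 • a + x 2 • b] =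
        !![1, 0, 0; 0, p, q; x 0, x 1, x 2] * Matrix.of ![w, a, b] := by
      ext i j
      fin_cases i <;> simp [Matrix.mul_apply, Fin.sum_univ_three]
    rw [h2, det_mul, mul_eq_zero, or_iff_left hab] at h1
    simp [det_fin_three] at h1
    linear_combination h1
  obtain ⟨α, hα⟩ := exists_coords hab (mulMat F w a *ᵥ a)
  obtain ⟨β, hβ⟩ := exists_coords hab (mulMat F w b *ᵥ b)
  obtain ⟨γ, hγ⟩ := exists_coords hab (mulMat F w a *ᵥ b)
  change _ = α 0 • w + α 1 • a + α 2 • b at hα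
  change _ = β 0 • w + β 1 • a + β 2 • b at hβ
  change _ = γ 0 • w + γ 1 • a + γ 2 • b at hγ
  have hγ' : mulMat F w b *ᵥ a = γ 0 • w + γ 1 • a + γ 2 • b := by
    rw [mulMat_mulVec_comm hF, hγ]
  have e1 := hdep2 1 0 α (by simpa using hα)
  have e2 := hdep2 0 1 β (by simpa using hβ)
  have e3 := hdep2 1 1 (α + β + (2 : ℂ) • γ) (by
    simp only [one_smul, mulMat_add, add_mulVec, mulVec_add, hα, hβ, hγ, hγ', Pi.add_apply,
      Pi.smul_apply, smul_eq_mul]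
    module)
  have e4 := hdep2 1 (-1) (α + β - (2 : ℂ) • γ) (by
    simp only [one_smul, neg_smul, ← sub_eq_add_neg, mulMat_sub, sub_mulVec, mulVec_sub, hα, hβ,
      hγ, hγ', Pi.add_apply, Pi.sub_apply, Pi.smul_apply, smul_eq_mul]
    module)
  simp only [one_mul, zero_mul, Pi.add_apply, Pi.sub_apply, Pi.smul_apply, smul_eq_mul] at e1 e2 e3 e4
  have f1 : α 1 = 2 * γ 2 := by linear_combination -(e3 - e4) / 2 + e2
  have f2 : β 2 = 2 * γ 1 := by linear_combination (e3 + e4) / 2 - e1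
  have one_v (u) := mulMat_mulVec_one hF hw u
  have hv_one (u : Fin 3 → ℂ) : mulMat F w w *ᵥ u = u := by rw [mulMat_self hw, one_mulVec]
  -- Subtracting multiples of the unit makes the three products of `a'` and `b'` multiples of the
  -- unit.
  set a' := a - γ 2 • w with ha'
  set b' := b - γ 1 • w with hb'
  have haa : mulMat F w a' *ᵥ a' = (α 0 + γ 2 ^ 2) • w := by
    simp only [ha', mulMat_sub, mulMat_smul, sub_mulVec, mulVec_sub, smul_mulVec, mulVec_smul, hα,
      one_v, hv_one, e1, f1]
    module
  have hbb : mulMat F w b' *ᵥ b' = (β 0 + γ 1 ^ 2) • w := by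
    simp only [hb', mulMat_sub, mulMat_smul, sub_mulVec, mulVec_sub, smul_mulVec, mulVec_smul, hβ,
      one_v, hv_one, ← e2, f2]
    module
  have hab' : mulMat F w a' *ᵥ b' = (γ 0 + γ 1 * γ 2) • w := by
    simp only [ha', hb', mulMat_sub, mulMat_smul, sub_mulVec, mulVec_sub, smul_mulVec, mulVec_smul,
      hγ, one_v, hv_one]
    module
  have hB' : (Matrix.of ![w, a', b']).det ≠ 0 := by
    have h2 : Matrix.of ![w, a', b'] =
        !![1, 0, 0; -γ 2, 1, 0; -γ 1, 0, 1] * Matrix.of ![w, a, b] := by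
      ext i j
      fin_cases i <;> simp [Matrix.mul_apply, Fin.sum_univ_three, ha', hb'] <;> ring
    rw [h2, det_mul]
    simpa [det_fin_three] using hab
  have hli := (isUnit_det_rows_iff w a' b').mpr hB'
  have hli0 (x y : ℂ) (h : x • a' = y • b') : x = 0 ∧ y = 0 := by
    have := Fintype.linearIndependent_iff.mp hli ![0, x, -y] (by
      simp [Fin.sum_univ_three, h])
    exact ⟨this 1, by simpa using this 2⟩
  -- The identity `a' * (a' * b') = (a' * a') * b'` equates multiples of the independent vectors
  -- `a'` and `b'`, so both scalars vanish.
  obtain ⟨k0, h0⟩ := hli0 (γ 0 + γ 1 * γ 2) (α 0 + γ 2 ^ 2) (by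
    have h := congrArg (fun v => mulMat F w a' *ᵥ v) hab'
    simp only [mulVec_mulVec, mulVec_smul, one_v, ← mulMat_mulVec hs hF hc, haa, mulMat_smul,
      mulMat_self hw, smul_mulVec, one_mulVec] at h
    exact h.symm)
  obtain ⟨h0', -⟩ := hli0 (β 0 + γ 1 ^ 2) (γ 0 + γ 1 * γ 2) (by
    have h := congrArg (fun v => mulMat F w b' *ᵥ v) hab'
    simp only [mulMat_mulVec_comm hF a' b', mulVec_mulVec, mulVec_smul, one_v,
      ← mulMat_mulVec hs hF hc, hbb, mulMat_smul, mulMat_self hw, smul_mulVec, one_mulVec] at h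
    exact h)
  rw [h0, zero_smul] at haa
  rw [k0, zero_smul] at hab'
  rw [h0', zero_smul] at hbb
  have hba' : mulMat F w b' *ᵥ a' = 0 := by rw [mulMat_mulVec_comm hF, hab']
  -- All products in the plane of `a'` and `b'` vanish, so this plane is isotropic for `F w`,
  -- contradicting nondegeneracy.
  have hz (x y : Fin 3 → ℂ) (h : mulMat F w x *ᵥ y = 0) : x ⬝ᵥ F w *ᵥ y = 0 := by
    rw [dotProduct_F_mulVec hs hF hw, h, mulVec_zero, dotProduct_zero]
  exact hw (det_eq_zero_of_isotropic hB' (hz _ _ haa) (hz _ _ hab') (hz _ _ hba') (hz _ _ hbb))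

/-- The values of a cubic form that depends on the powers of one element of an algebra. -/
theorem exists_hankel_of_det_ne_zero (hs : ∀ u, (F u).IsSymm) (hF : ∀ u v, F u *ᵥ v = F v *ᵥ u)
    (hc : ∀ u v w, (F u * (F w).adjugate * F v).IsSymm) (hw : (F w).det ≠ 0) :
    ∃ (B : Matrix (Fin 3) (Fin 3) ℂ) (c : Fin 3 → ℂ) (m : ℕ → ℂ), B.det ≠ 0 ∧
      (∀ n, m (n + 3) = c 0 * m n + c 1 * m (n + 1) + c 2 * m (n + 2)) ∧
      ∀ i j k : Fin 3, B i ⬝ᵥ F (B j) *ᵥ B k = m (i + j + k) := by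
  obtain ⟨a, ha⟩ := exists_generator hs hF hc hw
  set A := mulMat F w a with hA
  have hB (i : Fin 3) : Matrix.of ![w, a, A *ᵥ a] i = (A ^ (i : ℕ)) *ᵥ w := by
    fin_cases i
    · exact (one_mulVec w).symm
    · change a = (A ^ 1) *ᵥ w
      rw [pow_one, hA, mulMat_mulVec_one hF hw]
    · change A *ᵥ a = (A ^ 2) *ᵥ w
      rw [pow_two, ← mulVec_mulVec]
      congr 1
      rw [hA, mulMat_mulVec_one hF hw]
  have hpow (n : ℕ) : mulMat F w ((A ^ n) *ᵥ w) = A ^ n := by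
    induction n with
    | zero => rw [pow_zero, one_mulVec, mulMat_self hw]
    | succ n ih => rw [pow_succ', ← mulVec_mulVec, hA, mulMat_mulVec hs hF hc, ← hA, ih]
  -- The recurrence comes from expressing the cube of the generator in the basis of its lower
  -- powers.
  obtain ⟨c, hc3⟩ := exists_coords ha ((A ^ 3) *ᵥ w)
  rw [hB, hB, hB] at hc3
  refine ⟨Matrix.of ![w, a, A *ᵥ a], c, fun n => w ⬝ᵥ F w *ᵥ ((A ^ n) *ᵥ w), ha, fun n => ?_,
    fun i j k => ?_⟩
  · have h : (A ^ (n + 3)) *ᵥ w = c 0 • ((A ^ n) *ᵥ w) + c 1 • ((A ^ (n + 1)) *ᵥ w) +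
        c 2 • ((A ^ (n + 2)) *ᵥ w) := by
      rw [pow_add, ← mulVec_mulVec, hc3]
      simp only [mulVec_add, mulVec_smul, mulVec_mulVec, ← pow_add]
      rfl
    simp only [h, mulVec_add, mulVec_smul, dotProduct_add, dotProduct_smul, smul_eq_mul]
  · have h : F ((A ^ (j : ℕ)) *ᵥ w) = F w * A ^ (j : ℕ) := by
      rw [← F_mul_mulMat hw, hpow]
    rw [hB, hB, hB, h, ← mulVec_mulVec, dotProduct_F_mulVec hs hF hw, hpow]
    simp only [mulVec_mulVec, ← pow_add, add_assoc]

end TernaryCubic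

end VeroneseCubic

/-! ### Ternary cubics with vanishing Hessian -/

namespace VeroneseCubic

open MvPolynomial Matrix

theorem exists_root_cubic (a b c : ℂ) : ∃ r : ℂ, r ^ 3 + a * r ^ 2 + b * r + c = 0 := by
  obtain ⟨r, hr⟩ := IsAlgClosed.exists_root
    (Polynomial.X ^ 3 + (Polynomial.C a * Polynomial.X ^ 2 + Polynomial.C b * Polynomial.X +
      Polynomial.C c) : Polynomial ℂ) (by
    rw [Polynomial.degree_add_eq_left_of_degree_lt]
    · simp
    · refine lt_of_le_of_lt (Polynomial.degree_quadratic_le) ?_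
      rw [Polynomial.degree_X_pow]
      norm_num)
  refine ⟨r, ?_⟩
  simpa [Polynomial.IsRoot, add_assoc] using hr

theorem matrix_ext_of_rows {B X Y : Matrix (Fin 3) (Fin 3) ℂ} (hB : B.det ≠ 0)
    (h : ∀ i j, B i ⬝ᵥ X *ᵥ B j = B i ⬝ᵥ Y *ᵥ B j) : X = Y := by
  have hent (Z : Matrix (Fin 3) (Fin 3) ℂ) (i j : Fin 3) : (B * Z * Bᵀ) i j = B i ⬝ᵥ Z *ᵥ B j := by
    rw [Matrix.mul_assoc, Matrix.mul_apply]
    rfl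
  have hXY : B * X * Bᵀ = B * Y * Bᵀ := by
    ext i j
    rw [hent, hent, h]
  have hu : IsUnit B.det := isUnit_iff_ne_zero.mpr hB
  have hu' : IsUnit Bᵀ.det := by rwa [det_transpose]
  have h2 := congrArg (fun Z => B⁻¹ * Z * (Bᵀ)⁻¹) hXY
  simpa only [Matrix.mul_assoc, mul_nonsing_inv _ hu', Matrix.mul_one,
    nonsing_inv_mul_cancel_left _ _ hu] using h2

theorem exists_sq_eq (β γ δ : ℂ) (h : β * δ = γ ^ 2) :
    ∃ a b : ℂ, a * a = β ∧ a * b = γ ∧ b * b = δ := by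
  obtain ⟨a, ha⟩ := IsAlgClosed.exists_pow_nat_eq β (n := 2) (by norm_num)
  rcases eq_or_ne a 0 with rfl | ha0
  · obtain ⟨b, hb⟩ := IsAlgClosed.exists_pow_nat_eq δ (n := 2) (by norm_num)
    have hβ : β = 0 := by rw [← ha]; ring
    have hγ : γ = 0 := by
      rw [hβ, zero_mul] at h
      exact pow_eq_zero_iff (two_ne_zero) |>.mp h.symm
    exact ⟨0, b, by rw [hβ]; ring, by rw [hγ]; ring, by rw [← hb]; ring⟩
  · refine ⟨a, γ / a, by rw [← ha]; ring, by field_simp, ?_⟩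
    field_simp
    rw [ha, ← h]

theorem dotProduct_mulVec_symm {D : Matrix (Fin 3) (Fin 3) ℂ} (hD : D.IsSymm) (x y : Fin 3 → ℂ) :
    x ⬝ᵥ D *ᵥ y = y ⬝ᵥ D *ᵥ x := by
  rw [dotProduct_mulVec, ← mulVec_transpose, hD, dotProduct_comm]

/-- A symmetric matrix of rank at most one is a square. -/
theorem exists_eq_vecMulVec {D : Matrix (Fin 3) (Fin 3) ℂ} (hD : D.IsSymm) {z x y : Fin 3 → ℂ}
    (hB : (Matrix.of ![z, x, y]).det ≠ 0) (hz : D *ᵥ z = 0)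
    (h : (x ⬝ᵥ D *ᵥ x) * (y ⬝ᵥ D *ᵥ y) = (x ⬝ᵥ D *ᵥ y) ^ 2) : ∃ m, D = vecMulVec m m := by
  obtain ⟨a, b, haa, hab, hbb⟩ := exists_sq_eq _ _ _ h
  have hu : IsUnit (Matrix.of ![z, x, y]).det := isUnit_iff_ne_zero.mpr hB
  set m := (Matrix.of ![z, x, y])⁻¹ *ᵥ ![0, a, b] with hm
  have hBm : (Matrix.of ![z, x, y]) *ᵥ m = ![0, a, b] := by
    rw [hm, mulVec_mulVec, mul_nonsing_inv _ hu, one_mulVec]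
  have hzm : z ⬝ᵥ m = 0 := congrFun hBm 0
  have hxm : x ⬝ᵥ m = a := congrFun hBm 1
  have hym : y ⬝ᵥ m = b := congrFun hBm 2
  have hR (u v : Fin 3 → ℂ) : u ⬝ᵥ vecMulVec m m *ᵥ v = (u ⬝ᵥ m) * (v ⬝ᵥ m) := by
    rw [vecMulVec_mulVec, dotProduct_comm m v]
    simp [dotProduct_smul, mul_comm]
  have hzl (v) : z ⬝ᵥ D *ᵥ v = 0 := by
    rw [dotProduct_mulVec_symm hD, hz, dotProduct_zero]
  refine ⟨m, matrix_ext_of_rows hB fun i j => ?_⟩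
  rw [hR]
  fin_cases i <;> fin_cases j
  · change z ⬝ᵥ D *ᵥ z = (z ⬝ᵥ m) * (z ⬝ᵥ m); rw [hzl, hzm, zero_mul]
  · change z ⬝ᵥ D *ᵥ x = (z ⬝ᵥ m) * (x ⬝ᵥ m); rw [hzl, hzm, zero_mul]
  · change z ⬝ᵥ D *ᵥ y = (z ⬝ᵥ m) * (y ⬝ᵥ m); rw [hzl, hzm, zero_mul]
  · change x ⬝ᵥ D *ᵥ z = (x ⬝ᵥ m) * (z ⬝ᵥ m); rw [hz, hzm, dotProduct_zero, mul_zero]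
  · change x ⬝ᵥ D *ᵥ x = (x ⬝ᵥ m) * (x ⬝ᵥ m); rw [hxm, haa]
  · change x ⬝ᵥ D *ᵥ y = (x ⬝ᵥ m) * (y ⬝ᵥ m); rw [hxm, hym, hab]
  · change y ⬝ᵥ D *ᵥ z = (y ⬝ᵥ m) * (z ⬝ᵥ m); rw [hz, hzm, dotProduct_zero, mul_zero]
  · change y ⬝ᵥ D *ᵥ x = (y ⬝ᵥ m) * (x ⬝ᵥ m)
    rw [dotProduct_mulVec_symm hD, hxm, hym, mul_comm, hab]
  · change y ⬝ᵥ D *ᵥ y = (y ⬝ᵥ m) * (y ⬝ᵥ m); rw [hym, hbb]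

/-- This is the Gram determinant of `D` on `z`, `x`, `y`, expanded so that the products with `z`
stand apart. -/
theorem det_conj_eq_zero {D : Matrix (Fin 3) (Fin 3) ℂ} (hD : D.IsSymm) (h : D.det = 0)
    (z x y : Fin 3 → ℂ) :
    (z ⬝ᵥ D *ᵥ z) * ((x ⬝ᵥ D *ᵥ x) * (y ⬝ᵥ D *ᵥ y) - (x ⬝ᵥ D *ᵥ y) ^ 2) -
      ((z ⬝ᵥ D *ᵥ x) ^ 2 * (y ⬝ᵥ D *ᵥ y) - 2 * (z ⬝ᵥ D *ᵥ x) * (z ⬝ᵥ D *ᵥ y) * (x ⬝ᵥ D *ᵥ y) +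
        (z ⬝ᵥ D *ᵥ y) ^ 2 * (x ⬝ᵥ D *ᵥ x)) = 0 := by
  have hG : (Matrix.of ![z, x, y] * D * (Matrix.of ![z, x, y])ᵀ).det = 0 := by
    rw [det_mul, det_mul, h, mul_zero, zero_mul]
  have hent (i j : Fin 3) : (Matrix.of ![z, x, y] * D * (Matrix.of ![z, x, y])ᵀ) i j =
      ![z, x, y] i ⬝ᵥ D *ᵥ ![z, x, y] j := by
    rw [Matrix.mul_assoc, Matrix.mul_apply]
    rfl
  rw [det_fin_three] at hG
  simp only [hent] at hG
  change (z ⬝ᵥ D *ᵥ z) * (x ⬝ᵥ D *ᵥ x) * (y ⬝ᵥ D *ᵥ y)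
    - (z ⬝ᵥ D *ᵥ z) * (x ⬝ᵥ D *ᵥ y) * (y ⬝ᵥ D *ᵥ x)
    - (z ⬝ᵥ D *ᵥ x) * (x ⬝ᵥ D *ᵥ z) * (y ⬝ᵥ D *ᵥ y)
    + (z ⬝ᵥ D *ᵥ x) * (x ⬝ᵥ D *ᵥ y) * (y ⬝ᵥ D *ᵥ z)
    + (z ⬝ᵥ D *ᵥ y) * (x ⬝ᵥ D *ᵥ z) * (y ⬝ᵥ D *ᵥ x)
    - (z ⬝ᵥ D *ᵥ y) * (x ⬝ᵥ D *ᵥ x) * (y ⬝ᵥ D *ᵥ z) = 0 at hG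
  rw [dotProduct_mulVec_symm hD y x, dotProduct_mulVec_symm hD x z,
    dotProduct_mulVec_symm hD y z] at hG
  linear_combination hG

theorem exists_adapted_rows {z m : Fin 3 → ℂ} (hz : z ≠ 0) (hm : m ≠ 0) (hzm : z ⬝ᵥ m = 0) :
    ∃ x y : Fin 3 → ℂ, (Matrix.of ![z, x, y]).det ≠ 0 ∧ x ⬝ᵥ m = 0 ∧ y ⬝ᵥ m = 1 := by
  obtain ⟨a, b, hB⟩ := exists_rows_extend hz
  have main (a b : Fin 3 → ℂ) (hB : (Matrix.of ![z, a, b]).det ≠ 0) (hb : b ⬝ᵥ m ≠ 0) :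
      ∃ x y : Fin 3 → ℂ, (Matrix.of ![z, x, y]).det ≠ 0 ∧ x ⬝ᵥ m = 0 ∧ y ⬝ᵥ m = 1 := by
    refine ⟨a - (a ⬝ᵥ m / b ⬝ᵥ m) • b, (b ⬝ᵥ m)⁻¹ • b, ?_, ?_, ?_⟩
    · have h2 : Matrix.of ![z, a - (a ⬝ᵥ m / b ⬝ᵥ m) • b, (b ⬝ᵥ m)⁻¹ • b] =
          !![1, 0, 0; 0, 1, -(a ⬝ᵥ m / b ⬝ᵥ m); 0, 0, (b ⬝ᵥ m)⁻¹] * Matrix.of ![z, a, b] := by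
        ext i j
        fin_cases i <;> simp [Matrix.mul_apply, Fin.sum_univ_three, sub_eq_add_neg]
      rw [h2, det_mul]
      refine mul_ne_zero ?_ hB
      simpa [det_fin_three] using hb
    · rw [sub_dotProduct, smul_dotProduct, smul_eq_mul, div_mul_cancel₀ _ hb, sub_self]
    · rw [smul_dotProduct, smul_eq_mul, inv_mul_cancel₀ hb]
  by_cases hb : b ⬝ᵥ m = 0
  · refine main b a ?_ fun ha => hm ?_
    · have : (Matrix.of ![z, b, a]).det = -(Matrix.of ![z, a, b]).det := by
        simp [det_fin_three]
        ring
      rwa [this, neg_ne_zero]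
    · refine eq_zero_of_mulVec_eq_zero hB ?_
      funext i
      fin_cases i
      · exact hzm
      · exact ha
      · exact hb
  · exact main a b hB hb

section Cone

variable {F : (Fin 3 → ℂ) →ₗ[ℂ] Matrix (Fin 3) (Fin 3) ℂ} (hs : ∀ u, (F u).IsSymm)
  (hF : ∀ u v, F u *ᵥ v = F v *ᵥ u) (hdet : ∀ u, (F u).det = 0)

-- In a basis `z`, `x`, `y` with `x ⬝ᵥ m = 0` and `y ⬝ᵥ m = 1`, the Gram determinant of `F v`
-- reduces to `-(v ⬝ᵥ m) ^ 2 * (x ⬝ᵥ F v *ᵥ x)`. Taking `v = y` and `v = x + y` leaves only the `y`,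
-- `y` entry of `F x`, and a multiple of `F z` cancels it.
include hs hF hdet in
theorem exists_cone_of_vecMulVec {z m : Fin 3 → ℂ} (hz : z ≠ 0) (hm : F z = vecMulVec m m)
    (hzz : F z *ᵥ z = 0) : ∃ x, x ≠ 0 ∧ F x = 0 := by
  rcases eq_or_ne m 0 with rfl | hm0
  · exact ⟨z, hz, by rw [hm, zero_vecMulVec]⟩
  have hzm : z ⬝ᵥ m = 0 := by
    rw [hm, vecMulVec_mulVec, dotProduct_comm] at hzz
    simpa [hm0] using hzz
  obtain ⟨x, y, hB, hxm, hym⟩ := exists_adapted_rows hz hm0 hzm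
  have hR (u v : Fin 3 → ℂ) : u ⬝ᵥ F z *ᵥ v = (u ⬝ᵥ m) * (v ⬝ᵥ m) := by
    rw [hm, vecMulVec_mulVec, dotProduct_comm m v]
    simp [dotProduct_smul, mul_comm]
  have hsw (u v t : Fin 3 → ℂ) : u ⬝ᵥ F v *ᵥ t = v ⬝ᵥ F u *ᵥ t := by
    rw [hF v t, dotProduct_mulVec_symm (hs t), hF t u, dotProduct_mulVec_symm (hs u)]
  have hxx (v : Fin 3 → ℂ) (hv : v ⬝ᵥ m ≠ 0) : x ⬝ᵥ F v *ᵥ x = 0 := by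
    have h := det_conj_eq_zero (hs v) (hdet v) z x y
    rw [hsw z v z, hsw z v x, hsw z v y, hR, hR, hR, hzm, hxm, hym] at h
    have h2 : (v ⬝ᵥ m) ^ 2 * (x ⬝ᵥ F v *ᵥ x) = 0 := by linear_combination -h
    exact (mul_eq_zero.mp h2).resolve_left (pow_ne_zero 2 hv)
  have hxxy := hxx y (by rw [hym]; exact one_ne_zero)
  have hxxx : x ⬝ᵥ F x *ᵥ x = 0 := by
    have h := hxx (x + y) (by rw [add_dotProduct, hxm, hym, zero_add]; exact one_ne_zero)
    rwa [map_add, add_mulVec, dotProduct_add, hxxy, add_zero] at h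
  have hxy : y ⬝ᵥ F x *ᵥ x = 0 := by rw [hsw, hxxy]
  refine ⟨x - (y ⬝ᵥ F x *ᵥ y) • z, ?_, ?_⟩
  · intro h
    have h1 := Fintype.linearIndependent_iff.mp ((isUnit_det_rows_iff z x y).mpr hB)
      ![-(y ⬝ᵥ F x *ᵥ y), 1, 0] (by
        simp only [Fin.sum_univ_three]
        change -(y ⬝ᵥ F x *ᵥ y) • z + (1 : ℂ) • x + (0 : ℂ) • y = 0
        rw [← h]
        module) 1
    exact one_ne_zero h1
  · refine matrix_ext_of_rows hB fun i j => ?_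
    rw [map_sub, map_smul, sub_mulVec, dotProduct_sub, smul_mulVec, dotProduct_smul, hR,
      zero_mulVec, dotProduct_zero]
    have hzx (v : Fin 3 → ℂ) : z ⬝ᵥ F x *ᵥ v = 0 := by rw [hsw, hR, hxm, zero_mul]
    have hxz (v : Fin 3 → ℂ) : v ⬝ᵥ F x *ᵥ z = 0 := by
      rw [dotProduct_mulVec_symm (hs x), hzx]
    fin_cases i <;> fin_cases j
    · change z ⬝ᵥ F x *ᵥ z - _ • ((z ⬝ᵥ m) * (z ⬝ᵥ m)) = 0; simp [hzx, hzm]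
    · change z ⬝ᵥ F x *ᵥ x - _ • ((z ⬝ᵥ m) * (x ⬝ᵥ m)) = 0; simp [hzx, hzm]
    · change z ⬝ᵥ F x *ᵥ y - _ • ((z ⬝ᵥ m) * (y ⬝ᵥ m)) = 0; simp [hzx, hzm]
    · change x ⬝ᵥ F x *ᵥ z - _ • ((x ⬝ᵥ m) * (z ⬝ᵥ m)) = 0; simp [hxz, hzm]
    · change x ⬝ᵥ F x *ᵥ x - _ • ((x ⬝ᵥ m) * (x ⬝ᵥ m)) = 0; simp [hxxx, hxm]
    · change x ⬝ᵥ F x *ᵥ y - _ • ((x ⬝ᵥ m) * (y ⬝ᵥ m)) = 0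
      simp [dotProduct_mulVec_symm (hs x) x y, hxy, hxm]
    · change y ⬝ᵥ F x *ᵥ z - _ • ((y ⬝ᵥ m) * (z ⬝ᵥ m)) = 0; simp [hxz, hzm]
    · change y ⬝ᵥ F x *ᵥ x - _ • ((y ⬝ᵥ m) * (x ⬝ᵥ m)) = 0; simp [hxy, hxm]
    · change y ⬝ᵥ F x *ᵥ y - _ • ((y ⬝ᵥ m) * (y ⬝ᵥ m)) = 0; simp [hym]

include hs hF hdet in
theorem exists_vecMulVec : ∃ z m : Fin 3 → ℂ, z ≠ 0 ∧ F z = vecMulVec m m ∧ F z *ᵥ z = 0 := by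
  by_cases h : ∃ u z x y : Fin 3 → ℂ, z ≠ 0 ∧ (Matrix.of ![z, x, y]).det ≠ 0 ∧ F u *ᵥ z = 0 ∧
      (x ⬝ᵥ F u *ᵥ x) * (y ⬝ᵥ F u *ᵥ y) ≠ (x ⬝ᵥ F u *ᵥ y) ^ 2
  · obtain ⟨u, z, x, y, hz0, hB, hz, hne⟩ := h
    have hδ := sub_ne_zero.mpr hne
    -- Here `F u` has rank two and kernel spanned by `z`. The two relations are the quadratic and
    -- linear coefficients in `t` of the determinant of `F (v + t u)`, extracted from the values at
    -- `t = 0, 1, -1`.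
    have key (v : Fin 3 → ℂ) : z ⬝ᵥ F v *ᵥ z = 0 ∧ (z ⬝ᵥ F v *ᵥ x) ^ 2 * (y ⬝ᵥ F u *ᵥ y) -
        2 * (z ⬝ᵥ F v *ᵥ x) * (z ⬝ᵥ F v *ᵥ y) * (x ⬝ᵥ F u *ᵥ y) +
        (z ⬝ᵥ F v *ᵥ y) ^ 2 * (x ⬝ᵥ F u *ᵥ x) = 0 := by
      have hzl (v) : z ⬝ᵥ F u *ᵥ v = 0 := by
        rw [dotProduct_mulVec_symm (hs u), hz, dotProduct_zero]
      have h0 := det_conj_eq_zero (hs v) (hdet v) z x y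
      have h1 := det_conj_eq_zero (hs _) (hdet (v + u)) z x y
      have h2 := det_conj_eq_zero (hs _) (hdet (v - u)) z x y
      simp only [map_add, map_sub, add_mulVec, sub_mulVec, dotProduct_add, dotProduct_sub, hzl,
        add_zero, sub_zero] at h0 h1 h2
      have h3 : z ⬝ᵥ F v *ᵥ z = 0 := by
        refine (mul_eq_zero.mp ?_).resolve_right hδ
        linear_combination (h1 + h2) / 2 - h0
      rw [h3] at h0 h1 h2
      refine ⟨h3, ?_⟩
      linear_combination (h2 - h1) / 2
    have hzz : F z *ᵥ z = 0 := by
      refine dotProduct_eq_zero _ fun v => ?_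
      rw [dotProduct_comm, ← dotProduct_mulVec_symm (hs z), hF z v, (key v).1]
    have hsw (v t : Fin 3 → ℂ) : z ⬝ᵥ F v *ᵥ t = v ⬝ᵥ F z *ᵥ t := by
      rw [hF v t, dotProduct_mulVec_symm (hs t), hF t z, dotProduct_mulVec_symm (hs z)]
    have k1 := (key x).2
    have k2 := (key y).2
    have k3 := (key (x + y)).2
    simp only [hsw, add_dotProduct] at k1 k2 k3
    rw [dotProduct_mulVec_symm (hs z) y x] at k2 k3
    obtain ⟨m, hm⟩ := exists_eq_vecMulVec (hs z) hB hzz (by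
      rw [← sub_eq_zero]
      generalize x ⬝ᵥ F z *ᵥ x = β at *
      generalize x ⬝ᵥ F z *ᵥ y = γ at *
      generalize y ⬝ᵥ F z *ᵥ y = δ at *
      generalize x ⬝ᵥ F u *ᵥ x = p at *
      generalize x ⬝ᵥ F u *ᵥ y = q at *
      generalize y ⬝ᵥ F u *ᵥ y = r at *
      -- The vectors `(β, γ)`, `(γ, δ)` and their sum are isotropic for a nondegenerate binary
      -- quadratic form with discriminant `p r - q ^ 2`. So the two are proportional.
      have : (β * δ - γ ^ 2) ^ 2 * (p * r - q ^ 2) = 0 := by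
        have hq : r * β * γ - q * (β * δ + γ ^ 2) + p * γ * δ = 0 := by
          linear_combination (k3 - k1 - k2) / 2
        linear_combination (r * γ ^ 2 - 2 * q * γ * δ + p * δ ^ 2) * k1 -
          (r * β * γ - q * (β * δ + γ ^ 2) + p * γ * δ) * hq
      exact pow_eq_zero_iff two_ne_zero |>.mp ((mul_eq_zero.mp this).resolve_right hδ))
    exact ⟨z, m, hz0, hm, hzz⟩
  · push Not at h
    have hall (u : Fin 3 → ℂ) : ∃ m, F u = vecMulVec m m := by
      obtain ⟨z, hz0, hz⟩ := exists_mulVec_eq_zero_iff.mpr (hdet u)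
      obtain ⟨x, y, hB⟩ := exists_rows_extend hz0
      exact exists_eq_vecMulVec (hs u) hB hz (h u z x y hz0 hB hz)
    -- If every `F u` has rank at most one, a zero of the cubic on a line suffices.
    have hroot : ∃ z : Fin 3 → ℂ, z ≠ 0 ∧ z ⬝ᵥ F z *ᵥ z = 0 := by
      set a : Fin 3 → ℂ := ![1, 0, 0]
      set b : Fin 3 → ℂ := ![0, 1, 0]
      by_cases hb : b ⬝ᵥ F b *ᵥ b = 0
      · exact ⟨b, fun h => by simpa [b] using congrFun h 1, hb⟩
      · obtain ⟨r, hr⟩ := exists_root_cubic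
          ((a ⬝ᵥ F b *ᵥ b + b ⬝ᵥ F a *ᵥ b + b ⬝ᵥ F b *ᵥ a) / (b ⬝ᵥ F b *ᵥ b))
          ((a ⬝ᵥ F a *ᵥ b + a ⬝ᵥ F b *ᵥ a + b ⬝ᵥ F a *ᵥ a) / (b ⬝ᵥ F b *ᵥ b))
          ((a ⬝ᵥ F a *ᵥ a) / (b ⬝ᵥ F b *ᵥ b))
        refine ⟨a + r • b, fun h => by simpa [a, b] using congrFun h 0, ?_⟩
        simp only [map_add, map_smul, add_mulVec, mulVec_add, smul_mulVec, mulVec_smul,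
          dotProduct_add, add_dotProduct, smul_dotProduct, dotProduct_smul, smul_eq_mul]
        field_simp at hr
        linear_combination hr
    obtain ⟨z, hz0, hz⟩ := hroot
    obtain ⟨m, hm⟩ := hall z
    have hmz : m ⬝ᵥ z = 0 := by
      rw [hm, vecMulVec_mulVec] at hz
      simpa [dotProduct_smul, dotProduct_comm z m] using hz
    exact ⟨z, m, hz0, hm, by rw [hm, vecMulVec_mulVec, hmz]; simp⟩

include hs hF hdet in
/-- A ternary cubic whose Hessian determinant vanishes identically is a cone. -/
theorem exists_cone : ∃ x, x ≠ 0 ∧ F x = 0 := by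
  obtain ⟨z, m, hz, hm, hzz⟩ := exists_vecMulVec hs hF hdet
  exact exists_cone_of_vecMulVec hs hF hdet hz hm hzz

end Cone

end VeroneseCubic

/-! ### Cubics with vanishing Aronhold invariant as limits of sums of three cubes -/

namespace VeroneseCubic

open MvPolynomial Matrix Filter Topology

/-- The sequence with initial values `m` and recurrence coefficients `c`. -/
noncomputable def recSeq (c m : Fin 3 → ℂ) : ℕ → ℂ
  | 0 => m 0
  | 1 => m 1
  | 2 => m 2
  | n + 3 => c 0 * recSeq c m n + c 1 * recSeq c m (n + 1) + c 2 * recSeq c m (n + 2)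

theorem eq_recSeq {c : Fin 3 → ℂ} {s : ℕ → ℂ}
    (h : ∀ n, s (n + 3) = c 0 * s n + c 1 * s (n + 1) + c 2 * s (n + 2)) (n : ℕ) :
    s n = recSeq c ![s 0, s 1, s 2] n := by
  induction n using Nat.strong_induction_on with
  | _ n ih =>
    match n with
    | 0 => simp [recSeq]
    | 1 => simp [recSeq]
    | 2 => simp [recSeq]
    | n + 3 =>
      rw [recSeq, h, ih n (by omega), ih (n + 1) (by omega), ih (n + 2) (by omega)]

/-- The derivatives of a ternary cubic, as a linear map. -/
def cornerSliceLin (y : MI → ℂ) : (Fin 3 → ℂ) →ₗ[ℂ] Matrix (Fin 3) (Fin 3) ℂ where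
  toFun := cornerSlice y
  map_add' u v := by simp [cornerSlice, add_smul, Finset.sum_add_distrib]
  map_smul' c u := by simp [cornerSlice, Finset.smul_sum, smul_smul]

theorem cornerSlice_mulVec_comm (y : MI → ℂ) (u v : Fin 3 → ℂ) :
    cornerSlice y u *ᵥ v = cornerSlice y v *ᵥ u := by
  funext i
  simp only [cornerSlice, mulVec, dotProduct, Matrix.sum_apply, Matrix.smul_apply, smul_eq_mul,
    Finset.sum_mul]
  rw [Finset.sum_comm]
  refine Finset.sum_congr rfl fun j _ => Finset.sum_congr rfl fun k _ => ?_
  have : corner (slice y k.castSucc) i j = corner (slice y j.castSucc) i k := by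
    simp only [corner, slice, submatrix_apply, of_apply]
    rw [idx_swap_left, idx_swap_right, ← idx_swap_left]
  rw [this]
  ring

theorem single_dotProduct_cornerSlice_mulVec (y : MI → ℂ) (a b c : Fin 3) :
    Pi.single a 1 ⬝ᵥ cornerSlice y (Pi.single b 1) *ᵥ Pi.single c 1 =
      y (idx a.castSucc b.castSucc c.castSucc) := by
  rw [single_one_dotProduct, mulVec_single_one]
  simp only [cornerSlice, col_apply, Matrix.sum_apply, Matrix.smul_apply]
  rw [Finset.sum_eq_single b]
  · simp [corner, slice, idx_swap_left]
  · intro k _ hk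
    simp [hk]
  · simp

theorem exists_recSeq_of_aronhold_eq_zero {y : MI → ℂ} (hy : aronhold y = 0) :
    ∃ (B : Matrix (Fin 3) (Fin 3) ℂ) (e c m : Fin 3 → ℂ), B.det ≠ 0 ∧ e 0 = 1 ∧ e 1 = 1 ∧
      ∀ i j k : Fin 3, B i ⬝ᵥ cornerSlice y (B j) *ᵥ B k =
        e i * e j * e k * recSeq c m (i + j + k) := by
  have hs (u) : (cornerSliceLin y u).IsSymm := cornerSlice_isSymm y u
  have hF (u v) : cornerSliceLin y u *ᵥ v = cornerSliceLin y v *ᵥ u := cornerSlice_mulVec_comm y u v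
  by_cases h : ∃ w, (cornerSliceLin y w).det ≠ 0
  · obtain ⟨w, hw⟩ := h
    obtain ⟨B, c, m, hB, hm, hBm⟩ := exists_hankel_of_det_ne_zero hs hF
      (fun u v w => cornerSlice_mul_adjugate_mul_isSymm hy u v w) hw
    refine ⟨B, fun _ => 1, c, ![m 0, m 1, m 2], hB, rfl, rfl, fun i j k => ?_⟩
    rw [← eq_recSeq hm, ← hBm, one_mul, one_mul, one_mul]
    rfl
  · push Not at h
    obtain ⟨z, hz, hFz⟩ := exists_cone hs hF h
    change cornerSlice y z = 0 at hFz
    -- On a cone the weight `e 2 = 0` removes the vertex `z`. Only the four values of a binary cubic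
    -- remain, and a recurrence has to produce the last from the first three.
    have main (a b : Fin 3 → ℂ) (c : Fin 3 → ℂ) (hB : (Matrix.of ![a, b, z]).det ≠ 0)
        (hc : b ⬝ᵥ cornerSlice y b *ᵥ b = c 0 * (a ⬝ᵥ cornerSlice y a *ᵥ a) +
          c 1 * (a ⬝ᵥ cornerSlice y a *ᵥ b) + c 2 * (a ⬝ᵥ cornerSlice y b *ᵥ b)) :
        ∃ (B : Matrix (Fin 3) (Fin 3) ℂ) (e c m : Fin 3 → ℂ), B.det ≠ 0 ∧ e 0 = 1 ∧ e 1 = 1 ∧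
          ∀ i j k : Fin 3, B i ⬝ᵥ cornerSlice y (B j) *ᵥ B k =
            e i * e j * e k * recSeq c m (i + j + k) := by
      refine ⟨Matrix.of ![a, b, z], ![1, 1, 0], c, ![a ⬝ᵥ cornerSlice y a *ᵥ a,
        a ⬝ᵥ cornerSlice y a *ᵥ b, a ⬝ᵥ cornerSlice y b *ᵥ b], hB, rfl, rfl, ?_⟩
      have hsw (u v t : Fin 3 → ℂ) : u ⬝ᵥ cornerSlice y v *ᵥ t = v ⬝ᵥ cornerSlice y u *ᵥ t := by
        rw [cornerSlice_mulVec_comm y v t, dotProduct_mulVec_symm (cornerSlice_isSymm y t),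
          cornerSlice_mulVec_comm y t u, dotProduct_mulVec_symm (cornerSlice_isSymm y u)]
      have hz1 (u v) : z ⬝ᵥ cornerSlice y u *ᵥ v = 0 := by
        rw [hsw, hFz, zero_mulVec, dotProduct_zero]
      have hz3 (u v) : u ⬝ᵥ cornerSlice y v *ᵥ z = 0 := by
        rw [dotProduct_mulVec_symm (cornerSlice_isSymm y v), hz1]
      have hsl (u v t) : u ⬝ᵥ cornerSlice y v *ᵥ t = u ⬝ᵥ cornerSlice y t *ᵥ v := by
        rw [cornerSlice_mulVec_comm]
      have h3 : recSeq c ![a ⬝ᵥ cornerSlice y a *ᵥ a, a ⬝ᵥ cornerSlice y a *ᵥ b,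
          a ⬝ᵥ cornerSlice y b *ᵥ b] 3 = b ⬝ᵥ cornerSlice y b *ᵥ b := by
        rw [hc]
        simp [recSeq]
      have f1 := hsl a b a
      have f2 : b ⬝ᵥ cornerSlice y a *ᵥ a = a ⬝ᵥ cornerSlice y a *ᵥ b := by rw [hsw, hsl]
      have f3 := hsw b a b
      have f4 : b ⬝ᵥ cornerSlice y b *ᵥ a = a ⬝ᵥ cornerSlice y b *ᵥ b := by rw [hsl, hsw]
      intro i j k
      change ![a, b, z] i ⬝ᵥ cornerSlice y (![a, b, z] j) *ᵥ ![a, b, z] k = _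
      fin_cases i <;> fin_cases j <;> fin_cases k <;>
        simp [hz1, hz3, hFz, h3, f1, f2, f3, f4] <;> simp [recSeq]
    obtain ⟨a, b, hB⟩ := exists_rows_extend hz
    have hB1 : (Matrix.of ![a, b, z]).det ≠ 0 := by
      have : (Matrix.of ![a, b, z]).det = (Matrix.of ![z, a, b]).det := by
        simp [det_fin_three]
        ring
      rwa [this]
    have hB2 : (Matrix.of ![b, a, z]).det ≠ 0 := by
      have : (Matrix.of ![b, a, z]).det = -(Matrix.of ![z, a, b]).det := by
        simp [det_fin_three]
        ring
      rwa [this, neg_ne_zero]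
    -- A nonzero value among the first three yields the recurrence; if all three vanish, exchanging
    -- `a` and `b` puts the only possibly nonzero value first.
    by_cases h0 : a ⬝ᵥ cornerSlice y a *ᵥ a = 0
    · by_cases h1 : a ⬝ᵥ cornerSlice y a *ᵥ b = 0
      · by_cases h2 : a ⬝ᵥ cornerSlice y b *ᵥ b = 0
        · exact main b a ![0, 0, 0] hB2 (by simp [h0])
        · exact main a b ![0, 0, (b ⬝ᵥ cornerSlice y b *ᵥ b) / (a ⬝ᵥ cornerSlice y b *ᵥ b)] hB1
            (by simp [h2])
      · exact main a b ![0, (b ⬝ᵥ cornerSlice y b *ᵥ b) / (a ⬝ᵥ cornerSlice y a *ᵥ b), 0] hB1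
            (by simp [h1])
    · exact main a b ![(b ⬝ᵥ cornerSlice y b *ᵥ b) / (a ⬝ᵥ cornerSlice y a *ᵥ a), 0, 0] hB1
            (by simp [h0])

/-- The cubic arises from the cube of `w 0 + t w 1 + t ^ 2 w 2` by replacing each `t ^ n` with the
`n`-th term of the sequence. The covectors `β` read off `1` and `t` on this curve; they are rows of
`B`, dual to the columns of `B⁻¹`, and this duality survives the weights because `e 0 = e 1 = 1`. -/
theorem exists_curve_of_aronhold_eq_zero {y : MI → ℂ} (hy : aronhold y = 0)
    (h3 : ∀ i j, y (idx i j 3) = 0) : ∃ (w : Fin 3 → Fin 4 → ℂ) (β : Fin 2 → Fin 4 → ℂ)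
      (c m : Fin 3 → ℂ), (∀ i j, β i ⬝ᵥ w j = if (i : ℕ) = j then 1 else 0) ∧
      ∀ p q r, y (idx p q r) = ∑ i : Fin 3, ∑ j : Fin 3, ∑ k : Fin 3,
        w i p * w j q * w k r * recSeq c m (i + j + k) := by
  obtain ⟨B, e, c, m, hB, he0, he1, hBm⟩ := exists_recSeq_of_aronhold_eq_zero hy
  have hu : IsUnit B.det := isUnit_iff_ne_zero.mpr hB
  have hsn (f : Fin 3 → ℂ) : (Fin.snoc f 0 : Fin 4 → ℂ) 3 = 0 := Fin.snoc_last (α := fun _ => ℂ) 0 f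
  refine ⟨fun i => Fin.snoc (fun a => e i * B⁻¹ a i) 0, fun i => Fin.snoc (B i.castSucc) 0, c, m,
    fun i j => ?_, fun p q r => ?_⟩
  · have h1 : (B * B⁻¹) i.castSucc j = if (i : ℕ) = j then 1 else 0 := by
      rw [mul_nonsing_inv _ hu, one_apply]
      simp [Fin.ext_iff]
    have he : e j * (if (i : ℕ) = j then 1 else 0) = if (i : ℕ) = (j : ℕ) then 1 else 0 := by
      fin_cases i <;> fin_cases j <;> simp [he0, he1]
    rw [← he, ← h1, dotProduct, Fin.sum_univ_castSucc, Matrix.mul_apply, Finset.mul_sum]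
    simp [mul_left_comm, hsn]
  · induction p using Fin.lastCases with
    | last =>
      rw [idx_swap_left, idx_swap_right]
      simpa [hsn] using h3 q r
    | cast p =>
    induction q using Fin.lastCases with
    | last =>
      rw [idx_swap_right]
      simpa [hsn] using h3 p.castSucc r
    | cast q =>
    induction r using Fin.lastCases with
    | last => simpa [hsn] using h3 p.castSucc q.castSucc
    | cast r =>
    have hsingle (a : Fin 3) : (Pi.single a 1 : Fin 3 → ℂ) = ∑ i, B⁻¹ a i • B i := by
      have : (Pi.single a 1 : Fin 3 → ℂ) = (B⁻¹ * B) a := by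
        rw [nonsing_inv_mul _ hu]
        funext j
        simp [one_apply, Pi.single_apply, eq_comm]
      rw [this]
      funext j
      simp [Matrix.mul_apply]
    have hlin (v : Fin 3 → ℂ) : cornerSlice y v = cornerSliceLin y v := rfl
    rw [← single_dotProduct_cornerSlice_mulVec y p q r, hsingle p, hsingle q, hsingle r, hlin, map_sum]
    simp only [sum_dotProduct, Matrix.sum_mulVec, mulVec_sum, dotProduct_sum, map_smul,
      smul_dotProduct, dotProduct_smul, smul_mulVec, mulVec_smul, Fin.snoc_castSucc, smul_eq_mul]
    simp only [← hlin, hBm]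
    simp only [Fin.sum_univ_three]
    ring

theorem exists_roots (c : Fin 3 → ℂ) : ∃ r : Fin 3 → ℂ,
    c = ![r 0 * r 1 * r 2, -(r 0 * r 1 + r 0 * r 2 + r 1 * r 2), r 0 + r 1 + r 2] := by
  obtain ⟨a, ha⟩ := exists_root_cubic (-c 2) (-c 1) (-c 0)
  obtain ⟨d, hd⟩ := IsAlgClosed.exists_pow_nat_eq
    ((c 2 - a) ^ 2 - 4 * (a ^ 2 - c 2 * a - c 1)) (n := 2) (by norm_num)
  refine ⟨![a, (c 2 - a + d) / 2, (c 2 - a - d) / 2], ?_⟩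
  funext i
  fin_cases i
  · simp
    linear_combination -ha + a / 4 * hd
  · simp
    linear_combination -hd / 4
  · simp
    ring

/-- For distinct roots the Vandermonde matrix matches the three initial values, and every geometric
sequence with ratio a root satisfies the recurrence. -/
theorem recSeq_eq_sum_pow {r : Fin 3 → ℂ} (hr : Function.Injective r) (m : Fin 3 → ℂ) :
    ∃ b : Fin 3 → ℂ, ∀ n, recSeq ![r 0 * r 1 * r 2, -(r 0 * r 1 + r 0 * r 2 + r 1 * r 2),
      r 0 + r 1 + r 2] m n = ∑ i, b i * r i ^ n := by
  have hu : IsUnit (vandermonde r).det := isUnit_iff_ne_zero.mpr (det_vandermonde_ne_zero_iff.mpr hr)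
  obtain ⟨b, hb⟩ : ∃ b : Fin 3 → ℂ, b ᵥ* vandermonde r = m :=
    ⟨m ᵥ* (vandermonde r)⁻¹, by rw [vecMul_vecMul, nonsing_inv_mul _ hu, vecMul_one]⟩
  have hb' (n : Fin 3) : ∑ i, b i * r i ^ (n : ℕ) = m n := by
    rw [← hb]
    rfl
  refine ⟨b, fun n => ?_⟩
  induction n using Nat.strong_induction_on with
  | _ n ih =>
    match n with
    | 0 => exact (hb' 0).symm
    | 1 => exact (hb' 1).symm
    | 2 => exact (hb' 2).symm
    | n + 3 =>
      rw [recSeq, ih n (by omega), ih (n + 1) (by omega), ih (n + 2) (by omega)]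
      simp only [Fin.sum_univ_three, cons_val_zero, cons_val_one, cons_val]
      ring

theorem continuous_recSeq {c : ℂ → Fin 3 → ℂ} (hc : Continuous c) (m : Fin 3 → ℂ) (n : ℕ) :
    Continuous fun τ => recSeq (c τ) m n := by
  induction n using Nat.strong_induction_on with
  | _ n ih =>
    match n with
    | 0 => exact continuous_const
    | 1 => exact continuous_const
    | 2 => exact continuous_const
    | n + 3 =>
      have h0 := ih n (by omega)
      have h1 := ih (n + 1) (by omega)
      have h2 := ih (n + 2) (by omega)
      simp only [recSeq]
      fun_prop

theorem eventually_injective_add_mul (r : Fin 3 → ℂ) :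
    ∀ᶠ τ : ℂ in 𝓝[≠] 0, Function.Injective fun i : Fin 3 => r i + τ * (i : ℕ) := by
  have h (i j : Fin 3) (hij : i ≠ j) : ∀ᶠ τ : ℂ in 𝓝[≠] 0,
      r i + τ * (i : ℕ) ≠ r j + τ * (j : ℕ) := by
    have hd : ((i : ℕ) : ℂ) - (j : ℕ) ≠ 0 := by
      rw [sub_ne_zero, Ne, Nat.cast_inj, Fin.val_inj]
      exact hij
    by_cases hr : r i = r j
    · filter_upwards [self_mem_nhdsWithin] with τ hτ h
      rw [hr, add_right_inj, ← sub_eq_zero, ← mul_sub] at h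
      exact (mul_ne_zero hτ hd) h
    · refine Filter.Eventually.filter_mono nhdsWithin_le_nhds ?_
      have hcont : Continuous fun τ : ℂ => r i + τ * (i : ℕ) - (r j + τ * (j : ℕ)) := by fun_prop
      filter_upwards [(hcont.tendsto 0).eventually_ne (b₂ := 0)
        (by simpa [sub_eq_zero] using hr)] with τ hτ
      exact sub_ne_zero.mp hτ
  have h2 : ∀ᶠ τ : ℂ in 𝓝[≠] 0, ∀ i j : Fin 3, i ≠ j →
      r i + τ * (i : ℕ) ≠ r j + τ * (j : ℕ) := by
    simp only [eventually_all]
    exact h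
  filter_upwards [h2] with τ hτ i j hij
  by_contra hne
  exact hτ i j hne hij

/-- Evaluating with `β` turns a linear relation between the cubes into relations for `1`, `r` and `r
^ 2`, excluded by Vandermonde. -/
theorem linearIndependent_veroneseVec_curve {w : Fin 3 → Fin 4 → ℂ} {β : Fin 2 → Fin 4 → ℂ}
    (hβ : ∀ i j, β i ⬝ᵥ w j = if (i : ℕ) = j then 1 else 0) {r : Fin 3 → ℂ}
    (hr : Function.Injective r) :
    LinearIndependent ℂ fun l => veroneseVec 3 3 (∑ j : Fin 3, r l ^ (j : ℕ) • w j) := by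
  have h0 (l) : β 0 ⬝ᵥ (∑ j : Fin 3, r l ^ (j : ℕ) • w j) = 1 := by
    simp [hβ, Fin.sum_univ_three]
  have h1 (l) : β 1 ⬝ᵥ (∑ j : Fin 3, r l ^ (j : ℕ) • w j) = r l := by
    simp [hβ, Fin.sum_univ_three]
  rw [Fintype.linearIndependent_iff]
  intro g hg
  have key (n : Fin 3) : ∑ l, g l * r l ^ (n : ℕ) = 0 := by
    have e (a b c : Fin 2) := congrArg (tri (β a) (β b) (β c)) hg
    simp only [map_sum, map_smul, tri_veroneseVec, map_zero, smul_eq_mul] at e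
    fin_cases n
    · simpa [h0, h1] using e 0 0 0
    · simpa [h0, h1] using e 0 0 1
    · simpa [h0, h1, pow_two] using e 0 1 1
  exact congrFun (eq_zero_of_vecMul_eq_zero (det_vandermonde_ne_zero_iff.mpr hr)
    (funext fun n => key n))

theorem sum_mul_sum_pow (u v w b R : Fin 3 → ℂ) :
    ∑ i : Fin 3, ∑ j : Fin 3, ∑ k : Fin 3,
      u i * v j * w k * ∑ l, b l * R l ^ ((i : ℕ) + j + k) =
    ∑ l, b l * ((∑ j : Fin 3, R l ^ (j : ℕ) * u j) * (∑ j : Fin 3, R l ^ (j : ℕ) * v j) *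
      ∑ j : Fin 3, R l ^ (j : ℕ) * w j) := by
  simp only [Fin.sum_univ_three, Fin.val_zero, Fin.val_one, Fin.val_two]
  ring

/-- Ternary cubics with vanishing Aronhold invariant are limits of sums of three cubes. -/
theorem mem_closure_cubeSums_of_aronhold_eq_zero {y : MI → ℂ} (hy : aronhold y = 0)
    (h3 : ∀ i j, y (idx i j 3) = 0) : y ∈ closure (cubeSums 3 ⊤) := by
  obtain ⟨w, β, c, m, hβ, hw⟩ := exists_curve_of_aronhold_eq_zero hy h3
  obtain ⟨r, rfl⟩ := exists_roots c
  -- The roots are separated by a parameter `τ` while the initial values `m` stay fixed, so the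
  -- cubic varies continuously.
  set R : ℂ → Fin 3 → ℂ := fun τ i => r i + τ * (i : ℕ) with hR
  set C : ℂ → Fin 3 → ℂ := fun τ => ![R τ 0 * R τ 1 * R τ 2,
    -(R τ 0 * R τ 1 + R τ 0 * R τ 2 + R τ 1 * R τ 2), R τ 0 + R τ 1 + R τ 2] with hC
  have hCc : Continuous C := by
    refine continuous_pi fun i => ?_
    fin_cases i <;> simp [hC, hR] <;> fun_prop
  let Y : ℂ → MI → ℂ := fun τ α => ∑ i : Fin 3, ∑ j : Fin 3, ∑ k : Fin 3,
    w i (rep α).1 * w j (rep α).2.1 * w k (rep α).2.2 * recSeq (C τ) m (i + j + k)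
  have hYc : Continuous Y := by
    refine continuous_pi fun α => ?_
    have := continuous_recSeq hCc m
    fun_prop
  have hY0 : Y 0 = y := by
    funext α
    have hC0 : C 0 = ![r 0 * r 1 * r 2, -(r 0 * r 1 + r 0 * r 2 + r 1 * r 2), r 0 + r 1 + r 2] := by
      simp [hC, hR]
    conv_rhs => rw [← idx_rep α, hw, ← hC0]
  rw [← hY0]
  refine mem_closure_of_tendsto (hYc.continuousAt.tendsto.mono_left nhdsWithin_le_nhds)
    (f := Y) (b := 𝓝[≠] (0 : ℂ)) ?_
  filter_upwards [eventually_injective_add_mul r] with τ hτ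
  obtain ⟨b, hb⟩ := recSeq_eq_sum_pow (r := R τ) hτ m
  refine ⟨b, fun l => ∑ j : Fin 3, R τ l ^ (j : ℕ) • w j, fun _ => Submodule.mem_top,
    linearIndependent_veroneseVec_curve hβ hτ, ?_⟩
  funext α
  rw [Finset.sum_apply]
  simp only [Pi.smul_apply, smul_eq_mul]
  conv_rhs => rw [← idx_rep α]
  simp only [veroneseVec_idx, Y, Finset.sum_apply, Pi.smul_apply, smul_eq_mul]
  simp only [hC, hb]
  exact sum_mul_sum_pow _ _ _ _ _

end VeroneseCubic

/-! ### Sums of four cubes dominate the sixteen coordinates of degree at most one in `t 3` -/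

namespace VeroneseCubic

open MvPolynomial Matrix Filter Topology

/-- The derivative of a sum of four cubes. -/
noncomputable def cubesDeriv (t h : Fin 4 → Fin 4 → ℂ) (i j k : Fin 4) : ℂ :=
  ∑ l, (h l i * t l j * t l k + t l i * h l j * t l k + t l i * t l j * h l k)

theorem exists_hasStrictFDerivAt_sum_veroneseVec (t : Fin 4 → Fin 4 → ℂ) :
    ∃ D : (Fin 4 → Fin 4 → ℂ) →L[ℂ] (MI → ℂ),
      HasStrictFDerivAt (fun t : Fin 4 → Fin 4 → ℂ => ∑ l, veroneseVec 3 3 (t l)) D t ∧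
      ∀ h i j k, D h (idx i j k) = cubesDeriv t h i j k := by
  have key (i j k : Fin 4) : ∃ D : (Fin 4 → Fin 4 → ℂ) →L[ℂ] ℂ,
      HasStrictFDerivAt (fun t : Fin 4 → Fin 4 → ℂ => (∑ l, veroneseVec 3 3 (t l)) (idx i j k)) D t ∧
      ∀ h, D h = cubesDeriv t h i j k := by
    let ev (l i : Fin 4) : (Fin 4 → Fin 4 → ℂ) →L[ℂ] ℂ :=
      (ContinuousLinearMap.proj (φ := fun _ : Fin 4 => ℂ) i).comp
        (ContinuousLinearMap.proj (φ := fun _ : Fin 4 => Fin 4 → ℂ) l)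
    have hev (l i : Fin 4) : HasStrictFDerivAt (fun t : Fin 4 → Fin 4 → ℂ => t l i) (ev l i) t :=
      (ev l i).hasStrictFDerivAt
    have := HasStrictFDerivAt.fun_sum (u := Finset.univ)
      fun l _ => ((hev l i).mul (hev l j)).mul (hev l k)
    refine ⟨_, this.congr_of_eventuallyEq (Eventually.of_forall fun t => ?_), fun h => ?_⟩
    · simp
    · rw [_root_.sum_apply]
      refine Finset.sum_congr rfl fun l _ => ?_
      simp [ev]
      ring
  choose D hD hD' using key
  have hpi : HasStrictFDerivAt (fun t : Fin 4 → Fin 4 → ℂ => ∑ l, veroneseVec 3 3 (t l))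
      (ContinuousLinearMap.pi fun α => D (rep α).1 (rep α).2.1 (rep α).2.2) t := by
    refine hasStrictFDerivAt_pi.mpr fun α => ?_
    have := hD (rep α).1 (rep α).2.1 (rep α).2.2
    rwa [idx_rep] at this
  refine ⟨_, hpi, fun h i j k => ?_⟩
  rw [← hD' i j k h]
  have h1 := (hasStrictFDerivAt_pi.mp hpi (idx i j k)).hasFDerivAt
  exact congrArg (fun L : _ →L[ℂ] ℂ => L h) (h1.unique (hD i j k).hasFDerivAt)

/-- Four points in general position. -/
def framePoints : Fin 4 → Fin 4 → ℂ :=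
  ![![1, 0, 0, 0], ![0, 1, 0, 0], ![0, 0, 1, 0], ![1, 1, 1, 1]]

theorem exists_cubesDeriv_framePoints_eq (s : MI → ℂ) : ∃ h : Fin 4 → Fin 4 → ℂ,
    ∀ i j k, i ≠ 3 → j ≠ 3 → cubesDeriv framePoints h i j k = s (idx i j k) := by
  -- The tangent vector `u` at `(1, 1, 1, 1)` contributes `u i + u j + u k`. The other three points
  -- contribute nothing at `012`, `013`, `023`, `123`, so these four coordinates determine `u`, with
  -- `u 3 = r`. The tangent vectors at the other points then correct the coordinates with a repeated
  -- index below 3.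
  let r : ℂ := (s (idx 0 1 3) + s (idx 0 2 3) + s (idx 1 2 3) - 2 * s (idx 0 1 2)) / 3
  let u : Fin 4 → ℂ := ![s (idx 0 1 2) - s (idx 1 2 3) + r, s (idx 0 1 2) - s (idx 0 2 3) + r,
    s (idx 0 1 2) - s (idx 0 1 3) + r, r]
  refine ⟨![fun b => if b = 0 then s (idx 0 0 0) / 3 - u 0 else s (idx 0 0 b) - 2 * u 0 - u b,
    fun b => if b = 1 then s (idx 1 1 1) / 3 - u 1 else s (idx 1 1 b) - 2 * u 1 - u b,
    fun b => if b = 2 then s (idx 2 2 2) / 3 - u 2 else s (idx 2 2 b) - 2 * u 2 - u b, u],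
    fun i j k hi hj => ?_⟩
  fin_cases i <;> first | exact absurd rfl hi | skip
  all_goals fin_cases j <;> first | exact absurd rfl hj | skip
  all_goals
    fin_cases k <;> simp [cubesDeriv, Fin.sum_univ_four, framePoints, idx_sort, u, r] <;> ring

theorem linearIndependent_veroneseVec_of_frame {t : Fin 4 → Fin 4 → ℂ}
    (ht : ∀ l (a : Fin 3), t l a.castSucc = framePoints l a.castSucc) :
    LinearIndependent ℂ fun l => veroneseVec 3 3 (t l) := by
  rw [Fintype.linearIndependent_iff]
  intro g hg
  have e (i j k : Fin 3) := congrFun hg (idx i.castSucc j.castSucc k.castSucc)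
  simp only [Finset.sum_apply, Pi.smul_apply, veroneseVec_idx, ht, smul_eq_mul, Pi.zero_apply,
    Fin.sum_univ_four] at e
  have h3 : g 3 = 0 := by simpa [framePoints] using e 0 1 2
  have h0 : g 0 = 0 := by simpa [framePoints, h3] using e 0 0 0
  have h1 : g 1 = 0 := by simpa [framePoints, h3] using e 1 1 1
  have h2 : g 2 = 0 := by simpa [framePoints, h3] using e 2 2 2
  intro l
  fin_cases l <;> assumption

theorem continuous_veroneseVec : Continuous (veroneseVec 3 3) := by
  unfold veroneseVec
  fun_prop

/-- The sums of four cubes dominate the space of the coordinates of degree at most one in the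
last variable. -/
theorem exists_isOpen_sum_veroneseVec : ∃ U : Set (MI → ℂ), IsOpen U ∧ U.Nonempty ∧ ∀ y ∈ U,
    ∃ t : Fin 4 → Fin 4 → ℂ, LinearIndependent ℂ (fun l => veroneseVec 3 3 (t l)) ∧
      LinearIndependent ℂ (fun l => veroneseVec 3 3 (Function.update (t l) 3 0)) ∧
      ∀ i j k, i ≠ 3 → j ≠ 3 → y (idx i j k) = (∑ l, veroneseVec 3 3 (t l)) (idx i j k) := by
  obtain ⟨D, hD, hD'⟩ := exists_hasStrictFDerivAt_sum_veroneseVec framePoints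
  -- Adding free coordinates of degree at least two in the last variable makes the derivative
  -- surjective onto the whole space.
  let M : (MI → ℂ) →L[ℂ] (MI → ℂ) := ContinuousLinearMap.pi fun α =>
    (if 2 ≤ α.1 3 then 1 else 0 : ℂ) • ContinuousLinearMap.proj α
  have hM (z : MI → ℂ) {i j : Fin 4} (k : Fin 4) (hi : i ≠ 3) (hj : j ≠ 3) : M z (idx i j k) = 0 := by
    have : ¬ 2 ≤ (idx i j k).1 3 := by
      simp only [idx, Pi.add_apply, Pi.single_apply, hi.symm, hj.symm, if_false]
      split_ifs <;> simp
    simp [M, this]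
  have hM' (z : MI → ℂ) {α : MI} (hα : 2 ≤ α.1 3) : M z α = z α := by simp [M, hα]
  have hΦ : HasStrictFDerivAt (fun x : (Fin 4 → Fin 4 → ℂ) × (MI → ℂ) =>
      ∑ l, veroneseVec 3 3 (x.1 l) + M x.2)
      (D.comp (ContinuousLinearMap.fst ℂ _ _) + M.comp (ContinuousLinearMap.snd ℂ _ _))
      (framePoints, 0) :=
    (HasStrictFDerivAt.comp (framePoints, (0 : MI → ℂ)) (f := Prod.fst) hD hasStrictFDerivAt_fst).add
      (M.hasStrictFDerivAt.comp (framePoints, (0 : MI → ℂ)) hasStrictFDerivAt_snd)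
  have hsurj : (D.comp (ContinuousLinearMap.fst ℂ _ _) +
      M.comp (ContinuousLinearMap.snd ℂ _ _)).range = ⊤ := by
    rw [LinearMap.range_eq_top]
    intro s
    obtain ⟨h, hh⟩ := exists_cubesDeriv_framePoints_eq s
    refine ⟨(h, s - D h), ?_⟩
    funext α
    change D h α + M (s - D h) α = s α
    by_cases hα : 2 ≤ α.1 3
    · rw [hM' _ hα, Pi.sub_apply, add_sub_cancel]
    · obtain ⟨i, j, k, hi, hj, rfl⟩ : ∃ i j k, i ≠ 3 ∧ j ≠ 3 ∧ α = idx i j k := by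
        obtain ⟨i, j, k, rfl⟩ := exists_idx α
        by_cases hi : i = 3
        · subst hi
          refine ⟨j, k, 3, ?_, ?_, by rw [idx_swap_left, idx_swap_right]⟩ <;> rintro rfl <;>
            simp [idx] at hα
        · by_cases hj : j = 3
          · subst hj
            refine ⟨i, k, 3, hi, ?_, by rw [idx_swap_right]⟩
            rintro rfl
            simp [idx] at hα
          · exact ⟨i, j, k, hi, hj, rfl⟩
      rw [hM _ _ hi hj, hD', hh i j k hi hj, add_zero]
  -- A surjective strict derivative makes the map open at this point; both independence conditions
  -- hold nearby.
  have hmap := hΦ.map_nhds_eq_of_surj hsurj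
  set V : Set ((Fin 4 → Fin 4 → ℂ) × (MI → ℂ)) :=
    {x | LinearIndependent ℂ (fun l => veroneseVec 3 3 (x.1 l))} ∩
    {x | LinearIndependent ℂ (fun l => veroneseVec 3 3 (Function.update (x.1 l) 3 0))} with hV
  have hVn : V ∈ 𝓝 (framePoints, (0 : MI → ℂ)) := by
    have hc1 : Continuous fun x : (Fin 4 → Fin 4 → ℂ) × (MI → ℂ) =>
        fun l => veroneseVec 3 3 (x.1 l) :=
      continuous_pi fun l => continuous_veroneseVec.comp (by fun_prop)
    have hc2 : Continuous fun x : (Fin 4 → Fin 4 → ℂ) × (MI → ℂ) =>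
        fun l => veroneseVec 3 3 (Function.update (x.1 l) 3 0) :=
      continuous_pi fun l => continuous_veroneseVec.comp
        (Continuous.update (by fun_prop) 3 continuous_const)
    refine ((isOpen_setOfPred_linearIndependent.preimage hc1).inter
      (isOpen_setOfPred_linearIndependent.preimage hc2)).mem_nhds ⟨?_, ?_⟩
    · exact linearIndependent_veroneseVec_of_frame fun l a => rfl
    · refine linearIndependent_veroneseVec_of_frame fun l a => ?_
      exact Function.update_of_ne (Fin.castSucc_ne_last a) _ _
  have hU := hmap ▸ image_mem_map hVn
  obtain ⟨U, hUV, hUo, hU0⟩ := mem_nhds_iff.mp hU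
  refine ⟨U, hUo, ⟨_, hU0⟩, fun y hy => ?_⟩
  obtain ⟨x, ⟨h1, h2⟩, rfl⟩ := hUV hy
  refine ⟨x.1, h1, h2, fun i j k hi hj => ?_⟩
  simp [hM _ _ hi hj]

theorem eq_zero_of_forall_mem_isOpen {σ : Type*} [Finite σ] {f : MvPolynomial σ ℂ}
    {U : Set (σ → ℂ)} (hU : IsOpen U) (hne : U.Nonempty) (h : ∀ y ∈ U, aeval y f = 0) : f = 0 := by
  classical
  have := Fintype.ofFinite σ
  obtain ⟨x, hx⟩ := hne
  obtain ⟨ε, hε, hball⟩ := Metric.isOpen_iff.mp hU x hx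
  refine MvPolynomial.funext_set (fun i => Metric.ball (x i) ε) (fun i => ?_) fun y hy => ?_
  · exact infinite_of_mem_nhds (x i) (Metric.ball_mem_nhds _ hε)
  · rw [map_zero, ← coe_aeval_eq_eval]
    refine h y (hball ?_)
    rw [ball_pi _ hε]
    exact hy

end VeroneseCubic

/-! ### Plane cubics and the fourth secant variety of the plane -/

namespace VeroneseCubic

open MvPolynomial Matrix Filter Topology

theorem exists_matrix_forall_mem_iff {T : Submodule ℂ (Fin 4 → ℂ)} (hT : Module.finrank ℂ T = 3) :
    ∃ g : Matrix (Fin 4) (Fin 4) ℂ, IsUnit g.det ∧ ∀ t, t ∈ T ↔ (g *ᵥ t) 3 = 0 := by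
  have hlt : T < ⊤ := by
    rw [lt_top_iff_ne_top]
    rintro rfl
    simp at hT
  obtain ⟨φ, hφ, hle⟩ := Submodule.exists_le_ker_of_lt_top T hlt
  have hker : T = LinearMap.ker φ := by
    refine Submodule.eq_of_le_of_finrank_eq hle ?_
    have h1 := φ.finrank_range_add_finrank_ker
    rw [LinearMap.range_eq_top.mpr (LinearMap.surjective hφ), finrank_top] at h1
    simp at h1
    omega
  obtain ⟨a, ha⟩ : ∃ a : Fin 4 → ℂ, ∀ t, φ t = a ⬝ᵥ t := by
    refine ⟨fun i => φ (Pi.single i 1), fun t => ?_⟩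
    rw [LinearMap.pi_apply_eq_sum_univ φ, dotProduct]
    refine Finset.sum_congr rfl fun i _ => ?_
    rw [smul_eq_mul, mul_comm]
    congr 2
    funext j
    simp [Pi.single_apply, eq_comm]
  obtain ⟨m, hm⟩ : ∃ m, a m ≠ 0 := by
    by_contra! h
    exact hφ (LinearMap.ext fun t => by simp [ha, funext h])
  -- The last row is the equation of the plane; the others are the coordinate functions except the
  -- `m`-th, where that equation has a nonzero coefficient.
  let g : Matrix (Fin 4) (Fin 4) ℂ :=
    of fun i => if i = 3 then a else Pi.single (Equiv.swap m 3 i) 1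
  have hg3 (t) : (g *ᵥ t) 3 = φ t := by
    rw [ha]
    simp [mulVec, g]
  have hgi (t) {i : Fin 4} (hi : i ≠ 3) : (g *ᵥ t) i = t (Equiv.swap m 3 i) := by
    simp [mulVec, g, hi]
  refine ⟨g, ?_, fun t => by rw [hg3, hker, LinearMap.mem_ker]⟩
  rw [isUnit_iff_ne_zero]
  intro hdet
  obtain ⟨x, hx, hgx⟩ := exists_mulVec_eq_zero_iff.mpr hdet
  have h1 (j) (hj : j ≠ m) : x j = 0 := by
    have h2 : Equiv.swap m 3 j ≠ 3 := by
      rw [Ne, Equiv.swap_apply_eq_iff, Equiv.swap_apply_right]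
      exact hj
    have := hgi x h2
    rw [hgx, Equiv.swap_apply_self] at this
    exact this.symm
  apply hx
  funext j
  by_cases hj : j = m
  · subst hj
    have h2 := hg3 x
    rw [hgx, ha, dotProduct, Finset.sum_eq_single j (fun i _ hi => by rw [h1 i hi, mul_zero])
      (by simp)] at h2
    exact (mul_eq_zero.mp h2.symm).resolve_left hm
  · exact h1 j hj

theorem act_act_of_mul_eq_one {g h : Matrix (Fin 4) (Fin 4) ℂ} (hgh : g * h = 1) (s : MI → ℂ) :
    act g (act h s) = s := by
  rw [act_act, hgh, act_one]

theorem act_mem_cubeSums {k : ℕ} {T T' : Submodule ℂ (Fin 4 → ℂ)} {g : Matrix (Fin 4) (Fin 4) ℂ}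
    (hg : IsUnit g.det) (h : ∀ t ∈ T, g *ᵥ t ∈ T') {s : MI → ℂ} (hs : s ∈ cubeSums k T) :
    act g s ∈ cubeSums k T' := by
  obtain ⟨b, t, ht, hli, rfl⟩ := hs
  refine ⟨b, fun i => g *ᵥ t i, fun i => h _ (ht i), ?_, by simp [act_veroneseVec]⟩
  have h1 : LinearMap.ker (act (R := ℂ) g) = ⊥ := by
    refine LinearMap.ker_eq_bot_of_inverse (g := act g⁻¹) (LinearMap.ext fun s => ?_)
    exact act_act_of_mul_eq_one (nonsing_inv_mul _ hg) s
  have h2 : (fun i => veroneseVec 3 3 (g *ᵥ t i)) = act g ∘ fun i => veroneseVec 3 3 (t i) :=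
    funext fun i => (act_veroneseVec g (t i)).symm
  rw [h2]
  exact hli.map' (act g) h1

theorem sum_veroneseVec_mem_cubeSums {k : ℕ} {T : Submodule ℂ (Fin 4 → ℂ)} {t : Fin k → Fin 4 → ℂ}
    (ht : ∀ i, t i ∈ T) (h : LinearIndependent ℂ fun i => veroneseVec 3 3 (t i)) :
    ∑ i, veroneseVec 3 3 (t i) ∈ cubeSums k T :=
  ⟨fun _ => 1, t, ht, h, by simp⟩

theorem sum_veroneseVec_ne_zero {k : ℕ} [NeZero k] {t : Fin k → Fin 4 → ℂ}
    (h : LinearIndependent ℂ fun i => veroneseVec 3 3 (t i)) :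
    ∑ i, veroneseVec 3 3 (t i) ≠ 0 := by
  intro h0
  have := Fintype.linearIndependent_iff.mp h (fun _ => 1) (by simpa using h0) 0
  exact one_ne_zero this

theorem exists_idx_last {α : MI} (h : α.1 3 ≠ 0) : ∃ i j, α = idx i j 3 := by
  obtain ⟨i, j, k, rfl⟩ := exists_idx α
  by_cases hk : k = 3
  · exact ⟨i, j, by rw [hk]⟩
  by_cases hj : j = 3
  · exact ⟨i, k, by rw [hj, idx_swap_right]⟩
  by_cases hi : i = 3
  · exact ⟨j, k, by rw [hi, idx_swap_left, idx_swap_right]⟩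
  · simp [idx, Ne.symm hi, Ne.symm hj, Ne.symm hk] at h

/-- The restriction of a cubic to the first three variables. -/
def restrict {R : Type*} [Zero R] (y : MI → R) : MI → R := fun α => if α.1 3 = 0 then y α else 0

theorem restrict_veroneseVec (t : Fin 4 → ℂ) :
    restrict (veroneseVec 3 3 t) = veroneseVec 3 3 (Function.update t 3 0) := by
  funext α
  simp only [restrict, veroneseVec]
  rw [Fin.prod_univ_castSucc (n := 3), Fin.prod_univ_castSucc (n := 3)]
  have h (i : Fin 3) : Function.update t 3 0 i.castSucc = t i.castSucc :=
    Function.update_of_ne (Fin.castSucc_ne_last i) _ _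
  simp only [h]
  change _ = _ * Function.update t 3 0 3 ^ α.1 3
  split_ifs with h0
  · rw [h0, pow_zero]
    change _ * _ ^ α.1 3 = _
    rw [h0, pow_zero]
  · simp [h0]

theorem restrict_sum {ι : Type*} (s : Finset ι) (f : ι → MI → ℂ) :
    restrict (∑ i ∈ s, f i) = ∑ i ∈ s, restrict (f i) := by
  funext α
  by_cases h : α.1 3 = 0 <;> simp [restrict, h]

/-- The restriction of a cubic to the first three variables, as a linear map. -/
def restrictLin : (MI → ℂ) →ₗ[ℂ] (MI → ℂ) where
  toFun := restrict
  map_add' a b := by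
    funext α
    by_cases h : α.1 3 = 0 <;> simp [restrict, h]
  map_smul' c a := by
    funext α
    by_cases h : α.1 3 = 0 <;> simp [restrict, h]

theorem restrict_eq_self {y : MI → ℂ} (h : ∀ i j, y (idx i j 3) = 0) : restrict y = y := by
  funext α
  by_cases h0 : α.1 3 = 0
  · simp [restrict, h0]
  · obtain ⟨i, j, rfl⟩ := exists_idx_last h0
    simp [restrict, h0, h]

theorem veroneseVec_apply_idx_last {t : Fin 4 → ℂ} (h : t 3 = 0) (i j : Fin 4) :
    veroneseVec 3 3 t (idx i j 3) = 0 := by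
  simp [h]

/-- The cubics that only depend on the first three variables after a substitution. -/
noncomputable def planeCubics (g : Matrix (Fin 4) (Fin 4) ℂ) : Submodule ℂ (MI → ℂ) where
  carrier := {s | ∀ i j, act g s (idx i j 3) = 0}
  add_mem' {a b} ha hb i j := by
    rw [map_add, Pi.add_apply, ha i j, hb i j, add_zero]
  zero_mem' i j := by simp
  smul_mem' c s hs i j := by
    rw [map_smul, Pi.smul_apply, hs i j, smul_zero]

theorem cubeSums_subset_planeCubics {k : ℕ} {T : Submodule ℂ (Fin 4 → ℂ)}
    {g : Matrix (Fin 4) (Fin 4) ℂ} (hg : ∀ t ∈ T, (g *ᵥ t) 3 = 0) :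
    cubeSums k T ⊆ planeCubics g := by
  rintro _ ⟨b, t, ht, -, rfl⟩
  refine Submodule.sum_mem _ fun l _ => Submodule.smul_mem _ _ fun i j => ?_
  rw [act_veroneseVec]
  exact veroneseVec_apply_idx_last (hg _ (ht l)) i j

theorem submodule_span_veronese {P : Projectivization.Subspace ℂ (Fin 4 → ℂ)}
    {g : Matrix (Fin 4) (Fin 4) ℂ} (hg : IsUnit g.det)
    (hP : ∀ t, t ∈ Projectivization.Subspace.submodule P ↔ (g *ᵥ t) 3 = 0) :
    Projectivization.Subspace.submodule (Projectivization.Subspace.span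
      (veronese 3 3 '' (P : Set (ℙ ℂ (Fin 4 → ℂ))))) = planeCubics g := by
  apply le_antisymm
  · intro s hs
    by_cases h0 : s = 0
    · rw [h0]
      exact zero_mem _
    rw [Projectivization.Subspace.mem_submodule_iff _ h0] at hs
    have h1 := (Projectivization.Subspace.mem_span _).mp hs (Submodule.projectivization
      (planeCubics g)) (by
        rintro _ ⟨q, hq, rfl⟩
        induction q using Projectivization.ind with | h t ht =>
        refine (Submodule.mk_mem_projectivization_iff _ (veroneseVec_ne_zero 3 3 ht)).mpr ?_
        intro i j
        rw [act_veroneseVec]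
        exact veroneseVec_apply_idx_last
          ((hP t).mp ((Projectivization.Subspace.mem_submodule_iff P ht).mpr hq)) i j)
    exact (Submodule.mk_mem_projectivization_iff _ h0).mp h1
  · intro s hs
    -- This map fixes the plane cubics and sends every cube to the cube of a point of the plane.
    let ρ : (MI → ℂ) →ₗ[ℂ] (MI → ℂ) := (act g⁻¹).comp restrictLin
    have hs' : s = ρ (act g s) := by
      change s = act g⁻¹ (restrict (act g s))
      rw [restrict_eq_self hs, act_act_of_mul_eq_one (nonsing_inv_mul _ hg)]
    have h1 : act g s ∈ Submodule.span ℂ (Set.range (veroneseVec 3 3)) := by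
      rw [span_range_veroneseVec]
      exact Submodule.mem_top
    have h2 := Submodule.mem_map_of_mem (f := ρ) h1
    rw [← hs', Submodule.map_span] at h2
    refine (Submodule.span_le.mpr ?_) h2
    rintro _ ⟨_, ⟨t, rfl⟩, rfl⟩
    have h3 : ρ (veroneseVec 3 3 t) = veroneseVec 3 3 (g⁻¹ *ᵥ Function.update t 3 0) := by
      rw [← act_veroneseVec, ← restrict_veroneseVec]
      rfl
    rw [h3]
    set u := g⁻¹ *ᵥ Function.update t 3 0 with hu
    by_cases hu0 : u = 0
    · rw [hu0, veroneseVec_zero]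
      exact zero_mem _
    · change veroneseVec 3 3 u ∈ Projectivization.Subspace.submodule _
      rw [Projectivization.Subspace.mem_submodule_iff _ (veroneseVec_ne_zero 3 3 hu0)]
      refine Projectivization.Subspace.subset_span _ ⟨Projectivization.mk ℂ u hu0, ?_, rfl⟩
      refine (Projectivization.Subspace.mem_submodule_iff P hu0).mp ((hP u).mpr ?_)
      rw [hu, mulVec_mulVec, mul_nonsing_inv _ hg, one_mulVec, Function.update_self]

/-- An explicit finite set in place of the abstract subtype allows the counts 10 and 16 to be
computed. -/
theorem card_multiIndex_le (m : ℕ) : Nat.card {α : MI // α.1 3 ≤ m} =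
    ((Finset.univ.image fun p : Fin 4 × Fin 4 × Fin 4 =>
      (Pi.single p.1 1 + Pi.single p.2.1 1 + Pi.single p.2.2 1 : Fin 4 → ℕ)).filter
        fun a => a 3 ≤ m).card := by
  rw [← Fintype.card_coe, ← Nat.card_eq_fintype_card]
  refine Nat.card_congr (Equiv.ofBijective (fun α => ⟨α.1.1, ?_⟩) ⟨fun α β h => ?_, fun a => ?_⟩)
  · obtain ⟨i, j, k, h⟩ := exists_idx α.1
    refine Finset.mem_filter.mpr ⟨Finset.mem_image.mpr ⟨(i, j, k), Finset.mem_univ _, ?_⟩, α.2⟩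
    rw [h, idx]
  · exact Subtype.ext (Subtype.ext (Subtype.mk.inj h))
  · obtain ⟨a, ha⟩ := a
    obtain ⟨h1, h2⟩ := Finset.mem_filter.mp ha
    obtain ⟨p, -, rfl⟩ := Finset.mem_image.mp h1
    exact ⟨⟨idx p.1 p.2.1 p.2.2, h2⟩, rfl⟩

theorem finrank_planeCubics {g : Matrix (Fin 4) (Fin 4) ℂ} (hg : IsUnit g.det) :
    Module.finrank ℂ (planeCubics g) = 10 := by
  have e : planeCubics g ≃ₗ[ℂ] ({α : MI // α.1 3 ≤ 0} → ℂ) :=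
    { toFun := fun s α => act g s.1 α.1
      map_add' := fun a b => by ext; simp
      map_smul' := fun a b => by ext; simp
      invFun := fun f => ⟨act g⁻¹ fun α => if h : α.1 3 ≤ 0 then f ⟨α, h⟩ else 0, fun i j => by
        rw [act_act_of_mul_eq_one (mul_nonsing_inv _ hg)]
        simp [idx]⟩
      left_inv := fun s => by
        apply Subtype.ext
        refine (congrArg (act g⁻¹) (funext fun α => ?_)).trans
          (act_act_of_mul_eq_one (nonsing_inv_mul _ hg) s.1)
        split_ifs with h
        · rfl
        · obtain ⟨i, j, rfl⟩ := exists_idx_last (α := α) (by omega)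
          exact (s.2 i j).symm
      right_inv := fun f => by
        funext α
        change act g (act g⁻¹ _) α.1 = _
        rw [act_act_of_mul_eq_one (mul_nonsing_inv _ hg)]
        simp [α.2] }
  rw [e.finrank_eq, Module.finrank_fintype_fun_eq_card, ← Nat.card_eq_fintype_card,
    card_multiIndex_le]
  decide +kernel

theorem secantVariety_eq_span {P : Projectivization.Subspace ℂ (Fin 4 → ℂ)}
    {g : Matrix (Fin 4) (Fin 4) ℂ} (hg : IsUnit g.det)
    (hP : ∀ t, t ∈ Projectivization.Subspace.submodule P ↔ (g *ᵥ t) 3 = 0) :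
    secantVariety 4 (veronese 3 3 '' (P : Set (ℙ ℂ (Fin 4 → ℂ)))) =
      (Projectivization.Subspace.span
        (veronese 3 3 '' (P : Set (ℙ ℂ (Fin 4 → ℂ)))) : Set (ℙ ℂ (MI → ℂ))) := by
  ext p
  induction p using Projectivization.ind with | h v hv =>
  rw [mk_mem_secantVariety]
  rw [SetLike.mem_coe, ← Projectivization.Subspace.mem_submodule_iff _ hv, submodule_span_veronese hg hP]
  constructor
  · intro h i j
    have hf (s : MI → ℂ) : aeval s (act g (X : MI → MvPolynomial MI ℂ) (idx i j 3)) =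
        act g s (idx i j 3) := by
      rw [map_act]
      simp
    have := h (act g X (idx i j 3)) (fun s hs _ => by
      rw [hf]
      exact cubeSums_subset_planeCubics (fun t ht => (hP t).mp ht) hs i j) 1 one_ne_zero
    rwa [hf, one_smul] at this
  · intro h f hf c hc
    obtain ⟨U, hU, hne, hUt⟩ := exists_isOpen_sum_veroneseVec
    -- The pullback of `f` along the projection to plane cubics vanishes on an open set, because
    -- setting the last variable to zero turns four cubes into four cubes of points of the plane.
    -- Hence it is zero.
    let F : MvPolynomial MI ℂ := aeval (act g⁻¹ (restrict X)) f
    have hF (y : MI → ℂ) : aeval y F = aeval (act g⁻¹ (restrict y)) f := by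
      rw [← AlgHom.comp_apply, comp_aeval]
      congr 2
      funext α
      rw [map_act]
      refine congrArg (fun z => act g⁻¹ z α) (funext fun β => ?_)
      by_cases h : β.1 3 = 0 <;> simp [restrict, h]
    have hF0 : F = 0 := by
      refine eq_zero_of_forall_mem_isOpen hU hne fun y hy => ?_
      obtain ⟨t, -, hli, hyt⟩ := hUt y hy
      have hy' : restrict y = ∑ l, veroneseVec 3 3 (Function.update (t l) 3 0) := by
        have : restrict y = restrict (∑ l, veroneseVec 3 3 (t l)) := by
          funext α
          by_cases h0 : α.1 3 = 0
          · obtain ⟨i, j, k, rfl⟩ := exists_idx α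
            simp only [restrict, h0, if_true]
            refine hyt i j k ?_ ?_ <;> rintro rfl <;> simp [idx] at h0
          · simp [restrict, h0]
        rw [this, restrict_sum]
        simp only [restrict_veroneseVec]
      let T' : Submodule ℂ (Fin 4 → ℂ) := LinearMap.ker (LinearMap.proj 3)
      have hmem : act g⁻¹ (restrict y) ∈ cubeSums 4 (Projectivization.Subspace.submodule P) := by
        refine act_mem_cubeSums (T := T') (isUnit_nonsing_inv_det g hg) (fun t ht => ?_)
          (hy' ▸ sum_veroneseVec_mem_cubeSums (fun l => ?_) hli)
        · rw [hP, mulVec_mulVec, mul_nonsing_inv _ hg, one_mulVec]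
          exact ht
        · simp [T']
      rw [hF]
      refine hf _ hmem fun h0 => sum_veroneseVec_ne_zero hli ?_
      rw [← hy', ← act_act_of_mul_eq_one (mul_nonsing_inv _ hg) (restrict y), h0, map_zero]
    have h1 := hF (act g (c • v))
    have h2 (i j) : act g (c • v) (idx i j 3) = 0 := by
      rw [map_smul, Pi.smul_apply, h i j, smul_zero]
    rw [hF0, map_zero, restrict_eq_self h2,
      act_act_of_mul_eq_one (nonsing_inv_mul _ hg)] at h1
    exact h1.symm

end VeroneseCubic

/-! ### Solving the equations for the coordinates of degree at least two in the last variable -/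

namespace VeroneseCubic

open MvPolynomial Matrix

variable {R R' : Type*} [CommRing R] [CommRing R']

theorem map_corner (φ : R →+* R') (A : Matrix (Fin 4) (Fin 4) R) :
    (corner A).map φ = corner (A.map φ) := rfl

theorem map_slice (φ : R →+* R') (y : MI → R) (c : Fin 4) :
    (slice y c).map φ = slice (fun α => φ (y α)) c := rfl

theorem map_aronhold (φ : R →+* R') (y : MI → R) :
    φ (aronhold y) = aronhold fun α => φ (y α) := by
  rw [aronhold, map_bracket, map_corner, map_corner, map_corner, map_slice, map_slice, map_slice,
    aronhold]

theorem map_aronhold' (φ : R →+* R') (y : MI → R) :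
    φ (aronhold' y) = aronhold' fun α => φ (y α) := by
  rw [aronhold', map_bracket, map_corner, map_corner, map_corner,
    Matrix.map_add _ (map_add φ), map_slice, map_slice, map_slice, map_slice, aronhold']

theorem map_secantEq (φ : R →+* R') (y : MI → R) (k : Fin 3) :
    φ (secantEq y k) = secantEq (fun α => φ (y α)) k := by
  rw [secantEq, map_bracket, map_slice, map_slice, map_slice, secantEq]

theorem map_secantEq' (φ : R →+* R') (y : MI → R) :
    φ (secantEq' y) = secantEq' fun α => φ (y α) := by
  rw [secantEq', map_bracket, Matrix.map_add _ (map_add φ), map_slice, map_slice, map_slice,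
    map_slice, secantEq']

theorem bracket_smul {n : Type*} [Fintype n] [DecidableEq n] (c : R) (A B C : Matrix n n R)
    (i j : n) : bracket (c • A) (c • B) (c • C) i j =
      c ^ (Fintype.card n - 1 + 2) * bracket A B C i j := by
  simp only [bracket, adjugate_smul, Matrix.smul_mul, Matrix.mul_smul, Matrix.smul_apply,
    smul_eq_mul]
  ring

theorem slice_smul (c : R) (y : MI → R) (k : Fin 4) : slice (c • y) k = c • slice y k := rfl

theorem corner_smul (c : R) (A : Matrix (Fin 4) (Fin 4) R) : corner (c • A) = c • corner A := rfl

theorem aronhold_smul (c : R) (y : MI → R) : aronhold (c • y) = c ^ 4 * aronhold y := by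
  simp only [aronhold, slice_smul, corner_smul, bracket_smul, Fintype.card_fin]

/-- Replace the coordinates of degree at least two in the last variable. -/
def upd (l : Fin 3 → R) (c : R) (y : MI → R) : MI → R := fun α =>
  if α.1 3 ≤ 1 then y α else if α.1 3 = 2 then ∑ k : Fin 3, if α.1 k.castSucc = 1 then l k else 0
  else c

theorem map_upd (φ : R →+* R') (l : Fin 3 → R) (c : R) (y : MI → R) (α : MI) :
    φ (upd l c y α) = upd (fun k => φ (l k)) (φ c) (fun β => φ (y β)) α := by
  unfold upd
  split_ifs <;> simp [map_sum, apply_ite φ]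

theorem idx_last_le {i j : Fin 4} (hi : i ≠ 3) (hj : j ≠ 3) (k : Fin 4) : (idx i j k).1 3 ≤ 1 := by
  simp only [idx, Pi.add_apply, Pi.single_apply, hi.symm, hj.symm, if_false]
  split_ifs <;> simp

theorem upd_idx {i j : Fin 4} (hi : i ≠ 3) (hj : j ≠ 3) (k : Fin 4) (l : Fin 3 → R) (c : R)
    (y : MI → R) : upd l c y (idx i j k) = y (idx i j k) :=
  if_pos (idx_last_le hi hj k)

theorem upd_idx_three_three (k : Fin 3) (l : Fin 3 → R) (c : R) (y : MI → R) :
    upd l c y (idx k.castSucc 3 3) = l k := by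
  have h2 : (idx k.castSucc 3 3).1 3 = 2 := by
    simp [idx, Fin.ext_iff, k.2.ne']
  have hk (m : Fin 3) : (idx k.castSucc 3 3).1 m.castSucc = if m = k then 1 else 0 := by
    simp [idx, Fin.ext_iff, Pi.single_apply, m.2.ne]
  simp [upd, h2, hk]

theorem upd_idx_three_three_three (l : Fin 3 → R) (c : R) (y : MI → R) :
    upd l c y (idx 3 3 3) = c := by
  simp [upd, idx]

/-- Induction on the degree in the last variable. -/
theorem idx_cases {p : MI → Prop} (h1 : ∀ i j k, i ≠ 3 → j ≠ 3 → p (idx i j k))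
    (h2 : ∀ k : Fin 3, p (idx k.castSucc 3 3)) (h3 : p (idx 3 3 3)) (α : MI) : p α := by
  have key (i : Fin 4) : p (idx i 3 3) := by
    induction i using Fin.lastCases with
    | last => exact h3
    | cast k => exact h2 k
  obtain ⟨i, j, k, rfl⟩ := exists_idx α
  by_cases hi : i = 3
  · by_cases hj : j = 3
    · rw [hi, hj, idx_swap_right, idx_swap_left]
      exact key k
    · by_cases hk : k = 3
      · rw [hi, hk, idx_swap_left]
        exact key j
      · rw [hi, idx_swap_left, idx_swap_right]
        exact h1 j k 3 hj hk
  · by_cases hj : j = 3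
    · by_cases hk : k = 3
      · rw [hj, hk]
        exact key i
      · rw [hj, idx_swap_right]
        exact h1 i k 3 hi hk
    · exact h1 i j k hi hj

theorem upd_self (y : MI → R) : upd (fun k => y (idx k.castSucc 3 3)) (y (idx 3 3 3)) y = y := by
  funext α
  induction α using idx_cases with
  | h1 i j k hi hj => rw [upd_idx hi hj]
  | h2 k => rw [upd_idx_three_three]
  | h3 => rw [upd_idx_three_three_three]

theorem upd_congr {y y' : MI → R} (h : ∀ i j k, i ≠ 3 → j ≠ 3 → y (idx i j k) = y' (idx i j k))
    (l : Fin 3 → R) (c : R) : upd l c y = upd l c y' := by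
  funext α
  induction α using idx_cases with
  | h1 i j k hi hj => rw [upd_idx hi hj, upd_idx hi hj, h i j k hi hj]
  | h2 k => rw [upd_idx_three_three, upd_idx_three_three]
  | h3 => rw [upd_idx_three_three_three, upd_idx_three_three_three]

theorem corner_slice_upd (l : Fin 3 → R) (c : R) (y : MI → R) (k : Fin 4) :
    corner (slice (upd l c y) k) = corner (slice y k) := by
  ext i j
  have hi := Fin.castSucc_ne_last i
  have hj := Fin.castSucc_ne_last j
  change upd l c y (idx k i.castSucc j.castSucc) = y (idx k i.castSucc j.castSucc)
  rw [idx_swap_left, idx_swap_right, upd_idx hi hj]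

theorem zeroLast_slice_upd (l l' : Fin 3 → R) (c c' : R) (y : MI → R) (k : Fin 3) :
    zeroLast (slice (upd l c y) k.castSucc) = zeroLast (slice (upd l' c' y) k.castSucc) := by
  ext i j
  have hk : k.castSucc ≠ 3 := Fin.castSucc_ne_last k
  simp only [zeroLast, of_apply, slice]
  split_ifs with h
  · rfl
  · by_cases hi : i = 3
    · have hj : j ≠ 3 := fun hj => h ⟨hi, hj⟩
      rw [idx_swap_right, upd_idx hk hj, upd_idx hk hj]
    · rw [upd_idx hk hi, upd_idx hk hi]

theorem aronhold_upd (l : Fin 3 → R) (c : R) (y : MI → R) :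
    aronhold (upd l c y) = aronhold y := by
  simp only [aronhold, corner_slice_upd]

theorem corner_add (A B : Matrix (Fin 4) (Fin 4) R) : corner (A + B) = corner A + corner B := rfl

theorem aronhold'_upd (l : Fin 3 → R) (c : R) (y : MI → R) :
    aronhold' (upd l c y) = aronhold' y := by
  simp only [aronhold', corner_add, corner_slice_upd]

/-- The equation is affine in `l k` with slope the Aronhold invariant. The matrices `zeroLast` of
the first three slices involve only coordinates of degree at most one in the last variable. -/
theorem secantEq_upd (l : Fin 3 → R) (c : R) (y : MI → R) (k : Fin 3) :
    secantEq (upd l c y) k = l k * aronhold y + secantEq (upd 0 0 y) k := by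
  have hb (l : Fin 3 → R) (c : R) : secantEq (upd l c y) k = l k * aronhold y +
      bracket (zeroLast (slice (upd l c y) k.castSucc))
        (zeroLast (slice (upd l c y) (k + 1).castSucc))
        (zeroLast (slice (upd l c y) (k + 2).castSucc)) (k + 1).castSucc (k + 2).castSucc := by
    rw [← aronhold_upd l c y, ← bracket_corner_slice (upd l c y) k]
    refine (bracket_castSucc _ _ _ _ _).trans ?_
    congr 2
    exact upd_idx_three_three k l c y
  rw [hb, hb 0, zeroLast_slice_upd l 0 c 0, zeroLast_slice_upd l 0 c 0,
    zeroLast_slice_upd l 0 c 0, Pi.zero_apply]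
  ring

theorem zeroLast_add (A B : Matrix (Fin 4) (Fin 4) R) :
    zeroLast (A + B) = zeroLast A + zeroLast B := by
  ext i j
  simp only [zeroLast, of_apply, Matrix.add_apply]
  split_ifs <;> simp

theorem zeroLast_slice_upd_three (l : Fin 3 → R) (c c' : R) (y : MI → R) :
    zeroLast (slice (upd l c y) 3) = zeroLast (slice (upd l c' y) 3) := by
  have h (i : Fin 4) (hi : i ≠ 3) : upd l c y (idx i 3 3) = upd l c' y (idx i 3 3) := by
    obtain ⟨k, rfl⟩ := Fin.exists_castSucc_eq.mpr hi
    rw [upd_idx_three_three, upd_idx_three_three]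
  ext i j
  simp only [zeroLast, of_apply, slice]
  split_ifs with hij
  · rfl
  · by_cases hi : i = 3
    · have hj : j ≠ 3 := fun hj => hij ⟨hi, hj⟩
      rw [hi, idx_swap_right, idx_swap_left, h j hj]
    · by_cases hj : j = 3
      · rw [hj, idx_swap_left, h i hi]
      · rw [idx_swap_left, idx_swap_right, upd_idx hi hj, upd_idx hi hj]

/-- Here the corner entry of `A` is `l 0 + c`, and `c = -l 0` makes it vanish. Adding `slice y 0` to
`slice y 3` is essential: on a plane cubic `slice y 3` is zero, and alone it would give slope zero.
-/
theorem secantEq'_upd (l : Fin 3 → R) (c : R) (y : MI → R) :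
    secantEq' (upd l c y) = (l 0 + c) * aronhold' y + secantEq' (upd l (-l 0) y) := by
  have h (c : R) : (slice (upd l c y) 0 + slice (upd l c y) 3) 3 3 = l 0 + c :=
    congrArg₂ (· + ·) (upd_idx_three_three 0 l c y) (upd_idx_three_three_three l c y)
  have hb (c : R) : secantEq' (upd l c y) = (l 0 + c) * aronhold' y +
      bracket (zeroLast (slice (upd l c y) (Fin.castSucc 0)) + zeroLast (slice (upd l c y) 3))
        (zeroLast (slice (upd l c y) (Fin.castSucc 1)))
        (zeroLast (slice (upd l c y) (Fin.castSucc 2))) (Fin.castSucc 1) (Fin.castSucc 2) := by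
    rw [← zeroLast_add, ← h c, ← aronhold'_upd l c y]
    exact bracket_castSucc _ _ _ 1 2
  rw [hb, hb (-l 0), zeroLast_slice_upd l l c (-l 0), zeroLast_slice_upd l l c (-l 0),
    zeroLast_slice_upd l l c (-l 0), zeroLast_slice_upd_three l c (-l 0)]
  ring

/-- The point of the fourth secant variety with given coordinates of degree at most one in the
last variable. The scalars `u` and `u'` are the inverses of the two Aronhold invariants. -/
noncomputable def lift (y : MI → R) (u u' : R) : MI → R :=
  upd (fun k => -(secantEq (upd 0 0 y) k * u))
    (secantEq (upd 0 0 y) 0 * u - secantEq' (upd (fun k => -(secantEq (upd 0 0 y) k * u))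
      (secantEq (upd 0 0 y) 0 * u) y) * u') y

theorem map_lift (φ : R →+* R') (y : MI → R) (u u' : R) (α : MI) :
    φ (lift y u u' α) = lift (fun β => φ (y β)) (φ u) (φ u') α := by
  have h0 : (fun α => φ (upd 0 0 y α)) = upd 0 0 fun β => φ (y β) := by
    funext α
    rw [map_upd]
    simp [Pi.zero_def]
  have h1 (k : Fin 3) : φ (secantEq (upd 0 0 y) k) = secantEq (upd 0 0 fun β => φ (y β)) k := by
    rw [map_secantEq, h0]
  rw [lift, map_upd, lift]
  simp only [map_neg, map_mul, map_sub, map_secantEq', map_upd, h1]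

theorem lift_congr {y y' : MI → R} (h : ∀ i j k, i ≠ 3 → j ≠ 3 → y (idx i j k) = y' (idx i j k))
    (u u' : R) : lift y u u' = lift y' u u' := by
  simp only [lift, upd_congr h]

/-- The equations `secantEq` determine the three coordinates of degree two, and `secantEq'` then
determines the coordinate of degree three. -/
theorem lift_eq_self {y : MI → R} {u u' : R} (hu : aronhold y * u = 1) (hu' : aronhold' y * u' = 1)
    (h : ∀ k, secantEq y k = 0) (h' : secantEq' y = 0) : lift y u u' = y := by
  have hl (k : Fin 3) : y (idx k.castSucc 3 3) = -(secantEq (upd 0 0 y) k * u) := by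
    have h1 := secantEq_upd (fun k => y (idx k.castSucc 3 3)) (y (idx 3 3 3)) y k
    rw [upd_self, h] at h1
    linear_combination -y (idx k.castSucc 3 3) * hu - u * h1
  have hc : y (idx 3 3 3) = secantEq (upd 0 0 y) 0 * u -
      secantEq' (upd (fun k => -(secantEq (upd 0 0 y) k * u)) (secantEq (upd 0 0 y) 0 * u) y) * u' := by
    have h1 := secantEq'_upd (fun k => y (idx k.castSucc 3 3)) (y (idx 3 3 3)) y
    rw [upd_self, h'] at h1
    simp only [hl, neg_neg] at h1
    linear_combination (-y (idx 3 3 3) + secantEq (upd 0 0 y) 0 * u) * hu' - u' * h1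
  conv_rhs => rw [← upd_self y]
  rw [lift, ← hc]
  simp only [← hl]

theorem secantEq_eq_zero {y : MI → R} (h : ∀ i j, y (idx i j 3) = 0) (k : Fin 3) :
    secantEq y k = 0 := by
  have h1 (c i : Fin 4) : slice y c i 3 = 0 := h c i
  have h2 (c i : Fin 4) : slice y c 3 i = 0 := by
    rw [← h c i, ← idx_swap_right]
    rfl
  exact bracket_eq_zero_of_last (h1 _) (h2 _) (fun i _ => h2 _ i) (Fin.castSucc_ne_last _)
    (Fin.castSucc_ne_last _)

theorem slice_three_eq_zero {y : MI → R} (h : ∀ i j, y (idx i j 3) = 0) : slice y 3 = 0 := by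
  ext i j
  rw [slice, of_apply, idx_swap_left, idx_swap_right, h, Matrix.zero_apply]

theorem secantEq'_eq_zero {y : MI → R} (h : ∀ i j, y (idx i j 3) = 0) : secantEq' y = 0 := by
  rw [secantEq', slice_three_eq_zero h, add_zero]
  exact secantEq_eq_zero h 0

theorem aronhold'_eq_aronhold {y : MI → R} (h : ∀ i j, y (idx i j 3) = 0) :
    aronhold' y = aronhold y := by
  rw [aronhold', slice_three_eq_zero h, add_zero, aronhold]

theorem slice_sum_smul_veroneseVec (b : Fin 4 → ℂ) (t : Fin 4 → Fin 4 → ℂ) (c : Fin 4) :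
    slice (∑ l, b l • veroneseVec 3 3 (t l)) c =
      (of t)ᵀ * diagonal (fun l => b l * t l c) * of t := by
  ext i j
  rw [Matrix.mul_apply]
  simp only [slice, of_apply, Finset.sum_apply, Pi.smul_apply, smul_eq_mul, veroneseVec_idx,
    mul_diagonal, transpose_apply]
  exact Finset.sum_congr rfl fun l _ => by ring

theorem secantEq_sum_smul_veroneseVec (b : Fin 4 → ℂ) (t : Fin 4 → Fin 4 → ℂ) (k : Fin 3) :
    secantEq (∑ l, b l • veroneseVec 3 3 (t l)) k = 0 := by
  rw [secantEq, slice_sum_smul_veroneseVec, slice_sum_smul_veroneseVec, slice_sum_smul_veroneseVec]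
  exact bracket_transpose_mul_diagonal_mul _ _ _ _ _ _

theorem secantEq'_sum_smul_veroneseVec (b : Fin 4 → ℂ) (t : Fin 4 → Fin 4 → ℂ) :
    secantEq' (∑ l, b l • veroneseVec 3 3 (t l)) = 0 := by
  rw [secantEq', slice_sum_smul_veroneseVec, slice_sum_smul_veroneseVec,
    slice_sum_smul_veroneseVec, slice_sum_smul_veroneseVec, ← Matrix.add_mul, ← Matrix.mul_add,
    diagonal_add]
  exact bracket_transpose_mul_diagonal_mul _ _ _ _ _ _

/-- Near a plane cubic, the coordinates of degree at least two in the last variable are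
determined by the equations of the secant variety. -/
theorem idx_three_mem {y : MI → R} {I : Ideal R} (hu : IsUnit (aronhold y))
    (hu' : IsUnit (aronhold' y)) (h : ∀ k, secantEq y k = 0) (h' : secantEq' y = 0)
    (hI : ∀ i j, i ≠ 3 → j ≠ 3 → y (idx i j 3) ∈ I) (i j : Fin 4) : y (idx i j 3) ∈ I := by
  obtain ⟨u, hu⟩ := isUnit_iff_exists_inv.mp hu
  obtain ⟨u', hu'⟩ := isUnit_iff_exists_inv.mp hu'
  have h1 := lift_eq_self hu hu' h h'
  rw [← Ideal.Quotient.eq_zero_iff_mem, ← h1, map_lift]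
  -- Modulo `I` the data for `lift` are those of a plane cubic, for which the solution of the
  -- equations is zero.
  set z : MI → R ⧸ I := fun β => Ideal.Quotient.mk I (y β) with hz
  have key : ∀ i j, upd 0 0 z (idx i j 3) = 0 := by
    intro i j
    by_cases hj : j = 3
    · subst hj
      induction i using Fin.lastCases with
      | last => exact upd_idx_three_three_three _ _ _
      | cast k => exact upd_idx_three_three _ _ _ _
    · by_cases hi : i = 3
      · subst hi
        rw [idx_swap_left]
        induction j using Fin.lastCases with
        | last => exact upd_idx_three_three_three _ _ _
        | cast k => exact upd_idx_three_three _ _ _ _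
      · rw [upd_idx hi hj]
        exact Ideal.Quotient.eq_zero_iff_mem.mpr (hI i j hi hj)
  have h0 : (fun k => -(secantEq (upd 0 0 z) k * Ideal.Quotient.mk I u)) = 0 := by
    funext k
    simp [secantEq_eq_zero key]
  rw [lift, h0, secantEq_eq_zero key, zero_mul, secantEq'_eq_zero key, zero_mul, sub_zero]
  exact key i j

end VeroneseCubic

/-! ### Rational parametrizations of the fourth secant variety and its linear sections -/

namespace VeroneseCubic

open MvPolynomial Matrix

section RationalFunctions

variable {σ τ : Type*}

/-- The functions that are rational with a power of `D` as denominator where `D` does not vanish. -/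
def ratFun (D : MvPolynomial σ ℂ) : Subalgebra ℂ ((σ → ℂ) → ℂ) where
  carrier := {φ | ∃ (N : ℕ) (F : MvPolynomial σ ℂ), ∀ s, aeval s D ≠ 0 →
    φ s * aeval s D ^ N = aeval s F}
  mul_mem' := by
    rintro φ ψ ⟨N, F, hF⟩ ⟨M, G, hG⟩
    refine ⟨N + M, F * G, fun s hs => ?_⟩
    rw [map_mul, ← hF s hs, ← hG s hs, Pi.mul_apply]
    ring
  add_mem' := by
    rintro φ ψ ⟨N, F, hF⟩ ⟨M, G, hG⟩
    refine ⟨N + M, F * D ^ M + G * D ^ N, fun s hs => ?_⟩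
    rw [map_add, map_mul, map_mul, ← hF s hs, ← hG s hs, Pi.add_apply, map_pow, map_pow]
    ring
  algebraMap_mem' c := ⟨0, C c, fun s _ => by simp⟩

theorem aeval_mem_ratFun (D F : MvPolynomial σ ℂ) : (fun s => aeval s F) ∈ ratFun D :=
  ⟨0, F, fun s _ => by simp⟩

/-- The default value of the inverse at zeros of `e` is harmless, because `D` vanishes there and no
condition is imposed. -/
theorem inv_aeval_mem_ratFun {D e : MvPolynomial σ ℂ} (h : e ∣ D) :
    (fun s => (aeval s e)⁻¹) ∈ ratFun D := by
  obtain ⟨e', rfl⟩ := h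
  refine ⟨1, e', fun s hs => ?_⟩
  rw [map_mul] at hs
  rw [pow_one, map_mul, inv_mul_cancel_left₀ (left_ne_zero_of_mul hs)]

/-- The evaluation of rational functions at a point. -/
def evalRat (D : MvPolynomial σ ℂ) (s : σ → ℂ) : ratFun D →ₐ[ℂ] ℂ :=
  (Pi.evalAlgHom ℂ (fun _ : σ → ℂ => ℂ) s).comp (ratFun D).val

/-- The polynomials that vanish on the image of a rational map. -/
noncomputable def imageIdeal (D : MvPolynomial σ ℂ) (θ : τ → ratFun D) :
    Ideal (MvPolynomial τ ℂ) where
  carrier := {f | ∀ s, aeval s D ≠ 0 → aeval (fun i => evalRat D s (θ i)) f = 0}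
  add_mem' {f g} hf hg s hs := by rw [map_add, hf s hs, hg s hs, add_zero]
  zero_mem' s _ := map_zero _
  smul_mem' c f hf s hs := by rw [smul_eq_mul, map_mul, hf s hs, mul_zero]

theorem mem_imageIdeal {D : MvPolynomial σ ℂ} {θ : τ → ratFun D} {f : MvPolynomial τ ℂ} :
    f ∈ imageIdeal D θ ↔ ∀ s, aeval s D ≠ 0 → aeval (fun i => evalRat D s (θ i)) f = 0 := Iff.rfl

theorem exists_numerator (D : MvPolynomial σ ℂ) (θ : τ → ratFun D) (f : MvPolynomial τ ℂ) :
    ∃ (N : ℕ) (F : MvPolynomial σ ℂ), ∀ s, aeval s D ≠ 0 →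
      aeval (fun i => evalRat D s (θ i)) f * aeval s D ^ N = aeval s F := by
  obtain ⟨N, F, hF⟩ := (aeval θ f).2
  refine ⟨N, F, fun s hs => ?_⟩
  rw [← hF s hs]
  congr 1
  change _ = evalRat D s (aeval θ f)
  rw [← AlgHom.comp_apply, comp_aeval]

/-- After denominators are cleared, a product vanishing on the image gives `D * F * G = 0` in a
polynomial ring, which is a domain. -/
theorem imageIdeal_isPrime {D : MvPolynomial σ ℂ} (hD : D ≠ 0) (θ : τ → ratFun D) :
    (imageIdeal D θ).IsPrime := by
  have key (f : MvPolynomial τ ℂ) : ∃ F : MvPolynomial σ ℂ, ∀ s, aeval s D ≠ 0 →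
      (aeval (fun i => evalRat D s (θ i)) f = 0 ↔ aeval s F = 0) := by
    obtain ⟨N, F, hF⟩ := exists_numerator D θ f
    exact ⟨F, fun s hs => by rw [← hF s hs, mul_eq_zero_iff_right (pow_ne_zero N hs)]⟩
  refine ⟨fun h => hD ?_, fun {f g} hfg => ?_⟩
  · refine MvPolynomial.funext fun s => ?_
    rw [map_zero, ← coe_aeval_eq_eval]
    by_contra hs
    exact one_ne_zero ((map_one (aeval fun i => evalRat D s (θ i))).symm.trans
      (mem_imageIdeal.mp ((Ideal.eq_top_iff_one _).mp h) s hs))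
  · obtain ⟨F, hF⟩ := key f
    obtain ⟨G, hG⟩ := key g
    have h0 : D * (F * G) = 0 := by
      refine MvPolynomial.funext fun s => ?_
      rw [map_zero, ← coe_aeval_eq_eval]
      change aeval s (D * (F * G)) = 0
      rw [map_mul, map_mul, mul_eq_zero, mul_eq_zero, or_iff_not_imp_left]
      intro hs
      rw [← hF s hs, ← hG s hs, ← mul_eq_zero, ← map_mul]
      exact hfg s hs
    rcases mul_eq_zero.mp ((mul_eq_zero.mp h0).resolve_left hD) with h | h
    · exact Or.inl fun s hs => (hF s hs).mpr (by rw [h, map_zero])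
    · exact Or.inr fun s hs => (hG s hs).mpr (by rw [h, map_zero])

end RationalFunctions

section Chain

variable (a : MI → ℂ) (β₀ : MI) (S : Set MI)

open Classical in
/-- The linear substitution that expresses the coordinates in `S` by the coordinate `β₀`. -/
noncomputable def subst (s : MI → ℂ) : MI → ℂ := fun α => if α ∈ S then a α * s β₀ else s α

open Classical in
/-- The polynomials that define the linear substitution. -/
noncomputable def substPoly : MI → MvPolynomial MI ℂ :=
  fun α => if α ∈ S then C (a α) * X β₀ else X α

theorem aeval_substPoly (s : MI → ℂ) (α : MI) : aeval s (substPoly a β₀ S α) = subst a β₀ S s α := by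
  unfold substPoly subst
  split_ifs <;> simp

/-- The common denominator of the parametrization. -/
noncomputable def denom : MvPolynomial MI ℂ :=
  aronhold (substPoly a β₀ S) * aronhold' (substPoly a β₀ S)

theorem aeval_aronhold_substPoly (s : MI → ℂ) :
    aeval s (aronhold (substPoly a β₀ S)) = aronhold (subst a β₀ S s) :=
  (map_aronhold (aeval s : MvPolynomial MI ℂ →ₐ[ℂ] ℂ).toRingHom _).trans
    (congrArg aronhold (_root_.funext (aeval_substPoly a β₀ S s)))

theorem aeval_aronhold'_substPoly (s : MI → ℂ) :
    aeval s (aronhold' (substPoly a β₀ S)) = aronhold' (subst a β₀ S s) :=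
  (map_aronhold' (aeval s : MvPolynomial MI ℂ →ₐ[ℂ] ℂ).toRingHom _).trans
    (congrArg aronhold' (_root_.funext (aeval_substPoly a β₀ S s)))

theorem aeval_denom (s : MI → ℂ) : aeval s (denom a β₀ S) =
    aronhold (subst a β₀ S s) * aronhold' (subst a β₀ S s) := by
  rw [denom, map_mul, aeval_aronhold_substPoly, aeval_aronhold'_substPoly]

variable (g : Matrix (Fin 4) (Fin 4) ℂ)

/-- A rational parametrization of a linear section of the fourth secant variety. -/
noncomputable def secParam : MI → ratFun (denom a β₀ S) :=
  act g⁻¹ (lift (fun α => ⟨_, aeval_mem_ratFun _ (substPoly a β₀ S α)⟩)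
    ⟨_, inv_aeval_mem_ratFun (e := aronhold (substPoly a β₀ S)) (Dvd.intro _ rfl)⟩
    ⟨_, inv_aeval_mem_ratFun (e := aronhold' (substPoly a β₀ S)) (Dvd.intro_left _ rfl)⟩)

/-- The lift of a vector of coordinates to a point of the fourth secant variety. -/
noncomputable def liftInv (y : MI → ℂ) : MI → ℂ := lift y (aronhold y)⁻¹ (aronhold' y)⁻¹

theorem evalRat_secParam (s : MI → ℂ) :
    (fun α => evalRat _ s (secParam a β₀ S g α)) = act g⁻¹ (liftInv (subst a β₀ S s)) := by
  funext α
  rw [secParam, map_act]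
  refine congrArg (fun z => act g⁻¹ z α) (_root_.funext fun β => ?_)
  refine (map_lift (evalRat _ s).toRingHom _ _ _ β).trans ?_
  rw [liftInv, ← aeval_aronhold_substPoly, ← aeval_aronhold'_substPoly,
    ← _root_.funext (aeval_substPoly a β₀ S s)]
  rfl

/-- The ideal of the closure of the image of the parametrization. -/
noncomputable def secIdeal : Ideal (MvPolynomial MI ℂ) :=
  imageIdeal (denom a β₀ S) (secParam a β₀ S g)

theorem mem_secIdeal {f : MvPolynomial MI ℂ} : f ∈ secIdeal a β₀ S g ↔
    ∀ s, aeval s (denom a β₀ S) ≠ 0 → aeval (act g⁻¹ (liftInv (subst a β₀ S s))) f = 0 := by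
  rw [secIdeal, mem_imageIdeal]
  simp only [evalRat_secParam]

/-- Imposing the relations in `S` after those in the larger `S'` changes nothing, so the section for
`S'` lies in the section for `S`. -/
theorem secIdeal_mono (ha : a β₀ = 1) {S S' : Set MI} (h : S ⊆ S') :
    secIdeal a β₀ S g ≤ secIdeal a β₀ S' g := by
  intro f hf
  rw [mem_secIdeal] at hf ⊢
  intro s hs
  have h0 : subst a β₀ S' s β₀ = s β₀ := by simp [subst, ha]
  have h1 : subst a β₀ S (subst a β₀ S' s) = subst a β₀ S' s := by
    funext α
    by_cases hα : α ∈ S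
    · simp only [subst, hα, if_true, h hα, ha, one_mul, ite_self]
    · simp only [subst, hα, if_false]
  have h2 := hf (subst a β₀ S' s)
  rw [aeval_denom, h1, ← aeval_denom] at h2
  exact h2 hs

variable {a β₀ g}

theorem aronhold_eq_of_eq {y y' : MI → ℂ}
    (h : ∀ i j k, i ≠ 3 → j ≠ 3 → y (idx i j k) = y' (idx i j k)) : aronhold y = aronhold y' := by
  rw [← aronhold_upd 0 0 y, upd_congr h, aronhold_upd]

theorem aronhold'_eq_of_eq {y y' : MI → ℂ}
    (h : ∀ i j k, i ≠ 3 → j ≠ 3 → y (idx i j k) = y' (idx i j k)) :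
    aronhold' y = aronhold' y' := by
  rw [← aronhold'_upd 0 0 y, upd_congr h, aronhold'_upd]

theorem liftInv_congr {y y' : MI → ℂ}
    (h : ∀ i j k, i ≠ 3 → j ≠ 3 → y (idx i j k) = y' (idx i j k)) : liftInv y = liftInv y' := by
  rw [liftInv, liftInv, aronhold_eq_of_eq h, aronhold'_eq_of_eq h, lift_congr h]

theorem liftInv_eq_self {y : MI → ℂ} (h0 : aronhold y * aronhold' y ≠ 0)
    (h : ∀ k, secantEq y k = 0) (h' : secantEq' y = 0) : liftInv y = y :=
  lift_eq_self (mul_inv_cancel₀ (left_ne_zero_of_mul h0))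
    (mul_inv_cancel₀ (right_ne_zero_of_mul h0)) h h'

theorem liftInv_apply (y : MI → ℂ) {α : MI} (hα : α.1 3 ≤ 1) : liftInv y α = y α := by
  rw [liftInv, lift, upd, if_pos hα]

/-- The fourth secant variety is contained in the closure of the image of the parametrization. -/
theorem homogIdeal_secantVariety_le_secIdeal (hg : IsUnit g.det) :
    homogIdeal (secantVariety 4 (Set.range (veronese 3 3))) ≤ secIdeal a β₀ ∅ g := by
  intro f hf
  rw [range_veronese, mem_homogIdeal_secantVariety] at hf
  have hsub (s : MI → ℂ) : subst a β₀ ∅ s = s := by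
    funext α
    simp [subst]
  obtain ⟨N, F, hF⟩ := exists_numerator (denom a β₀ ∅) (secParam a β₀ ∅ g) f
  simp only [evalRat_secParam, hsub] at hF
  obtain ⟨U, hU, hne, hUt⟩ := exists_isOpen_sum_veroneseVec
  have h0 : denom a β₀ ∅ * F = 0 := by
    refine eq_zero_of_forall_mem_isOpen hU hne fun y hy => ?_
    rw [map_mul, mul_eq_zero, or_iff_not_imp_left]
    intro hD
    obtain ⟨t, hli, -, hyt⟩ := hUt y hy
    have hD' := hD
    rw [aeval_denom, hsub, aronhold_eq_of_eq hyt, aronhold'_eq_of_eq hyt] at hD'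
    -- A sum of four cubes satisfies the equations, so it is the lift of its own coordinates of
    -- degree at most one in the last variable, and these are those of `y`.
    rw [← hF y hD, liftInv_congr hyt, liftInv_eq_self hD' (fun k => by
        simpa using secantEq_sum_smul_veroneseVec 1 t k)
      (by simpa using secantEq'_sum_smul_veroneseVec 1 t), hf, zero_mul]
    · refine act_mem_cubeSums (T := ⊤) (isUnit_nonsing_inv_det g hg) (fun t _ => ?_)
        (sum_veroneseVec_mem_cubeSums (fun _ => Submodule.mem_top) hli)
      rw [Projectivization.Subspace.submodule.map_top]
      exact Submodule.mem_top
    · intro h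
      refine sum_veroneseVec_ne_zero hli ?_
      rw [← act_act_of_mul_eq_one (mul_nonsing_inv _ hg) (∑ l, veroneseVec 3 3 (t l)), h, map_zero]
  rw [mem_secIdeal]
  intro s hs
  have h1 := congrArg (aeval s) h0
  rw [map_mul, map_zero, mul_eq_zero, or_iff_right hs, ← hF s hs, mul_eq_zero,
    or_iff_left (pow_ne_zero N hs)] at h1
  rwa [hsub]

end Chain

end VeroneseCubic

/-! ### Dimension and regularity of the local ring -/

namespace VeroneseCubic

open MvPolynomial Matrix

section Homogeneous

variable {σ : Type*}

theorem isHomogeneous_det {n : Type*} [Fintype n] [DecidableEq n]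
    {A : Matrix n n (MvPolynomial σ ℂ)} (hA : ∀ i j, (A i j).IsHomogeneous 1) :
    A.det.IsHomogeneous (Fintype.card n) := by
  rw [det_apply']
  refine IsHomogeneous.sum _ _ _ fun τ _ => ?_
  have h1 : (∏ i, A (τ i) i).IsHomogeneous (∑ _i : n, 1) :=
    IsHomogeneous.prod _ _ _ fun i _ => hA _ _
  have h2 : (((Equiv.Perm.sign τ : ℤ) : MvPolynomial σ ℂ)).IsHomogeneous 0 := by
    rw [← map_intCast (C : ℂ →+* MvPolynomial σ ℂ)]
    exact isHomogeneous_C _ _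
  simpa using h2.mul h1

theorem isHomogeneous_adjugate {n : ℕ} {A : Matrix (Fin (n + 1)) (Fin (n + 1)) (MvPolynomial σ ℂ)}
    (hA : ∀ i j, (A i j).IsHomogeneous 1) (i j : Fin (n + 1)) :
    (A.adjugate i j).IsHomogeneous n := by
  rw [adjugate_fin_succ_eq_det_submatrix]
  have h1 := isHomogeneous_det (A := A.submatrix j.succAbove i.succAbove) fun _ _ => hA _ _
  have h2 : ((-1 : MvPolynomial σ ℂ) ^ (j + i : ℕ)).IsHomogeneous 0 := by
    rw [← map_one (C : ℂ →+* MvPolynomial σ ℂ), ← map_neg, ← map_pow]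
    exact isHomogeneous_C _ _
  simpa using h2.mul h1

theorem isHomogeneous_bracket {n : ℕ}
    {A B C : Matrix (Fin (n + 1)) (Fin (n + 1)) (MvPolynomial σ ℂ)}
    (hA : ∀ i j, (A i j).IsHomogeneous 1) (hB : ∀ i j, (B i j).IsHomogeneous 1)
    (hC : ∀ i j, (C i j).IsHomogeneous 1) (i j : Fin (n + 1)) :
    (bracket A B C i j).IsHomogeneous (1 + n + 1) := by
  have key (i j) : ((B * A.adjugate * C) i j).IsHomogeneous (1 + n + 1) := by
    rw [Matrix.mul_apply]
    refine IsHomogeneous.sum _ _ _ fun k _ => IsHomogeneous.mul ?_ (hC k j)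
    rw [Matrix.mul_apply]
    exact IsHomogeneous.sum _ _ _ fun l _ => (hB i l).mul (isHomogeneous_adjugate hA l k)
  exact (key i j).sub (key j i)

theorem isHomogeneous_secantEq {y : MI → MvPolynomial σ ℂ} (hy : ∀ α, (y α).IsHomogeneous 1)
    (k : Fin 3) : (secantEq y k).IsHomogeneous 5 :=
  isHomogeneous_bracket (n := 3) (fun _ _ => hy _) (fun _ _ => hy _) (fun _ _ => hy _) _ _

theorem isHomogeneous_secantEq' {y : MI → MvPolynomial σ ℂ} (hy : ∀ α, (y α).IsHomogeneous 1) :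
    (secantEq' y).IsHomogeneous 5 :=
  isHomogeneous_bracket (n := 3) (fun _ _ => (hy _).add (hy _)) (fun _ _ => hy _)
    (fun _ _ => hy _) _ _

/-- The coordinate functions after a linear substitution. -/
noncomputable def coord (g : Matrix (Fin 4) (Fin 4) ℂ) : MI → MvPolynomial MI ℂ := act g X

theorem isHomogeneous_coord (g : Matrix (Fin 4) (Fin 4) ℂ) (α : MI) :
    (coord g α).IsHomogeneous 1 := by
  rw [coord, act_apply, tri_apply, ← mem_homogeneousSubmodule]
  exact sum_mem fun i _ => sum_mem fun j _ => sum_mem fun k _ =>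
    Submodule.smul_mem _ _ (isHomogeneous_X ℂ _)

theorem aeval_coord (g : Matrix (Fin 4) (Fin 4) ℂ) (s : MI → ℂ) (α : MI) :
    aeval s (coord g α) = act g s α := by
  rw [coord, map_act]
  simp

theorem aeval_secantEq_coord (g : Matrix (Fin 4) (Fin 4) ℂ) (s : MI → ℂ) (k : Fin 3) :
    aeval s (secantEq (coord g) k) = secantEq (act g s) k :=
  (map_secantEq (aeval s : MvPolynomial MI ℂ →ₐ[ℂ] ℂ).toRingHom _ k).trans
    (congrArg (secantEq · k) (_root_.funext (aeval_coord g s)))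

theorem aeval_secantEq'_coord (g : Matrix (Fin 4) (Fin 4) ℂ) (s : MI → ℂ) :
    aeval s (secantEq' (coord g)) = secantEq' (act g s) :=
  (map_secantEq' (aeval s : MvPolynomial MI ℂ →ₐ[ℂ] ℂ).toRingHom _).trans
    (congrArg secantEq' (_root_.funext (aeval_coord g s)))

theorem aeval_aronhold_coord (g : Matrix (Fin 4) (Fin 4) ℂ) (s : MI → ℂ) :
    aeval s (aronhold (coord g)) = aronhold (act g s) :=
  (map_aronhold (aeval s : MvPolynomial MI ℂ →ₐ[ℂ] ℂ).toRingHom _).trans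
    (congrArg aronhold (_root_.funext (aeval_coord g s)))

theorem aeval_aronhold'_coord (g : Matrix (Fin 4) (Fin 4) ℂ) (s : MI → ℂ) :
    aeval s (aronhold' (coord g)) = aronhold' (act g s) :=
  (map_aronhold' (aeval s : MvPolynomial MI ℂ →ₐ[ℂ] ℂ).toRingHom _).trans
    (congrArg aronhold' (_root_.funext (aeval_coord g s)))

theorem act_nonsing_inv_coord {g : Matrix (Fin 4) (Fin 4) ℂ} (hg : IsUnit g.det) :
    act g⁻¹ (coord g) = X := by
  funext α
  refine MvPolynomial.funext fun s => ?_
  rw [← coe_aeval_eq_eval]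
  change aeval s (act g⁻¹ (coord g) α) = aeval s (X α)
  rw [map_act, aeval_X]
  simp only [aeval_coord]
  rw [act_act_of_mul_eq_one (nonsing_inv_mul _ hg)]

theorem secantEq_coord_mem (g : Matrix (Fin 4) (Fin 4) ℂ) (k : Fin 3) :
    secantEq (coord g) k ∈ homogIdeal (secantVariety 4 (Set.range (veronese 3 3))) := by
  rw [range_veronese, mem_homogIdeal_secantVariety]
  rintro _ ⟨b, t, -, -, rfl⟩ -
  rw [aeval_secantEq_coord]
  simpa [act_veroneseVec] using secantEq_sum_smul_veroneseVec b (fun l => g *ᵥ t l) k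

theorem secantEq'_coord_mem (g : Matrix (Fin 4) (Fin 4) ℂ) :
    secantEq' (coord g) ∈ homogIdeal (secantVariety 4 (Set.range (veronese 3 3))) := by
  rw [range_veronese, mem_homogIdeal_secantVariety]
  rintro _ ⟨b, t, -, -, rfl⟩ -
  rw [aeval_secantEq'_coord]
  simpa [act_veroneseVec] using secantEq'_sum_smul_veroneseVec b (fun l => g *ᵥ t l)

end Homogeneous

theorem exists_equiv_multiIndex {β₀ : MI} (hβ : β₀.1 3 ≤ 1) :
    Nonempty (Fin 15 ≃ {α : MI // α.1 3 ≤ 1 ∧ α ≠ β₀}) := by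
  have h1 : {α : MI | α.1 3 ≤ 1}.ncard = 16 := by
    rw [← Nat.card_coe_set_eq]
    refine (card_multiIndex_le 1).trans ?_
    decide +kernel
  have h2 : ({α : MI | α.1 3 ≤ 1} \ {β₀}).ncard = 15 := by
    rw [Set.ncard_sdiff_singleton_of_mem (s := {α : MI | α.1 3 ≤ 1}) hβ, h1]
  rw [← Nat.card_coe_set_eq] at h2
  exact ⟨(Finite.equivFinOfCardEq h2).symm⟩

section Smooth

variable {g : Matrix (Fin 4) (Fin 4) ℂ} (hg : IsUnit g.det) {v : MI → ℂ} (hv : v ≠ 0)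
  (hy : ∀ i j, act g v (idx i j 3) = 0) (h0 : aronhold (act g v) ≠ 0) {β₀ : MI}
  (hβ : act g v β₀ ≠ 0)

/-- A linear form that takes the value one at `v`. -/
noncomputable def normForm (g : Matrix (Fin 4) (Fin 4) ℂ) (v : MI → ℂ) (β₀ : MI) :
    MvPolynomial MI ℂ := C (act g v β₀)⁻¹ * coord g β₀

theorem isHomogeneous_normForm (g : Matrix (Fin 4) (Fin 4) ℂ) (v : MI → ℂ) (β₀ : MI) :
    (normForm g v β₀).IsHomogeneous 1 := by
  simpa [normForm] using (isHomogeneous_C MI _).mul (isHomogeneous_coord g β₀)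

include hβ in
theorem aeval_normForm : aeval v (normForm g v β₀) = 1 := by
  rw [normForm, map_mul, aeval_C, aeval_coord, Algebra.algebraMap_self_apply, inv_mul_cancel₀ hβ]

include hβ in
theorem normForm_notMem : normForm g v β₀ ∉ homogIdeal {Projectivization.mk ℂ v hv} := by
  rw [mem_homogIdeal_singleton]
  intro h
  have := h 1 one_ne_zero
  rw [one_smul, aeval_normForm hβ] at this
  exact one_ne_zero this

include hy hβ in
theorem apply_three_eq_zero : β₀.1 3 = 0 := by
  by_contra h
  obtain ⟨i, j, rfl⟩ := exists_idx_last h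
  exact hβ (hy i j)

include hg hy h0 hβ in
theorem le_ringKrullDim_secantVariety :
    localIdeal (secantVariety 4 (Set.range (veronese 3 3))) (Projectivization.mk ℂ v hv) ≠ ⊤ ∧
      (15 : ℕ) ≤ ringKrullDim (VarietyLocalRing (secantVariety 4 (Set.range (veronese 3 3)))
        (Projectivization.mk ℂ v hv)) := by
  have hβ3 : β₀.1 3 ≤ 1 := by rw [apply_three_eq_zero hy hβ]; exact zero_le_one
  obtain ⟨e⟩ := exists_equiv_multiIndex hβ3
  let y := act g v
  let a : MI → ℂ := fun α => y α / y β₀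
  have ha : a β₀ = 1 := div_self hβ
  -- Of the sixteen free coordinates, `β₀` serves for dehomogenization; the other fifteen are made
  -- proportional to it one at a time, with the ratios of the given point. Each section therefore
  -- still passes through the point.
  let S : ℕ → Set MI := fun k => {α | ∃ i : Fin 15, i.1 < k ∧ (e i).1 = α}
  have hsubst (T : Set MI) (c : ℂ) : subst a β₀ T (c • y) = c • y := by
    funext α
    have hyβ : y β₀ ≠ 0 := hβ
    simp only [subst, Pi.smul_apply, smul_eq_mul, a]
    split_ifs
    · field_simp
    · rfl
  have hycz (c : ℂ) (i j) : (c • y) (idx i j 3) = 0 := by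
    exact (congrArg (c • ·) (hy i j)).trans (smul_zero c)
  have hD (T : Set MI) {c : ℂ} (hc : c ≠ 0) : aeval (c • y) (denom a β₀ T) ≠ 0 := by
    rw [aeval_denom, hsubst, aronhold'_eq_aronhold (hycz c), aronhold_smul]
    exact mul_self_ne_zero.mpr (mul_ne_zero (pow_ne_zero _ hc) h0)
  have hD0 (T : Set MI) : denom a β₀ T ≠ 0 := fun h => hD T one_ne_zero (by rw [h, map_zero])
  have hX (α : MI) (s : MI → ℂ) : aeval (act g⁻¹ s) (coord g α - C (a α) * coord g β₀) =
      s α - a α * s β₀ := by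
    rw [map_sub, map_mul, aeval_C, aeval_coord, aeval_coord,
      act_act_of_mul_eq_one (mul_nonsing_inv _ hg), Algebra.algebraMap_self_apply]
  refine le_ringKrullDim_varietyLocalRing _ _ (isHomogeneous_normForm g v β₀)
    (normForm_notMem hv hβ) (fun k => secIdeal a β₀ (S k) g)
    (fun k => imageIdeal_isPrime (hD0 _) _) ?_ ?_ ?_ ?_
  · have : S 0 = ∅ := by
      ext α
      simp [S]
    rw [this]
    exact homogIdeal_secantVariety_le_secIdeal hg
  · intro k l hkl
    exact secIdeal_mono _ _ _ ha fun α ⟨i, hi, h⟩ => ⟨i, hi.trans_le hkl, h⟩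
  · intro k f hf
    rw [mem_homogIdeal_singleton]
    intro c hc
    have h1 := (mem_secIdeal _ _ _ _).mp hf (c • y) (hD _ hc)
    rw [hsubst, liftInv_eq_self _ (secantEq_eq_zero (hycz c)) (secantEq'_eq_zero (hycz c)),
      map_smul, act_act_of_mul_eq_one (nonsing_inv_mul _ hg)] at h1
    · exact h1
    · have h2 := hD ∅ hc
      rwa [aeval_denom, hsubst] at h2
  · intro k hk
    set α := (e ⟨k, hk⟩).1 with hα
    obtain ⟨hα1, hα2⟩ := (e ⟨k, hk⟩).2
    rw [← hα] at hα1 hα2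
    refine ⟨coord g α - C (a α) * coord g β₀, ?_, ?_, fun h => ?_⟩
    · refine (isHomogeneous_coord g α).sub ?_
      simpa using (isHomogeneous_C MI (a α)).mul (isHomogeneous_coord g β₀)
    · rw [mem_secIdeal]
      intro s _
      have hαS : α ∈ S (k + 1) := ⟨⟨k, hk⟩, Nat.lt_succ_self k, rfl⟩
      rw [hX, liftInv_apply _ hα1, liftInv_apply _ hβ3]
      simp [subst, hαS, ha]
    · have hαS : α ∉ S k := by
        rintro ⟨i, hi, h⟩
        have := e.injective (Subtype.ext h)
        rw [this] at hi
        exact lt_irrefl _ hi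
      -- The parametrization preserves coordinates of degree at most one in the last variable, so
      -- the form pulls back to `X α - C (a α) * X β₀`, which is not zero.
      have hz : denom a β₀ (S k) * (X α - C (a α) * X β₀) = 0 := by
        refine MvPolynomial.funext fun s => ?_
        rw [map_zero, ← coe_aeval_eq_eval]
        change aeval s (denom a β₀ (S k) * (X α - C (a α) * X β₀)) = 0
        rw [map_mul, mul_eq_zero, or_iff_not_imp_left]
        intro hs
        have h1 := (mem_secIdeal _ _ _ _).mp h s hs
        rw [hX, liftInv_apply _ hα1, liftInv_apply _ hβ3] at h1
        simpa [subst, hαS, ha] using h1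
      have h1 := congrArg (aeval (Pi.single α (1 : ℂ) : MI → ℂ)) ((mul_eq_zero.mp hz).resolve_left (hD0 _))
      simp [Pi.single_eq_of_ne hα2.symm] at h1

include hg hy h0 hβ in
theorem isRegularLocalRing_secantVariety :
    IsRegularLocalRing (VarietyLocalRing (secantVariety 4 (Set.range (veronese 3 3)))
      (Projectivization.mk ℂ v hv)) := by
  obtain ⟨hne, hdim⟩ := le_ringKrullDim_secantVariety hg hv hy h0 hβ
  set p := Projectivization.mk ℂ v hv with hp
  set V := secantVariety 4 (Set.range (veronese 3 3)) with hV
  have hβ3 : β₀.1 3 ≤ 1 := by rw [apply_three_eq_zero hy hβ]; exact zero_le_one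
  obtain ⟨e⟩ := exists_equiv_multiIndex hβ3
  have hL := isHomogeneous_normForm g v β₀
  have hLp := normForm_notMem hv hβ
  have hLv := aeval_normForm hβ
  let δ := dehom p _ hL hLp
  let ψ : MvPolynomial MI ℂ →+* VarietyLocalRing V p := (Ideal.Quotient.mk (localIdeal V p)).comp δ
  have hψ {f : MvPolynomial MI ℂ} (hf : f.IsHomogeneous 5) (hfV : f ∈ homogIdeal V) : ψ f = 0 :=
    Ideal.Quotient.eq_zero_iff_mem.mpr (dehom_mem_localIdeal p _ hL hLp hf hfV)
  have : IsNoetherianRing (ProjLocalRing p) := isNoetherianRing_projLocalRing p _ hL hLp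
  have : Nontrivial (VarietyLocalRing V p) := Ideal.Quotient.nontrivial_iff.mpr hne
  have : IsLocalRing (VarietyLocalRing V p) :=
    IsLocalRing.of_surjective' (Ideal.Quotient.mk (localIdeal V p)) Ideal.Quotient.mk_surjective
  let w : MI → MvPolynomial MI ℂ := fun α => coord g α - C (act g v α)
  have hw (α) : δ (w α) ∈ IsLocalRing.maximalIdeal (ProjLocalRing p) := by
    have h1 := Ideal.mem_map_of_mem δ (sub_C_aeval_mem v (coord g α))
    rw [Ideal.map_span, ← Set.range_comp, aeval_coord] at h1
    exact (maximalIdeal_projLocalRing p _ hL hLp hv hp hLv).ge h1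
  let I : Ideal (VarietyLocalRing V p) := Ideal.span (Set.range fun i : Fin 15 => ψ (w (e i)))
  have hgen {α : MI} (hα : α.1 3 ≤ 1) : ψ (w α) ∈ I := by
    by_cases h : α = β₀
    · have h1 : w α = C (act g v β₀) * (normForm g v β₀ - 1) := by
        rw [normForm, mul_sub, ← mul_assoc, ← C_mul, mul_inv_cancel₀ hβ, C_1, one_mul, mul_one, ← h]
      have h2 : ψ (w α) = 0 := by
        change Ideal.Quotient.mk _ (δ (w α)) = 0
        rw [h1, map_mul, map_sub, map_one]
        have : δ (normForm g v β₀) = 1 := dehom_self p _ hL hLp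
        rw [this, sub_self, mul_zero, map_zero]
      rw [h2]
      exact zero_mem _
    · obtain ⟨i, hi⟩ := e.surjective ⟨α, hα, h⟩
      exact Ideal.subset_span ⟨i, by simp only [hi]⟩
  have hwl (i j) : w (idx i j 3) = coord g (idx i j 3) := by
    simp only [w, hy, C_0, sub_zero]
  have hlast : ∀ i j, ψ (coord g (idx i j 3)) ∈ I := by
    -- The equations hold in the local ring and both Aronhold invariants are units there, so the
    -- four remaining coordinates lie in the ideal of the fifteen generators.
    refine idx_three_mem (y := fun α => ψ (coord g α)) ?_ ?_ (fun k => ?_) ?_ fun i j hi hj => ?_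
    · rw [← map_aronhold ψ]
      refine (isUnit_dehom p _ hL hLp hv hp hLv ?_).map (Ideal.Quotient.mk _)
      rwa [aeval_aronhold_coord]
    · rw [← map_aronhold' ψ]
      refine (isUnit_dehom p _ hL hLp hv hp hLv ?_).map (Ideal.Quotient.mk _)
      rwa [aeval_aronhold'_coord, aronhold'_eq_aronhold hy]
    · rw [← map_secantEq ψ]
      exact hψ (isHomogeneous_secantEq (isHomogeneous_coord g) k) (secantEq_coord_mem g k)
    · rw [← map_secantEq' ψ]
      exact hψ (isHomogeneous_secantEq' (isHomogeneous_coord g)) (secantEq'_coord_mem g)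
    · rw [← hwl]
      exact hgen (idx_last_le hi hj 3)
  have hall (α : MI) : ψ (w α) ∈ I := by
    by_cases h : α.1 3 = 0
    · exact hgen (by omega)
    · obtain ⟨i, j, rfl⟩ := exists_idx_last h
      rw [hwl]
      exact hlast i j
  have hX (α : MI) : ψ (X α - C (v α)) ∈ I := by
    have h1 : X α - C (v α) = act g⁻¹ w α := by
      have h2 : w = coord g - fun α => C (act g v α) := rfl
      rw [h2, map_sub, Pi.sub_apply, act_nonsing_inv_coord hg]
      congr 1
      have h3 := map_act (Algebra.ofId ℂ (MvPolynomial MI ℂ)) g⁻¹ (act g v) α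
      rw [act_act_of_mul_eq_one (nonsing_inv_mul _ hg)] at h3
      exact h3
    rw [h1, act_apply, tri_apply]
    simp only [map_sum, smul_eq_C_mul, map_mul ψ]
    exact sum_mem fun i _ => sum_mem fun j _ => sum_mem fun k _ => I.mul_mem_left _ (hall _)
  have hmax : IsLocalRing.maximalIdeal (VarietyLocalRing V p) = I := by
    apply le_antisymm
    · intro x hx
      obtain ⟨x, rfl⟩ := Ideal.Quotient.mk_surjective x
      have hx' : x ∈ IsLocalRing.maximalIdeal (ProjLocalRing p) :=
        fun h => hx (h.map (Ideal.Quotient.mk _))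
      rw [maximalIdeal_projLocalRing p _ hL hLp hv hp hLv] at hx'
      have h1 := Ideal.mem_map_of_mem (Ideal.Quotient.mk (localIdeal V p)) hx'
      rw [Ideal.map_span] at h1
      refine (Ideal.span_le.mpr ?_) h1
      rintro _ ⟨_, ⟨α, rfl⟩, rfl⟩
      exact hX α
    · refine Ideal.span_le.mpr ?_
      rintro _ ⟨i, rfl⟩ hu
      have := IsLocalHom.of_surjective (Ideal.Quotient.mk (localIdeal V p))
        Ideal.Quotient.mk_surjective
      exact hw _ (isUnit_of_map_unit (Ideal.Quotient.mk (localIdeal V p)) _ hu)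
  -- Fifteen generators of the maximal ideal meet the lower bound 15 for the dimension.
  refine IsRegularLocalRing.of_spanFinrank_maximalIdeal_le _ (le_trans ?_ hdim)
  rw [hmax]
  have h1 := Submodule.spanFinrank_span_le_ncard_of_finite (R := VarietyLocalRing V p)
    (Set.finite_range fun i : Fin 15 => ψ (w (e i)))
  refine Nat.cast_le.mpr (h1.trans ?_)
  rw [← Set.image_univ]
  refine (Set.ncard_image_le Set.finite_univ).trans ?_
  simp [Set.ncard_univ]

end Smooth

end VeroneseCubic

/-! ### Points off the third secant variety and the conclusion -/

namespace VeroneseCubic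

open MvPolynomial Matrix

/-- If the invariant vanished, the cubic would be a classical limit of sums of three cubes, hence a
point of the Zariski closed third secant variety. -/
theorem aronhold_ne_zero_of_notMem {g : Matrix (Fin 4) (Fin 4) ℂ} (hg : IsUnit g.det) {v : MI → ℂ}
    (hv : v ≠ 0) (hy : ∀ i j, act g v (idx i j 3) = 0)
    (h : Projectivization.mk ℂ v hv ∉ secantVariety 3 (Set.range (veronese 3 3))) :
    aronhold (act g v) ≠ 0 := by
  intro h0
  apply h
  rw [range_veronese]
  refine mk_mem_secantVariety_of_mem_closure hv ?_
  rw [Projectivization.Subspace.submodule.map_top,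
    ← act_act_of_mul_eq_one (nonsing_inv_mul _ hg) v]
  exact map_mem_closure (act (R := ℂ) g⁻¹).continuous_of_finiteDimensional
    (mem_closure_cubeSums_of_aronhold_eq_zero h0 hy)
    fun s hs => act_mem_cubeSums (isUnit_nonsing_inv_det g hg) (fun _ _ => Submodule.mem_top) hs

theorem secantVariety_subset_secantVariety_range (k : ℕ)
    (P : Projectivization.Subspace ℂ (Fin 4 → ℂ)) :
    secantVariety k (veronese 3 3 '' (P : Set (ℙ ℂ (Fin 4 → ℂ)))) ⊆
      secantVariety k (Set.range (veronese 3 3)) := by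
  intro p hp
  induction p using Projectivization.ind with | h v hv =>
  rw [mk_mem_secantVariety] at hp
  rw [range_veronese, mk_mem_secantVariety]
  refine fun f hf => hp f fun s ⟨b, t, _, hli, hs⟩ hs0 => hf s ⟨b, t, fun _ => ?_, hli, hs⟩ hs0
  rw [Projectivization.Subspace.submodule.map_top]
  exact Submodule.mem_top

end VeroneseCubic

open VeroneseCubic in
/-- For every plane `ℙ² ⊂ ℙ³`, the variety `σ₄(v₃(ℙ²))` is the linear span of `v₃(ℙ²)`, a `9`-plane
in `ℙ¹⁹`, and `σ₄(v₃(ℙ³))` is smooth at all points of `σ₄(v₃(ℙ²)) \ σ₃(v₃(ℙ³))`. -/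
theorem corollary1p2 (P : Projectivization.Subspace ℂ (Fin 4 → ℂ))
    (hP : Module.finrank ℂ (Projectivization.Subspace.submodule P) = 3) :
    (∀ p ∈ secantVariety 4 (veronese 3 3 '' (P : Set (ℙ ℂ (Fin 4 → ℂ)))) \
        secantVariety 3 (Set.range (veronese 3 3)),
      IsSmoothAt (secantVariety 4 (Set.range (veronese 3 3))) p) ∧
    secantVariety 4 (veronese 3 3 '' (P : Set (ℙ ℂ (Fin 4 → ℂ)))) =
      (Projectivization.Subspace.span
        (veronese 3 3 '' (P : Set (ℙ ℂ (Fin 4 → ℂ)))) : Set (ℙ ℂ (MultiIndex 3 3 → ℂ))) ∧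
    Module.finrank ℂ (Projectivization.Subspace.submodule (Projectivization.Subspace.span
      (veronese 3 3 '' (P : Set (ℙ ℂ (Fin 4 → ℂ)))))) = 10 := by
  obtain ⟨g, hg, hgP⟩ := exists_matrix_forall_mem_iff hP
  refine ⟨fun p hp => ⟨secantVariety_subset_secantVariety_range 4 P hp.1, ?_⟩,
    secantVariety_eq_span hg hgP, by rw [submodule_span_veronese hg hgP, finrank_planeCubics hg]⟩
  obtain ⟨h4, h3⟩ := hp
  induction p using Projectivization.ind with | h v hv =>
  rw [secantVariety_eq_span hg hgP, SetLike.mem_coe,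
    ← Projectivization.Subspace.mem_submodule_iff _ hv, submodule_span_veronese hg hgP] at h4
  have h0 := aronhold_ne_zero_of_notMem hg hv h4 h3
  obtain ⟨β₀, hβ⟩ : ∃ β₀, act g v β₀ ≠ 0 := by
    by_contra! h
    apply hv
    rw [← act_act_of_mul_eq_one (Matrix.nonsing_inv_mul _ hg) v, funext h]
    exact map_zero _
  exact isRegularLocalRing_secantVariety hg hv h4 h0 hβ
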